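/- Let $\rho$ be a density matrix (positive semidefinite, trace one) on $\mathbb C^2\otimes\mathbb C^2$ that is entangled, i.e. not a finite convex combination of product states $\sigma_1\otimes\sigma_2$. For $2\times 2$ complex matrices $A,B$ with $\operatorname{Tr}\big((A\otimes B)\rho(A\otimes B)^\dagger\big)\neq 0$, the local operation $\Theta=\Theta_{A,B}$ sends $\rho$ to $$\Theta(\rho)=\frac{(A\otimes B)\,\rho\,(A\otimes B)^\dagger}{\operatorname{Tr}\big((A\otimes B)\,\rho\,(A\otimes B)^\dagger\big)} .$$ Let $E_F(\rho)=\inf\sum_i p_i\,S\big(\operatorname{Tr}_2|\psi_i\rangle\langle\psi_i|\big)$ be the entanglement of formation, where the infimum is over all finite ensembles of unit vectors $\psi_i$ with probabilities $p_i$ such that $\rho=\sum_i p_i|\psi_i\rangle\langle\psi_i|$, and $S(\sigma)=-\operatorname{Tr}\sigma\log_2\sigma$. Put $M_\rho=\sup_\Theta E_F(\Theta(\rho))$, the supremum being over all local operations. The Bell states are the projectors onto $\tfrac1{\sqrt2}(|00\rangle\pm|11\rangle)$ and $\tfrac1{\sqrt2}(|01\rangle\pm|10\rangle)$, and a matrix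 is Bell-diagonal if it is diagonal in this basis. A product vector is a nonzero vector of the form $a\otimes b$; product vectors are counted up to scalar multiples. The support of $\rho$ is its range. Call $\rho$ - *incompletely distillable* if $M_\rho<1$ and there is a local operation $\Xi$ with $E_F(\Xi(\rho))=M_\rho$ and $\Xi(\rho)$ Bell-diagonal; - *incompletely quasi-distillable* if $M_\rho<1$, no local operation $\Xi$ has $E_F(\Xi(\rho))=M_\rho$, and there are local operations $\Xi_n$ such that $\sigma=\lim_{n\to\infty}\Xi_n(\rho)$ exists, is Bell-diagonal and satisfies $E_F(\sigma)=M_\rho$; - *quasi-distillable* if $M_\rho=1$, no local operation $\Xi$ has $E_F(\Xi(\rho))=1$, and there are local operations $\Xi_n$ such that $\lim_{n\to\infty}\Xi_n(\rho)$ exists and is a Bell state; - *distillable* if $M_\rho=1$ and there is a local operation $\Xi$ such that $\Xi(\rho)$ is a Bell state. Assume that $\rho$ is not Bell-diagonal. Then one of the following holds. - **I.** $\operatorname{rank}\rho=4$, and $\rho$ is incompletely distillable. - **II.** $\operatorname{rank}\rho=3$, and either (i) the kernel of $\rho$ contains no product vector and $\rho$ is incompletely distillable, or (ii) the kernel of $\rho$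 is the linear span of a product vector and $\rho$ is incompletely quasi-distillable. - **III.** $\operatorname{rank}\rho=2$, and either (i) the support of $\rho$ contains, up to scalars, exactly one product vector and $\rho$ is quasi-distillable, or (ii) the support of $\rho$ contains, up to scalars, exactly two product vectors and $\rho$ is incompletely distillable. - **IV.** $\operatorname{rank}\rho=1$, and $\rho$ is distillable. -/

import Mathlib

open Matrix Filter Topology
open scoped Kronecker ComplexOrder

namespace TwoQubit

/-- The basis labels `(i, j)` of `ℂ² ⊗ ℂ²`. -/
abbrev Q : Type := Fin 2 × Fin 2

/-- A density matrix (state): positive semidefinite of trace one. -/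
def IsState {n : Type} [Fintype n] (ρ : Matrix n n ℂ) : Prop :=
  ρ.PosSemidef ∧ ρ.trace = 1

/-- The matrix `|ψ⟩⟨ψ|`. -/
def ketbra {n : Type} (ψ : n → ℂ) : Matrix n n ℂ :=
  Matrix.vecMulVec ψ (star ψ)

/-- Separable states: finite convex combinations of product states. -/
def IsSeparable (ρ : Matrix Q Q ℂ) : Prop :=
  ρ ∈ convexHull ℝ {σ : Matrix Q Q ℂ | ∃ σ₁ σ₂ : Matrix (Fin 2) (Fin 2) ℂ,
    IsState σ₁ ∧ IsState σ₂ ∧ σ = σ₁ ⊗ₖ σ₂}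

/-- Entangled states. -/
def IsEntangled (ρ : Matrix Q Q ℂ) : Prop :=
  IsState ρ ∧ ¬ IsSeparable ρ

/-! ### Entanglement of formation -/

/-- The partial trace over the second qubit. -/
def partialTrace₂ (ρ : Matrix Q Q ℂ) : Matrix (Fin 2) (Fin 2) ℂ :=
  Matrix.of fun i k => ∑ j, ρ (i, j) (k, j)

theorem isHermitian_partialTrace₂_ketbra (ψ : Q → ℂ) :
    (partialTrace₂ (ketbra ψ)).IsHermitian := by
  ext i k
  simp [partialTrace₂, ketbra, Matrix.vecMulVec_apply, mul_comm]

/-- The von Neumann entropy `-Tr σ log₂ σ` of a Hermitian matrix. -/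
noncomputable def entropy {n : Type} [Fintype n] [DecidableEq n] (σ : Matrix n n ℂ)
    (hσ : σ.IsHermitian) : ℝ :=
  ∑ i, Real.negMulLog (hσ.eigenvalues i) / Real.log 2

/-- The entanglement of a pure state `ψ`: the entropy of its reduced density matrix. -/
noncomputable def pureEntanglement (ψ : Q → ℂ) : ℝ :=
  entropy (partialTrace₂ (ketbra ψ)) (isHermitian_partialTrace₂_ketbra ψ)

/-- The entanglement of formation: the infimum of the average pure-state entanglement over all
finite ensembles of unit vectors realizing `ρ`. -/
noncomputable def entanglementOfFormation (ρ : Matrix Q Q ℂ) : ℝ :=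
  sInf {x : ℝ | ∃ (n : ℕ) (p : Fin n → ℝ) (ψ : Fin n → Q → ℂ),
    (∀ i, 0 ≤ p i) ∧ ∑ i, p i = 1 ∧ (∀ i, ∑ q, ‖ψ i q‖ ^ 2 = 1) ∧
    ρ = ∑ i, p i • ketbra (ψ i) ∧ x = ∑ i, p i * pureEntanglement (ψ i)}

/-! ### Local operations -/

/-- The unnormalized outcome `(A ⊗ B) ρ (A ⊗ B)†`. -/
def filtered (A B : Matrix (Fin 2) (Fin 2) ℂ) (ρ : Matrix Q Q ℂ) : Matrix Q Q ℂ :=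
  (A ⊗ₖ B) * ρ * (A ⊗ₖ B)ᴴ

/-- The filtration by `A ⊗ B` has non-zero success probability on `ρ`. -/
def Admissible (A B : Matrix (Fin 2) (Fin 2) ℂ) (ρ : Matrix Q Q ℂ) : Prop :=
  (filtered A B ρ).trace ≠ 0

/-- The outcome `Θ(ρ)` of the local operation given by `A ⊗ B`. -/
noncomputable def localOp (A B : Matrix (Fin 2) (Fin 2) ℂ) (ρ : Matrix Q Q ℂ) : Matrix Q Q ℂ :=
  (filtered A B ρ).trace⁻¹ • filtered A B ρ

/-- `M_ρ`, the supremum of the entanglement of formation over all local operations. -/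
noncomputable def maxEF (ρ : Matrix Q Q ℂ) : ℝ :=
  sSup {x : ℝ | ∃ A B : Matrix (Fin 2) (Fin 2) ℂ,
    Admissible A B ρ ∧ x = entanglementOfFormation (localOp A B ρ)}

/-! ### Bell states and product vectors -/

/-- The Bell vectors `(|0,x⟩ + (-1)^z |1,1-x⟩)/√2`. -/
noncomputable def bellVector (x z : Fin 2) : Q → ℂ := fun q =>
  if q.2 = q.1 + x then (-1) ^ (z.val * q.1.val) / (Real.sqrt 2 : ℂ) else 0

/-- `σ` is (the density matrix of) one of the four Bell states. -/
def IsBellState (σ : Matrix Q Q ℂ) : Prop :=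
  ∃ x z, σ = ketbra (bellVector x z)

/-- `σ` is diagonal in the Bell basis. -/
def IsBellDiagonal (σ : Matrix Q Q ℂ) : Prop :=
  ∃ w : Fin 2 → Fin 2 → ℝ, σ = ∑ x, ∑ z, w x z • ketbra (bellVector x z)

/-- Non-zero vectors of the form `a ⊗ b`. -/
def IsProductVector (v : Q → ℂ) : Prop :=
  v ≠ 0 ∧ ∃ a b : Fin 2 → ℂ, v = fun q => a q.1 * b q.2

/-- The kernel of `ρ`. -/
def kernel (ρ : Matrix Q Q ℂ) : Submodule ℂ (Q → ℂ) :=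
  LinearMap.ker ρ.mulVecLin

/-- The support of a self-adjoint matrix `ρ`: its range, which is the orthogonal complement of
its kernel. -/
def support (ρ : Matrix Q Q ℂ) : Submodule ℂ (Q → ℂ) :=
  LinearMap.range ρ.mulVecLin

/-- The set of lines in `U` that are spanned by a product vector, so that its cardinality is the
number of product vectors in `U` up to scalars. -/
def productLines (U : Submodule ℂ (Q → ℂ)) : Set (Submodule ℂ (Q → ℂ)) :=
  {L | ∃ v ∈ U, IsProductVector v ∧ L = Submodule.span ℂ {v}}

/-! ### The four types of behaviour -/

/-- `M_ρ < 1` is attained by a Bell-diagonal outcome. -/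
def IncompletelyDistillable (ρ : Matrix Q Q ℂ) : Prop :=
  maxEF ρ < 1 ∧ ∃ A B : Matrix (Fin 2) (Fin 2) ℂ, Admissible A B ρ ∧
    entanglementOfFormation (localOp A B ρ) = maxEF ρ ∧ IsBellDiagonal (localOp A B ρ)

/-- `M_ρ < 1` is not attained, but outcomes converge to a Bell-diagonal state `σ` with
`E_F(σ) = M_ρ`. -/
def IncompletelyQuasiDistillable (ρ : Matrix Q Q ℂ) : Prop :=
  maxEF ρ < 1 ∧
  (¬ ∃ A B : Matrix (Fin 2) (Fin 2) ℂ, Admissible A B ρ ∧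
    entanglementOfFormation (localOp A B ρ) = maxEF ρ) ∧
  ∃ (A B : ℕ → Matrix (Fin 2) (Fin 2) ℂ) (σ : Matrix Q Q ℂ),
    (∀ n, Admissible (A n) (B n) ρ) ∧
    Tendsto (fun n => localOp (A n) (B n) ρ) atTop (𝓝 σ) ∧
    IsBellDiagonal σ ∧ entanglementOfFormation σ = maxEF ρ

/-- `M_ρ = 1` is not attained, but outcomes converge to a Bell state. -/
def QuasiDistillable (ρ : Matrix Q Q ℂ) : Prop :=
  maxEF ρ = 1 ∧
  (¬ ∃ A B : Matrix (Fin 2) (Fin 2) ℂ, Admissible A B ρ ∧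
    entanglementOfFormation (localOp A B ρ) = 1) ∧
  ∃ (A B : ℕ → Matrix (Fin 2) (Fin 2) ℂ) (σ : Matrix Q Q ℂ),
    (∀ n, Admissible (A n) (B n) ρ) ∧
    Tendsto (fun n => localOp (A n) (B n) ρ) atTop (𝓝 σ) ∧ IsBellState σ

/-- `M_ρ = 1`, and a Bell state is an outcome. -/
def Distillable (ρ : Matrix Q Q ℂ) : Prop :=
  maxEF ρ = 1 ∧ ∃ A B : Matrix (Fin 2) (Fin 2) ℂ, Admissible A B ρ ∧
    IsBellState (localOp A B ρ)

end TwoQubit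

/-!
The proof brings an entangled state to a normal form by an invertible local filter and reads the
behaviour off the normal form; all four notions of distillability, the rank and the number of
product vectors in the support are unchanged by invertible filters.

The entanglement of formation is controlled through the concurrence. For a vector `v` of
`ℂ² ⊗ ℂ²`, seen as a `2 × 2` matrix, the concurrence is `2 |det v|`, and `pureEntanglement_eq`
writes the entanglement of a unit vector as a convex increasing function `concEntropy` of it. A
filter `A ⊗ B` multiplies concurrences by `|det A det B|`, so for an operator `K` of concurrence `C`
the outcome of the filter has entanglement of formation at most
`concEntropy (C |det A det B| / Tr (A ⊗ B) K (A ⊗ B)†)`, with equality if the filter is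
invertible. The upper bound needs an ensemble whose members all have the same concurrence; it comes
from remixing a diagonal ensemble by an isometry (`exists_isometry_diag_eq_zero`). Hence `M_ρ` is
governed by the infimum of the filtered trace over matrices of determinant one, and is attained
exactly when that infimum is. The structure `HasConcurrence` packages the data needed for this.

If the kernel of `ρ` contains no product vector, then the filtered trace is coercive and attains its
minimum (`exists_minimizer`). At a minimizer both marginals are multiples of the identity, which
makes the operator a real symmetric matrix in the magic basis. Identifying that basis with the
quaternion units, its eigenvectors form an orthonormal frame of quaternions, and such a frame is
moved to the standard one by left and right multiplication by unit quaternions, that is, by local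
unitaries (`exists_frame_eq`). So `ρ` has a Bell-diagonal normal form
(`exists_filtered_eq_bellDiag`). A Bell-diagonal operator in which no weight exceeds the sum of the
others is separable (`isSeparable_of_eq_filtered_bellDiag`); otherwise it minimizes the filtered
trace itself, and it is incompletely distillable unless its rank is one. The rank is at least three
here, because a plane of vectors always meets the quadric of product vectors.

If the kernel contains a product vector, it can be moved to `|11⟩`. Triangular and diagonal filters
then lead to the normal form `asymState r a b`, a mixture of `|00⟩` and two Bell states with
weights `a > b` (`exists_filtered_eq_asymState`). Filtering by `diag(ε, 1)` on both qubits damps the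
component `|00⟩`; when `r > 0` the infimum of the filtered trace is approached in this way and not
attained. The four cases according to whether `r` and `b` vanish are the remaining cases of the
classification (`classification_of_productVector_mem_kernel`).
-/

namespace TwoQubit

/-! ### The entropy of a pure state as a function of its concurrence -/

/-- The entanglement of a pure two-qubit state as a function of its concurrence `c`. -/
noncomputable def concEntropy (c : ℝ) : ℝ :=
  Real.binEntropy ((1 + √(1 - c ^ 2)) / 2) / Real.log 2

theorem continuous_concEntropy : Continuous concEntropy := by
  unfold concEntropy
  fun_prop

theorem concEntropy_one : concEntropy 1 = 1 := by
  have : (1 / 2 : ℝ) = 2⁻¹ := by norm_num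
  simp only [concEntropy, one_pow, sub_self, Real.sqrt_zero, add_zero, this,
    Real.binEntropy_two_inv]
  exact div_self (Real.log_pos one_lt_two).ne'

theorem concEntropy_le_one (c : ℝ) : concEntropy c ≤ 1 :=
  (div_le_one (Real.log_pos one_lt_two)).2 Real.binEntropy_le_log_two

theorem strictMonoOn_concEntropy : StrictMonoOn concEntropy (Set.Icc 0 1) := by
  intro a ha b hb hab
  have hsq : a ^ 2 < b ^ 2 := by nlinarith [ha.1]
  have h1 : √(1 - b ^ 2) < √(1 - a ^ 2) :=
    Real.sqrt_lt_sqrt (by nlinarith [hb.1, hb.2]) (by linarith)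
  have h0 := Real.sqrt_nonneg (1 - b ^ 2)
  have h2 : √(1 - a ^ 2) ≤ 1 := by
    exact Real.sqrt_le_one.2 (by nlinarith [sq_nonneg a])
  refine div_lt_div_of_pos_right ?_ (Real.log_pos one_lt_two)
  refine Real.binEntropy_strictAntiOn ⟨?_, ?_⟩ ⟨?_, ?_⟩ ?_ <;> linarith

theorem convexOn_sinh : ConvexOn ℝ (Set.Ici 0) Real.sinh := by
  refine MonotoneOn.convexOn_of_deriv (convex_Ici 0) Real.continuous_sinh.continuousOn
    Real.differentiable_sinh.differentiableOn ?_
  intro x hx y hy hxy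
  rw [interior_Ici] at hx hy
  rw [Real.deriv_sinh]
  have hx' : (0 : ℝ) < x := hx
  exact Real.cosh_le_cosh.2 (by rwa [abs_of_pos hx', abs_of_pos (hx'.trans_le hxy)])

theorem div_sinh_le_div_sinh {u v : ℝ} (hu : 0 < u) (huv : u ≤ v) :
    v / Real.sinh v ≤ u / Real.sinh u := by
  have hv := hu.trans_le huv
  rw [div_le_div_iff₀ (Real.sinh_pos_iff.2 hv) (Real.sinh_pos_iff.2 hu)]
  have h1 : u / v ≤ 1 := (div_le_one hv).2 huv
  have h := convexOn_sinh.2 (Set.mem_Ici.2 le_rfl) (Set.mem_Ici.2 hv.le)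
    (sub_nonneg.2 h1) (div_nonneg hu.le hv.le) (sub_add_cancel 1 (u / v))
  simp only [smul_eq_mul, mul_zero, Real.sinh_zero, zero_add] at h
  rw [div_mul_cancel₀ _ hv.ne', div_mul_eq_mul_div, le_div_iff₀ hv] at h
  linarith

/-- With `y = √(1 - c²)` and `u = artanh y`, the derivative at `c` is `u / (sinh u · log 2)`. -/
theorem hasDerivAt_concEntropy {c : ℝ} (h0 : 0 < c) (h1 : c < 1) :
    HasDerivAt concEntropy (Real.artanh √(1 - c ^ 2) / Real.sinh (Real.artanh √(1 - c ^ 2))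
      / Real.log 2) c := by
  have hpos : 0 < 1 - c ^ 2 := by nlinarith
  set y := √(1 - c ^ 2) with hy
  have hy0 : 0 < y := Real.sqrt_pos.2 hpos
  have hyy : y ^ 2 = 1 - c ^ 2 := Real.sq_sqrt hpos.le
  have hy1 : y < 1 := by nlinarith
  have hmem : y ∈ Set.Ioo (-1 : ℝ) 1 := ⟨by linarith, hy1⟩
  have hs : Real.sinh (Real.artanh y) = y / c := by
    rw [Real.sinh_artanh hmem, hyy, sub_sub_cancel, Real.sqrt_sq h0.le]
  have ha : Real.artanh y = 1 / 2 * Real.log ((1 + y) / (1 - y)) :=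
    Real.artanh_eq_half_log ⟨hmem.1.le, hmem.2.le⟩
  rw [hs, ha, Real.log_div (by linarith) (by linarith)]
  have d1 : HasDerivAt (fun c : ℝ => 1 - c ^ 2) (-(2 * c)) c := by
    simpa using (hasDerivAt_pow 2 c).const_sub 1
  have d2 := ((d1.sqrt hpos.ne').const_add 1).div_const 2
  have d3 := (Real.hasDerivAt_binEntropy (p := (1 + y) / 2) (by linarith) (by linarith))
  have d4 := (HasDerivAt.comp c d3 d2).div_const (Real.log 2)
  refine d4.congr_deriv ?_
  rw [← hy]
  have e1 : 1 - (1 + y) / 2 = (1 - y) / 2 := by ring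
  rw [e1, Real.log_div (by linarith) two_ne_zero, Real.log_div (by linarith) two_ne_zero]
  field_simp
  ring

theorem convexOn_concEntropy : ConvexOn ℝ (Set.Icc 0 1) concEntropy := by
  refine MonotoneOn.convexOn_of_deriv (convex_Icc 0 1) continuous_concEntropy.continuousOn ?_ ?_
  · rw [interior_Icc]
    exact fun c hc => (hasDerivAt_concEntropy hc.1 hc.2).differentiableAt.differentiableWithinAt
  · rw [interior_Icc]
    intro a ha b hb hab
    rw [(hasDerivAt_concEntropy ha.1 ha.2).deriv, (hasDerivAt_concEntropy hb.1 hb.2).deriv]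
    have hb2 : b ^ 2 < 1 := by nlinarith [hb.1, hb.2]
    have hab2 : a ^ 2 ≤ b ^ 2 := by nlinarith [ha.1]
    have hbpos : 0 < √(1 - b ^ 2) := Real.sqrt_pos.2 (by linarith)
    have ha1 : √(1 - a ^ 2) < 1 := by
      rw [Real.sqrt_lt' one_pos]; nlinarith [ha.1]
    have hle : √(1 - b ^ 2) ≤ √(1 - a ^ 2) := Real.sqrt_le_sqrt (by linarith)
    refine div_le_div_of_nonneg_right ?_ (Real.log_pos one_lt_two).le
    exact div_sinh_le_div_sinh (Real.artanh_pos ⟨hbpos, hle.trans_lt ha1⟩)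
      (Real.artanh_le_artanh (by linarith) ha1 hle)

/-! ### Concurrence -/

/-- The polarization of `v ↦ 2 det v`, a vector of `ℂ² ⊗ ℂ²` being regarded as a `2 × 2` matrix;
up to sign this is the bilinear form `⟨ũ, v⟩` defined by the spin flip. -/
def tau (u v : Q → ℂ) : ℂ :=
  u (0, 0) * v (1, 1) + u (1, 1) * v (0, 0) - u (0, 1) * v (1, 0) - u (1, 0) * v (0, 1)

/-- The concurrence `2 |det v|` of a not necessarily normalized vector. -/
noncomputable def conc (v : Q → ℂ) : ℝ := ‖tau v v‖

/-- The squared Euclidean norm. -/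
noncomputable def normSq (v : Q → ℂ) : ℝ := ∑ q, ‖v q‖ ^ 2

theorem sum_Q {M : Type*} [AddCommMonoid M] (f : Q → M) :
    ∑ q, f q = f (0, 0) + f (0, 1) + (f (1, 0) + f (1, 1)) := by
  rw [Fintype.sum_prod_type]; simp [Fin.sum_univ_two]

theorem tau_comm (u v : Q → ℂ) : tau u v = tau v u := by unfold tau; ring

theorem tau_add_right (u v w : Q → ℂ) : tau u (v + w) = tau u v + tau u w := by
  simp only [tau, Pi.add_apply]; ring

theorem tau_smul_right (c : ℂ) (u v : Q → ℂ) : tau u (c • v) = c * tau u v := by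
  simp only [tau, Pi.smul_apply, smul_eq_mul]; ring

theorem tau_smul_left (c : ℂ) (u v : Q → ℂ) : tau (c • u) v = c * tau u v := by
  simp only [tau, Pi.smul_apply, smul_eq_mul]; ring

theorem tau_sum_right {ι : Type*} (s : Finset ι) (u : Q → ℂ) (f : ι → Q → ℂ) :
    tau u (∑ i ∈ s, f i) = ∑ i ∈ s, tau u (f i) := by
  classical
  induction s using Finset.induction_on with
  | empty => simp [tau]
  | insert a s ha ih => rw [Finset.sum_insert ha, Finset.sum_insert ha, tau_add_right, ih]

theorem tau_sum_left {ι : Type*} (s : Finset ι) (u : Q → ℂ) (f : ι → Q → ℂ) :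
    tau (∑ i ∈ s, f i) u = ∑ i ∈ s, tau (f i) u := by
  simp_rw [tau_comm _ u]; exact tau_sum_right s u f

theorem conc_nonneg (v : Q → ℂ) : 0 ≤ conc v := norm_nonneg _

theorem conc_smul (c : ℂ) (v : Q → ℂ) : conc (c • v) = ‖c‖ ^ 2 * conc v := by
  simp only [conc, tau_smul_left, tau_smul_right, norm_mul]; ring

theorem normSq_nonneg (v : Q → ℂ) : 0 ≤ normSq v := Finset.sum_nonneg fun _ _ => sq_nonneg _

theorem normSq_eq_zero {v : Q → ℂ} : normSq v = 0 ↔ v = 0 := by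
  rw [normSq, Finset.sum_eq_zero_iff_of_nonneg fun _ _ => sq_nonneg _]
  simp [funext_iff]

theorem normSq_smul (c : ℂ) (v : Q → ℂ) : normSq (c • v) = ‖c‖ ^ 2 * normSq v := by
  simp only [normSq, Pi.smul_apply, smul_eq_mul, norm_mul, mul_pow, Finset.mul_sum]

theorem conc_le_normSq (v : Q → ℂ) : conc v ≤ normSq v := by
  unfold conc tau normSq
  rw [sum_Q]
  have e : v (0, 0) * v (1, 1) + v (1, 1) * v (0, 0) - v (0, 1) * v (1, 0) - v (1, 0) * v (0, 1)
      = 2 * (v (0, 0) * v (1, 1)) - 2 * (v (0, 1) * v (1, 0)) := by ring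
  rw [e]
  refine (norm_sub_le _ _).trans ?_
  simp only [norm_mul, Complex.norm_ofNat]
  nlinarith [sq_nonneg (‖v (0, 0)‖ - ‖v (1, 1)‖), sq_nonneg (‖v (0, 1)‖ - ‖v (1, 0)‖)]

theorem trace_ketbra (v : Q → ℂ) : (ketbra v).trace = (normSq v : ℂ) := by
  simp only [Matrix.trace, ketbra, normSq, Matrix.diag_apply, Matrix.vecMulVec_apply, Pi.star_apply]
  push_cast
  refine Finset.sum_congr rfl fun q _ => ?_
  rw [← Complex.mul_conj']; rfl

theorem pureEntanglement_eq (ψ : Q → ℂ) (hψ : normSq ψ = 1) :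
    pureEntanglement ψ = concEntropy (conc ψ) := by
  set R := partialTrace₂ (ketbra ψ)
  set hR := isHermitian_partialTrace₂_ketbra ψ
  set a := hR.eigenvalues 0
  set b := hR.eigenvalues 1
  have htr : a + b = 1 := by
    have h := hR.trace_eq_sum_eigenvalues
    have h2 : R.trace = ((normSq ψ : ℝ) : ℂ) := by
      rw [← trace_ketbra]
      simp only [R, Matrix.trace, partialTrace₂, Matrix.diag_apply, Matrix.of_apply, sum_Q,
        Fin.sum_univ_two]
    rw [h2, hψ, Fin.sum_univ_two] at h
    have h' : hR.eigenvalues 0 + hR.eigenvalues 1 = 1 := by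
      apply Complex.ofReal_injective
      rw [Complex.ofReal_add]
      exact h.symm
    exact h'
  have hdet : 4 * (a * b) = conc ψ ^ 2 := by
    have h := hR.det_eq_prod_eigenvalues
    rw [Fin.prod_univ_two] at h
    have h3 : 4 * R.det = tau ψ ψ * star (tau ψ ψ) := by
      simp only [R, Matrix.det_fin_two, partialTrace₂, ketbra, Matrix.of_apply, Fin.sum_univ_two,
        Matrix.vecMulVec_apply, tau, Pi.star_apply, star_sub, star_add, star_mul']
      ring
    rw [h] at h3
    have h4 : tau ψ ψ * star (tau ψ ψ) = ((conc ψ ^ 2 : ℝ) : ℂ) := by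
      rw [conc]; push_cast; exact Complex.mul_conj' _
    rw [h4] at h3
    have h' : 4 * (hR.eigenvalues 0 * hR.eigenvalues 1) = conc ψ ^ 2 := by
      apply Complex.ofReal_injective
      rw [Complex.ofReal_mul, Complex.ofReal_mul]
      exact h3
    exact h'
  have hsq : √(1 - conc ψ ^ 2) = |a - b| := by
    rw [← hdet, ← Real.sqrt_sq_eq_abs]; congr 1
    have : b = 1 - a := by linarith
    rw [this]; ring
  have hb : b = 1 - a := by linarith
  have : pureEntanglement ψ = Real.binEntropy a / Real.log 2 := by
    unfold pureEntanglement entropy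
    rw [Fin.sum_univ_two, ← add_div, Real.binEntropy_eq_negMulLog_add_negMulLog_one_sub, ← hb]
  rw [this, concEntropy, hsq]
  congr 1
  rcases abs_cases (a - b) with ⟨h, _⟩ | ⟨h, _⟩ <;> rw [h, hb]
  · congr 1; ring
  · rw [← Real.binEntropy_one_sub]; congr 1; ring

/-! ### Local filtering of ensembles -/

theorem tau_kronecker_mulVec (A B : Matrix (Fin 2) (Fin 2) ℂ) (u v : Q → ℂ) :
    tau ((A ⊗ₖ B) *ᵥ u) ((A ⊗ₖ B) *ᵥ v) = A.det * B.det * tau u v := by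
  simp only [tau, Matrix.mulVec, dotProduct, sum_Q, Matrix.kroneckerMap_apply, Matrix.det_fin_two]
  ring

theorem conc_kronecker_mulVec (A B : Matrix (Fin 2) (Fin 2) ℂ) (v : Q → ℂ) :
    conc ((A ⊗ₖ B) *ᵥ v) = ‖A.det * B.det‖ * conc v := by
  rw [conc, tau_kronecker_mulVec, norm_mul, conc]

theorem mul_ketbra_mul (M : Matrix Q Q ℂ) (v : Q → ℂ) :
    M * ketbra v * Mᴴ = ketbra (M *ᵥ v) := by
  rw [ketbra, ketbra, Matrix.mul_vecMulVec, Matrix.vecMulVec_mul, Matrix.star_mulVec]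

theorem filtered_ketbra (A B : Matrix (Fin 2) (Fin 2) ℂ) (v : Q → ℂ) :
    filtered A B (ketbra v) = ketbra ((A ⊗ₖ B) *ᵥ v) := mul_ketbra_mul _ _

theorem filtered_sum {ι : Type*} [Fintype ι] (A B : Matrix (Fin 2) (Fin 2) ℂ)
    (f : ι → Matrix Q Q ℂ) : filtered A B (∑ i, f i) = ∑ i, filtered A B (f i) := by
  simp only [filtered, Matrix.mul_sum, Matrix.sum_mul]

theorem filtered_filtered (A B A' B' : Matrix (Fin 2) (Fin 2) ℂ) (ρ : Matrix Q Q ℂ) :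
    filtered A B (filtered A' B' ρ) = filtered (A * A') (B * B') ρ := by
  simp only [filtered, Matrix.mul_kronecker_mul, Matrix.conjTranspose_mul, Matrix.mul_assoc]

theorem filtered_smul (A B : Matrix (Fin 2) (Fin 2) ℂ) (c : ℂ) (ρ : Matrix Q Q ℂ) :
    filtered A B (c • ρ) = c • filtered A B ρ := by
  simp [filtered]

theorem filtered_one (ρ : Matrix Q Q ℂ) : filtered 1 1 ρ = ρ := by
  simp [filtered]

theorem ketbra_smul (c : ℂ) (v : Q → ℂ) : ketbra (c • v) = ((‖c‖ ^ 2 : ℝ) : ℂ) • ketbra v := by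
  ext i j
  simp only [ketbra, Matrix.vecMulVec_apply, Pi.smul_apply, Pi.star_apply, smul_eq_mul,
    star_mul', Matrix.smul_apply]
  push_cast
  rw [← Complex.mul_conj']
  simp only [Complex.star_def]
  ring

theorem ketbra_real_smul (c : ℝ) (v : Q → ℂ) : ketbra ((c : ℂ) • v) = (c ^ 2) • ketbra v := by
  rw [ketbra_smul, Complex.norm_real, Real.norm_eq_abs, sq_abs]
  ext i j; simp

theorem posSemidef_ketbra (v : Q → ℂ) : (ketbra v).PosSemidef :=
  Matrix.posSemidef_vecMulVec_self_star v

theorem trace_filtered_sum {ι : Type*} [Fintype ι] (A B : Matrix (Fin 2) (Fin 2) ℂ)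
    (x : ι → Q → ℂ) : (filtered A B (∑ i, ketbra (x i))).trace =
      ((∑ i, normSq ((A ⊗ₖ B) *ᵥ x i) : ℝ) : ℂ) := by
  rw [filtered_sum, Matrix.trace_sum]
  simp only [filtered_ketbra, trace_ketbra]
  push_cast; rfl

/-- Mixing an ensemble by an isometry does not change the state. -/
theorem sum_ketbra_isometry {ι κ : Type*} [Fintype ι] [DecidableEq ι] [Fintype κ]
    (W : Matrix κ ι ℝ) (hW : Wᵀ * W = 1) (x : ι → Q → ℂ) :
    ∑ i, ketbra (∑ k, (W i k : ℂ) • x k) = ∑ k, ketbra (x k) := by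
  have hW' : ∀ k l, ∑ i, W i k * W i l = if k = l then 1 else 0 := fun k l => by
    have := congrFun (congrFun hW k) l
    simpa [Matrix.mul_apply, Matrix.one_apply] using this
  ext p q
  simp only [Matrix.sum_apply, ketbra, Matrix.vecMulVec_apply, Finset.sum_apply, Pi.smul_apply,
    Pi.star_apply, smul_eq_mul, star_sum, star_mul', Finset.sum_mul_sum]
  rw [Finset.sum_comm]
  refine Finset.sum_congr rfl fun k _ => ?_
  rw [Finset.sum_comm]
  have : ∀ l, ∑ i, (W i k : ℂ) * x k p * (star (W i l : ℂ) * star (x l q)) =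
      (if k = l then 1 else 0) * (x k p * star (x l q)) := fun l => by
    have h : ((∑ i, W i k * W i l : ℝ) : ℂ) = if k = l then 1 else 0 := by
      rw [hW']; split_ifs <;> simp
    rw [← h]
    push_cast
    rw [Finset.sum_mul]
    refine Finset.sum_congr rfl fun i _ => ?_
    simp only [Complex.star_def, Complex.conj_ofReal]
    ring
  rw [Finset.sum_congr rfl fun l _ => this l]
  simp

/-- The matrix of all sign vectors is a multiple of an isometry. -/
theorem sum_units_mul {ι : Type*} [Fintype ι] [DecidableEq ι] (k l : ι) :
    ∑ ε : ι → ℤˣ, (((ε k : ℤ) : ℝ) * ((ε l : ℤ) : ℝ)) =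
      if k = l then (2 : ℝ) ^ Fintype.card ι else 0 := by
  split_ifs with h
  · subst h
    have : ∀ ε : ι → ℤˣ, (((ε k : ℤ) : ℝ) * ((ε k : ℤ) : ℝ)) = 1 := fun ε => by
      rw [← Int.cast_mul, ← Units.val_mul]; simp
    rw [Finset.sum_congr rfl fun ε _ => this ε]
    simp
  · have h1 := Equiv.sum_comp (Equiv.mulRight (Pi.mulSingle k (-1) : ι → ℤˣ))
      (fun ε : ι → ℤˣ => (((ε k : ℤ) : ℝ) * ((ε l : ℤ) : ℝ)))
    simp only [Equiv.coe_mulRight, Pi.mul_apply, Pi.mulSingle_eq_same,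
      Pi.mulSingle_eq_of_ne (Ne.symm h), mul_one, Units.val_neg, Int.cast_neg, mul_neg, neg_mul,
      Finset.sum_neg_distrib] at h1
    linarith

/-- The normalized matrix of all sign vectors: an isometry with entries of constant modulus. -/
theorem exists_sign_isometry (ι : Type*) [Fintype ι] [DecidableEq ι] :
    ∃ W : Matrix (ι → ℤˣ) ι ℝ, Wᵀ * W = 1 ∧
      ∀ ε k, W ε k * W ε k = ((2 : ℝ) ^ Fintype.card ι)⁻¹ := by
  set N : ℝ := (2 : ℝ) ^ Fintype.card ι
  have hN : 0 < N := by positivity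
  have hmul : ∀ (ε : ι → ℤˣ) (k l : ι), (((ε k : ℤ) : ℝ) / √N) * (((ε l : ℤ) : ℝ) / √N) =
      (((ε k : ℤ) : ℝ) * ((ε l : ℤ) : ℝ)) / N := fun ε k l => by
    rw [div_mul_div_comm, Real.mul_self_sqrt hN.le]
  refine ⟨Matrix.of fun ε k => ((ε k : ℤ) : ℝ) / √N, ?_, fun ε k => ?_⟩
  · ext k l
    simp only [Matrix.mul_apply, Matrix.transpose_apply, Matrix.of_apply, hmul,
      ← Finset.sum_div, sum_units_mul, Matrix.one_apply]
    split_ifs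
    · exact div_self hN.ne'
    · simp
  · have h1 : (((ε k : ℤ) : ℝ) * ((ε k : ℤ) : ℝ)) = 1 := by
      rw [← Int.cast_mul, ← Units.val_mul]; simp
    rw [Matrix.of_apply, hmul, h1, one_div]

/-- A real symmetric matrix of trace zero has zero diagonal in a suitable frame: in an
eigenbasis, every sign vector is isotropic. -/
theorem exists_isometry_diag_eq_zero {ι : Type*} [Fintype ι] [DecidableEq ι]
    (S : Matrix ι ι ℝ) (hS : S.IsHermitian) (htr : S.trace = 0) :
    ∃ W : Matrix (ι → ℤˣ) ι ℝ, Wᵀ * W = 1 ∧ ∀ i, (W * S * Wᵀ) i i = 0 := by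
  obtain ⟨W₀, h0, hsq⟩ := exists_sign_isometry ι
  set U : Matrix ι ι ℝ := (hS.eigenvectorUnitary : Matrix ι ι ℝ) with hU
  have hUU : Uᵀ * U = 1 := by
    have := Matrix.UnitaryGroup.star_mul_self hS.eigenvectorUnitary
    rwa [Matrix.star_eq_conjTranspose, Matrix.conjTranspose_eq_transpose_of_trivial] at this
  have hUU' : U * Uᵀ = 1 := mul_eq_one_comm.1 hUU
  have hspec : S = U * Matrix.diagonal hS.eigenvalues * Uᵀ := by
    have := hS.spectral_theorem
    rw [Unitary.conjStarAlgAut_apply] at this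
    rw [Matrix.star_eq_conjTranspose, Matrix.conjTranspose_eq_transpose_of_trivial] at this
    simpa using this
  have hsum : ∑ i, hS.eigenvalues i = 0 := by
    have := hS.trace_eq_sum_eigenvalues
    rw [htr] at this
    simpa using this.symm
  refine ⟨W₀ * Uᵀ, ?_, fun ε => ?_⟩
  · rw [Matrix.transpose_mul, Matrix.transpose_transpose, Matrix.mul_assoc, ← Matrix.mul_assoc W₀ᵀ,
      h0, Matrix.one_mul, hUU']
  · have e : W₀ * Uᵀ * S * (W₀ * Uᵀ)ᵀ = W₀ * Matrix.diagonal hS.eigenvalues * W₀ᵀ := by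
      rw [Matrix.transpose_mul, Matrix.transpose_transpose]
      calc _ = W₀ * Uᵀ * (U * Matrix.diagonal hS.eigenvalues * Uᵀ) * (U * W₀ᵀ) := by rw [← hspec]
        _ = W₀ * (Uᵀ * U) * Matrix.diagonal hS.eigenvalues * (Uᵀ * U) * W₀ᵀ := by
            simp only [Matrix.mul_assoc]
        _ = _ := by rw [hUU, Matrix.mul_one, Matrix.mul_one]
    rw [e, Matrix.mul_apply]
    have : ∀ k, (W₀ * Matrix.diagonal hS.eigenvalues) ε k * W₀ᵀ k ε =
        hS.eigenvalues k * ((2 : ℝ) ^ Fintype.card ι)⁻¹ := fun k => by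
      rw [Matrix.mul_diagonal, Matrix.transpose_apply, ← hsq ε k]; ring
    rw [Finset.sum_congr rfl fun k _ => this k, ← Finset.sum_mul, hsum, zero_mul]

theorem normSq_real_combination {ι : Type*} [Fintype ι] (c : ι → ℝ) (z : ι → Q → ℂ) :
    normSq (∑ k, (c k : ℂ) • z k) =
      ∑ k, ∑ l, c k * c l * (∑ q, (z k q * star (z l q)).re) := by
  have h : ∀ q, ‖(∑ k, (c k : ℂ) • z k) q‖ ^ 2 =
      ∑ k, ∑ l, c k * c l * (z k q * star (z l q)).re := fun q => by
    have h1 : ∀ a : ℂ, ‖a‖ ^ 2 = (a * star a).re := fun a => by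
      rw [Complex.star_def, Complex.mul_conj']; norm_cast
    rw [h1, Finset.sum_apply, star_sum, Finset.sum_mul_sum, Complex.re_sum]
    refine Finset.sum_congr rfl fun k _ => ?_
    rw [Complex.re_sum]
    refine Finset.sum_congr rfl fun l _ => ?_
    rw [← Complex.re_ofReal_mul]
    simp only [Pi.smul_apply, smul_eq_mul, star_mul', Complex.star_def, Complex.conj_ofReal]
    congr 1
    push_cast
    ring
  simp only [normSq, h, Finset.mul_sum]
  rw [Finset.sum_comm]
  exact Finset.sum_congr rfl fun k _ => Finset.sum_comm

/-! ### Bounds on the entanglement of formation -/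

theorem concEntropy_nonneg (c : ℝ) : 0 ≤ concEntropy c := by
  refine div_nonneg (Real.binEntropy_nonneg ?_ ?_) (Real.log_pos one_lt_two).le
  · have := Real.sqrt_nonneg (1 - c ^ 2); linarith
  · have : √(1 - c ^ 2) ≤ 1 := Real.sqrt_le_one.2 (by nlinarith [sq_nonneg c])
    linarith

theorem entanglementOfFormation_bddBelow (ρ : Matrix Q Q ℂ) :
    BddBelow {x : ℝ | ∃ (n : ℕ) (p : Fin n → ℝ) (ψ : Fin n → Q → ℂ),
    (∀ i, 0 ≤ p i) ∧ ∑ i, p i = 1 ∧ (∀ i, ∑ q, ‖ψ i q‖ ^ 2 = 1) ∧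
    ρ = ∑ i, p i • ketbra (ψ i) ∧ x = ∑ i, p i * pureEntanglement (ψ i)} := by
  refine ⟨0, ?_⟩
  rintro x ⟨n, p, ψ, hp, -, hψ, -, rfl⟩
  refine Finset.sum_nonneg fun i _ => mul_nonneg (hp i) ?_
  rw [pureEntanglement_eq _ (hψ i)]
  exact concEntropy_nonneg _

theorem normSq_single (q : Q) : normSq (Pi.single q (1 : ℂ)) = 1 := by
  rw [normSq, Finset.sum_eq_single q]
  · simp
  · intro b _ hb; simp [hb]
  · simp

theorem exists_unit_of_vector (v : Q → ℂ) :
    ∃ ψ : Q → ℂ, normSq ψ = 1 ∧ normSq v • ketbra ψ = ketbra v ∧ normSq v * conc ψ = conc v := by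
  by_cases hv : v = 0
  · refine ⟨Pi.single (0, 0) 1, normSq_single _, ?_, ?_⟩
    · subst hv; ext i j; simp [normSq, ketbra, Matrix.vecMulVec_apply]
    · subst hv; simp [normSq, conc, tau]
  · have h0 : 0 < normSq v := (normSq_nonneg v).lt_of_ne fun h => hv (normSq_eq_zero.1 h.symm)
    have hs := Real.sq_sqrt h0.le
    have hs0 : √(normSq v) ≠ 0 := (Real.sqrt_pos.2 h0).ne'
    have hn : ‖(((√(normSq v))⁻¹ : ℝ) : ℂ)‖ ^ 2 = (normSq v)⁻¹ := by
      rw [Complex.norm_real, Real.norm_eq_abs, sq_abs, inv_pow, hs]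
    refine ⟨(((√(normSq v))⁻¹ : ℝ) : ℂ) • v, ?_, ?_, ?_⟩
    · rw [normSq_smul, hn, inv_mul_cancel₀ h0.ne']
    · rw [ketbra_real_smul, smul_smul, inv_pow, hs, mul_inv_cancel₀ h0.ne', one_smul]
    · rw [conc_smul, hn, mul_inv_cancel_left₀ h0.ne']

/-- An ensemble whose members all have the same normalized concurrence bounds `E_F`. -/
theorem entanglementOfFormation_le {κ : Type*} [Fintype κ] {σ : Matrix Q Q ℂ} (v : κ → Q → ℂ)
    (hσ : σ = ∑ i, ketbra (v i)) (htr : σ.trace = 1) {c : ℝ}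
    (hc : ∀ i, conc (v i) = c * normSq (v i)) : entanglementOfFormation σ ≤ concEntropy c := by
  choose ψ h1 h2 h3 using fun i => exists_unit_of_vector (v i)
  have hsum : ∑ i, normSq (v i) = 1 := by
    rw [hσ, Matrix.trace_sum] at htr
    simp only [trace_ketbra] at htr
    exact_mod_cast htr
  have hval : ∑ i, normSq (v i) * pureEntanglement (ψ i) = concEntropy c := by
    rw [← one_mul (concEntropy c), ← hsum, Finset.sum_mul]
    refine Finset.sum_congr rfl fun i _ => ?_
    by_cases h0 : normSq (v i) = 0
    · simp [h0]
    · rw [pureEntanglement_eq _ (h1 i)]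
      congr 2
      have := (h3 i).trans (hc i)
      rw [mul_comm c] at this
      exact mul_left_cancel₀ h0 this
  refine csInf_le (entanglementOfFormation_bddBelow σ) ?_
  let e := Fintype.equivFin κ
  refine ⟨Fintype.card κ, fun i => normSq (v (e.symm i)), fun i => ψ (e.symm i),
    fun i => normSq_nonneg _, ?_, fun i => h1 _, ?_, ?_⟩
  · rw [← hsum]; exact Equiv.sum_comp e.symm fun i => normSq (v i)
  · rw [hσ, ← Equiv.sum_comp e.symm]
    exact Finset.sum_congr rfl fun i _ => (h2 _).symm
  · rw [← hval]; exact (Equiv.sum_comp e.symm fun i => normSq (v i) * pureEntanglement (ψ i)).symm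

/-- A lower bound for the average concurrence gives one for `E_F`, as `concEntropy` is convex
and increasing. -/
theorem le_entanglementOfFormation {κ : Type*} [Fintype κ] {σ : Matrix Q Q ℂ} (v : κ → Q → ℂ)
    (hσ : σ = ∑ i, ketbra (v i)) (htr : σ.trace = 1) {c : ℝ} (hc0 : 0 ≤ c)
    (hc : ∀ (n : ℕ) (w : Fin n → Q → ℂ), σ = ∑ i, ketbra (w i) → c ≤ ∑ i, conc (w i)) :
    concEntropy c ≤ entanglementOfFormation σ := by
  refine le_csInf ?_ ?_
  · choose ψ h1 h2 _ using fun i => exists_unit_of_vector (v i)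
    have hsum : ∑ i, normSq (v i) = 1 := by
      rw [hσ, Matrix.trace_sum] at htr
      simp only [trace_ketbra] at htr
      exact_mod_cast htr
    let e := Fintype.equivFin κ
    refine ⟨_, Fintype.card κ, fun i => normSq (v (e.symm i)), fun i => ψ (e.symm i),
      fun i => normSq_nonneg _, ?_, fun i => h1 _, ?_, rfl⟩
    · rw [← hsum]; exact Equiv.sum_comp e.symm fun i => normSq (v i)
    · rw [hσ, ← Equiv.sum_comp e.symm]
      exact Finset.sum_congr rfl fun i _ => (h2 _).symm
  · rintro x ⟨n, p, ψ, hp, hp1, hψ, hdec, rfl⟩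
    have hc1 : ∀ i, conc (ψ i) ≤ 1 := fun i => (conc_le_normSq _).trans_eq (hψ i)
    have h := hc n (fun i => ((√(p i) : ℝ) : ℂ) • ψ i) (by
      rw [hdec]
      refine Finset.sum_congr rfl fun i _ => ?_
      rw [ketbra_real_smul, Real.sq_sqrt (hp i)])
    have h' : c ≤ ∑ i, p i * conc (ψ i) := by
      refine h.trans_eq (Finset.sum_congr rfl fun i _ => ?_)
      rw [conc_smul, Complex.norm_real, Real.norm_eq_abs, sq_abs, Real.sq_sqrt (hp i)]
    have hle1 : ∑ i, p i * conc (ψ i) ≤ 1 := by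
      rw [← hp1]
      exact Finset.sum_le_sum fun i _ => mul_le_of_le_one_right (hp i) (hc1 i)
    calc concEntropy c ≤ concEntropy (∑ i, p i * conc (ψ i)) :=
          strictMonoOn_concEntropy.monotoneOn ⟨hc0, h'.trans hle1⟩ ⟨hc0.trans h', hle1⟩ h'
      _ ≤ ∑ i, p i * concEntropy (conc (ψ i)) := by
          simpa using convexOn_concEntropy.map_sum_le (t := Finset.univ) (w := p)
            (p := fun i => conc (ψ i)) (fun i _ => hp i) hp1
            (fun i _ => ⟨conc_nonneg _, hc1 i⟩)
      _ = ∑ i, p i * pureEntanglement (ψ i) :=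
          Finset.sum_congr rfl fun i _ => by rw [pureEntanglement_eq _ (hψ i)]

/-! ### Separability criteria -/

theorem exists_eq_mul_of_conc_eq_zero {v : Q → ℂ} (hv : conc v = 0) :
    ∃ a b : Fin 2 → ℂ, v = fun q => a q.1 * b q.2 := by
  have h : v (0, 0) * v (1, 1) = v (0, 1) * v (1, 0) := by
    have := norm_eq_zero.1 hv
    unfold tau at this
    linear_combination this / 2
  have key : ∀ a b : Fin 2 → ℂ, v (0, 0) = a 0 * b 0 → v (0, 1) = a 0 * b 1 →
      v (1, 0) = a 1 * b 0 → v (1, 1) = a 1 * b 1 → v = fun q => a q.1 * b q.2 := by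
    intro a b h1 h2 h3 h4
    ext ⟨i, j⟩
    fin_cases i <;> fin_cases j <;> assumption
  by_cases h0 : v (0, 0) = 0
  · rw [h0, zero_mul] at h
    rcases mul_eq_zero.1 h.symm with h1 | h1
    · exact ⟨![0, 1], ![v (1, 0), v (1, 1)], key _ _ (by simp [h0]) (by simp [h1]) (by simp)
        (by simp)⟩
    · exact ⟨![v (0, 1), v (1, 1)], ![0, 1], key _ _ (by simp [h0]) (by simp) (by simp [h1])
        (by simp)⟩
  · refine ⟨![v (0, 0), v (1, 0)], ![1, v (0, 1) / v (0, 0)], key _ _ (by simp) ?_ (by simp) ?_⟩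
    · simp; field_simp
    · simp; field_simp; linear_combination h

theorem tau_self_mul (a b : Fin 2 → ℂ) :
    tau (fun q => a q.1 * b q.2) (fun q => a q.1 * b q.2) = 0 := by
  simp only [tau]; ring

/-- A state with an ensemble of vectors of zero concurrence is separable. -/
theorem isSeparable_of_conc_eq_zero {κ : Type*} [Fintype κ] {ρ : Matrix Q Q ℂ} (v : κ → Q → ℂ)
    (hρ : ρ = ∑ i, ketbra (v i)) (htr : ρ.trace = 1) (hv : ∀ i, conc (v i) = 0) :
    IsSeparable ρ := by
  have key : ∀ i, ∃ σ : Matrix Q Q ℂ, (∃ σ₁ σ₂ : Matrix (Fin 2) (Fin 2) ℂ,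
      IsState σ₁ ∧ IsState σ₂ ∧ σ = σ₁ ⊗ₖ σ₂) ∧ normSq (v i) • σ = ketbra (v i) := by
    intro i
    obtain ⟨ψ, h1, h2, h3⟩ := exists_unit_of_vector (v i)
    by_cases h0 : normSq (v i) = 0
    · refine ⟨ketbra (Pi.single 0 1) ⊗ₖ ketbra (Pi.single 0 1), ⟨_, _, ?_, ?_, rfl⟩, ?_⟩
      · exact ⟨Matrix.posSemidef_vecMulVec_self_star _, by
          simp [Matrix.trace, ketbra, Matrix.vecMulVec_apply]⟩
      · exact ⟨Matrix.posSemidef_vecMulVec_self_star _, by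
          simp [Matrix.trace, ketbra, Matrix.vecMulVec_apply]⟩
      · rw [← h2, h0, zero_smul, zero_smul]
    · have hψ : conc ψ = 0 := by
        rw [hv i] at h3
        exact (mul_eq_zero.1 h3).resolve_left h0
      obtain ⟨a, b, hab⟩ := exists_eq_mul_of_conc_eq_zero hψ
      set α : ℝ := ∑ i, ‖a i‖ ^ 2
      set β : ℝ := ∑ i, ‖b i‖ ^ 2
      have hαβ : α * β = 1 := by
        rw [← h1, hab]
        simp only [normSq, α, β, norm_mul, mul_pow, sum_Q, Fin.sum_univ_two]
        ring
      have htra : ∀ a : Fin 2 → ℂ, (ketbra a).trace = ((∑ i, ‖a i‖ ^ 2 : ℝ) : ℂ) := fun a => by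
        simp only [Matrix.trace, ketbra, Matrix.diag_apply, Matrix.vecMulVec_apply, Pi.star_apply]
        push_cast
        exact Finset.sum_congr rfl fun q _ => by rw [← Complex.mul_conj']; rfl
      have hst : ∀ (a : Fin 2 → ℂ) (s : ℝ), 0 ≤ s → s * (∑ i, ‖a i‖ ^ 2) = 1 →
          IsState (s • ketbra a) := fun a s hs h => by
        refine ⟨(Matrix.posSemidef_vecMulVec_self_star a).smul hs, ?_⟩
        rw [Matrix.trace_smul, htra, Complex.real_smul, ← Complex.ofReal_mul, h, Complex.ofReal_one]
      refine ⟨ketbra ψ, ⟨β • ketbra a, α • ketbra b,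
        hst a β (Finset.sum_nonneg fun _ _ => sq_nonneg _) (by rw [mul_comm]; exact hαβ),
        hst b α (Finset.sum_nonneg fun _ _ => sq_nonneg _) hαβ, ?_⟩, h2⟩
      rw [Matrix.smul_kronecker, Matrix.kronecker_smul, smul_smul, mul_comm β, hαβ, one_smul]
      ext ⟨i, j⟩ ⟨k, l⟩
      simp only [ketbra, Matrix.vecMulVec_apply, Matrix.kroneckerMap_apply, hab, Pi.star_apply,
        star_mul']
      ring
  choose σ hσ hσv using key
  have hsum : ∑ i, normSq (v i) = 1 := by
    rw [hρ, Matrix.trace_sum] at htr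
    simp only [trace_ketbra] at htr
    exact_mod_cast htr
  have : ρ = ∑ i, normSq (v i) • σ i := by rw [hρ]; exact Finset.sum_congr rfl fun i _ => (hσv i).symm
  rw [this]
  exact (convex_convexHull ℝ _).sum_mem (fun i _ => normSq_nonneg _) hsum
    fun i _ => subset_convexHull ℝ _ (hσ i)

theorem tau_real_combination {ι : Type*} [Fintype ι] [DecidableEq ι] (c : ι → ℝ) (x : ι → Q → ℂ)
    (t : ι → ℂ) (ht : ∀ k l, tau (x k) (x l) = if k = l then t k else 0) :
    tau (∑ k, (c k : ℂ) • x k) (∑ k, (c k : ℂ) • x k) = ∑ k, ((c k * c k : ℝ) : ℂ) * t k := by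
  rw [tau_sum_left]
  refine Finset.sum_congr rfl fun k _ => ?_
  rw [tau_sum_right, Finset.sum_eq_single k]
  · rw [tau_smul_left, tau_smul_right, ht, if_pos rfl]; push_cast; ring
  · intro l _ hl
    rw [tau_smul_left, tau_smul_right, ht, if_neg hl.symm]; ring
  · simp

/-- If the spin-flip form is diagonal of trace zero on an ensemble, then all combinations of the
ensemble with coefficients `±1` are product vectors. -/
theorem isSeparable_of_tau_diagonal {ι : Type*} [Fintype ι] [DecidableEq ι] {ρ : Matrix Q Q ℂ}
    (x : ι → Q → ℂ) (t : ι → ℂ) (hρ : ρ = ∑ i, ketbra (x i)) (htr : ρ.trace = 1)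
    (ht : ∀ k l, tau (x k) (x l) = if k = l then t k else 0) (hsum : ∑ k, t k = 0) :
    IsSeparable ρ := by
  obtain ⟨W, hW, hsq⟩ := exists_sign_isometry ι
  refine isSeparable_of_conc_eq_zero (fun i => ∑ k, (W i k : ℂ) • x k)
    (by rw [sum_ketbra_isometry W hW, hρ]) htr fun i => ?_
  simp only [conc, tau_real_combination _ x t ht, hsq, ← Finset.mul_sum, hsum, mul_zero, norm_zero]

/-! ### The entanglement of formation of filtered states -/

/-- The (unnormalized) state `K` has concurrence `C`, certified from above by an ensemble on
which the spin-flip form is real diagonal of trace `C`, and its trace cannot be decreased below `m`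
by local filtering with determinant-one matrices. -/
structure HasConcurrence (K : Matrix Q Q ℂ) (C m : ℝ) : Prop where
  nonneg : 0 ≤ C
  pos : 0 < m
  le : C ≤ m
  decomp : ∃ (x : Q → Q → ℂ) (t : Q → ℝ), K = ∑ k, ketbra (x k) ∧
    (∀ k l, tau (x k) (x l) = if k = l then (t k : ℂ) else 0) ∧ ∑ k, t k = C
  lower : ∀ (n : ℕ) (v : Fin n → Q → ℂ), K = ∑ i, ketbra (v i) → C ≤ ∑ i, conc (v i)
  trace_le : ∀ A B : Matrix (Fin 2) (Fin 2) ℂ, ‖A.det * B.det‖ * m ≤ (filtered A B K).trace.re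

section FilteredStates

variable {K : Matrix Q Q ℂ} {C m : ℝ}

theorem localOp_sum {ι : Type*} [Fintype ι] (A B : Matrix (Fin 2) (Fin 2) ℂ) (x : ι → Q → ℂ)
    {T : ℝ} (hT : 0 ≤ T) (h : (filtered A B (∑ i, ketbra (x i))).trace = T) :
    localOp A B (∑ i, ketbra (x i)) =
      ∑ i, ketbra (((√T)⁻¹ : ℝ) • ((A ⊗ₖ B) *ᵥ x i)) := by
  rw [localOp, h, filtered_sum, Finset.smul_sum]
  refine Finset.sum_congr rfl fun i _ => ?_
  rw [filtered_ketbra]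
  have : ((√T)⁻¹ : ℝ) • ((A ⊗ₖ B) *ᵥ x i) = (((√T)⁻¹ : ℝ) : ℂ) • ((A ⊗ₖ B) *ᵥ x i) := by
    ext; simp
  rw [this, ketbra_real_smul, inv_pow, Real.sq_sqrt hT]
  ext i j; simp

theorem trace_localOp {A B : Matrix (Fin 2) (Fin 2) ℂ} {ρ : Matrix Q Q ℂ}
    (h : Admissible A B ρ) : (localOp A B ρ).trace = 1 := by
  rw [localOp, Matrix.trace_smul, smul_eq_mul, inv_mul_cancel₀ h]

theorem HasConcurrence.trace_eq (h : HasConcurrence K C m) (A B : Matrix (Fin 2) (Fin 2) ℂ) :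
    (filtered A B K).trace = ((filtered A B K).trace.re : ℂ) := by
  obtain ⟨x, t, rfl, -, -⟩ := h.decomp
  rw [trace_filtered_sum, Complex.ofReal_re]

theorem HasConcurrence.trace_pos (h : HasConcurrence K C m) {A B : Matrix (Fin 2) (Fin 2) ℂ}
    (hadm : Admissible A B K) : 0 < (filtered A B K).trace.re := by
  have h1 := h.trace_le A B
  refine (le_trans (by positivity [h.pos]) h1).lt_of_ne fun h0 => hadm ?_
  rw [h.trace_eq, ← h0, Complex.ofReal_zero]

theorem HasConcurrence.admissible (h : HasConcurrence K C m) {A B : Matrix (Fin 2) (Fin 2) ℂ}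
    (hA : A.det ≠ 0) (hB : B.det ≠ 0) : Admissible A B K := by
  intro h0
  have h1 := h.trace_le A B
  rw [h0, Complex.zero_re] at h1
  have : 0 < ‖A.det * B.det‖ := norm_pos_iff.2 (mul_ne_zero hA hB)
  nlinarith [h.pos]

/-- The upper bound for a filtered state: the filtered ensemble is remixed so that all its members
have the same normalized concurrence. -/
theorem HasConcurrence.entanglementOfFormation_le (h : HasConcurrence K C m)
    {A B : Matrix (Fin 2) (Fin 2) ℂ} (hadm : Admissible A B K) :
    entanglementOfFormation (localOp A B K) ≤
      concEntropy (C * (‖A.det * B.det‖ / (filtered A B K).trace.re)) := by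
  obtain ⟨x, t, hK, hx, ht⟩ := h.decomp
  have hTpos := h.trace_pos hadm
  have hTr := h.trace_eq A B
  set T := (filtered A B K).trace.re
  set z : Q → Q → ℂ := fun k => (A ⊗ₖ B) *ᵥ x k with hz
  have hTz : ∑ k, normSq (z k) = T := by
    have := hTr
    rw [hK, trace_filtered_sum] at this
    exact_mod_cast this
  set S : Matrix Q Q ℝ := Matrix.diagonal t -
    Matrix.of fun k l => C / T * ∑ q, (z k q * star (z l q)).re with hS
  have hherm : S.IsHermitian := by
    refine (Matrix.isHermitian_diagonal t).sub ?_
    ext k l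
    simp only [Matrix.conjTranspose_apply, Matrix.of_apply, star_trivial]
    congr 1
    refine Finset.sum_congr rfl fun q _ => ?_
    simp only [Complex.star_def, Complex.mul_re, Complex.conj_re, Complex.conj_im]; ring
  have htr : S.trace = 0 := by
    rw [hS, Matrix.trace_sub, Matrix.trace_diagonal, ht, Matrix.trace]
    have : ∀ k, (Matrix.of fun k l => C / T * ∑ q, (z k q * star (z l q)).re).diag k =
        C / T * normSq (z k) := fun k => by
      rw [Matrix.diag_apply, Matrix.of_apply, normSq]
      congr 1
      refine Finset.sum_congr rfl fun q _ => ?_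
      rw [Complex.star_def, Complex.mul_conj']; norm_cast
    rw [Finset.sum_congr rfl fun k _ => this k, ← Finset.mul_sum, hTz,
      div_mul_cancel₀ _ hTpos.ne', sub_self]
  obtain ⟨W, hW, hdiag⟩ := exists_isometry_diag_eq_zero S hherm htr
  have hrel : ∀ i, ∑ k, W i k * W i k * t k = C / T * normSq (∑ k, (W i k : ℂ) • z k) := by
    intro i
    have h1 := hdiag i
    rw [hS, Matrix.mul_sub, Matrix.sub_mul, Matrix.sub_apply, sub_eq_zero, Matrix.mul_apply,
      Matrix.mul_apply] at h1
    rw [normSq_real_combination, Finset.mul_sum]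
    calc _ = ∑ k, (W * Matrix.diagonal t) i k * Wᵀ k i :=
          Finset.sum_congr rfl fun k _ => by
            rw [Matrix.mul_diagonal, Matrix.transpose_apply]; ring
      _ = _ := h1
      _ = ∑ l, ∑ k, C / T * (W i k * W i l * ∑ q, (z k q * star (z l q)).re) := by
          refine Finset.sum_congr rfl fun l _ => ?_
          rw [Matrix.mul_apply, Finset.sum_mul]
          refine Finset.sum_congr rfl fun k _ => ?_
          rw [Matrix.transpose_apply, Matrix.of_apply]; ring
      _ = _ := by
          rw [Finset.sum_comm]
          exact Finset.sum_congr rfl fun k _ => (Finset.mul_sum _ _ _).symm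
  have hztau : ∀ k l, tau (z k) (z l) = if k = l then (A.det * B.det) * (t k : ℂ) else 0 := by
    intro k l
    rw [hz, tau_kronecker_mulVec, hx]
    split_ifs <;> simp
  have hloc : localOp A B K = ∑ i, ketbra ((((√T)⁻¹ : ℝ) : ℂ) • ∑ k, (W i k : ℂ) • z k) := by
    have e := localOp_sum A B x hTpos.le (by rw [← hK]; exact hTr)
    rw [← hK] at e
    have e2 : ∀ k, ((√T)⁻¹ : ℝ) • ((A ⊗ₖ B) *ᵥ x k) = (((√T)⁻¹ : ℝ) : ℂ) • z k := fun k => by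
      ext; simp [hz]
    simp only [e2, ketbra_real_smul, ← Finset.smul_sum] at e
    rw [e]
    simp only [ketbra_real_smul, ← Finset.smul_sum]
    rw [sum_ketbra_isometry W hW]
  refine TwoQubit.entanglementOfFormation_le _ hloc (trace_localOp hadm) fun i => ?_
  have hval : conc (∑ k, (W i k : ℂ) • z k) =
      ‖A.det * B.det‖ * (C / T * normSq (∑ k, (W i k : ℂ) • z k)) := by
    have e : ∑ k, ((W i k * W i k : ℝ) : ℂ) * (A.det * B.det * (t k : ℂ)) =
        A.det * B.det * ((∑ k, W i k * W i k * t k : ℝ) : ℂ) := by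
      push_cast
      rw [Finset.mul_sum]
      exact Finset.sum_congr rfl fun k _ => by ring
    rw [conc, tau_real_combination _ z _ hztau, e, norm_mul, Complex.norm_real, hrel]
    congr 1
    exact Real.norm_of_nonneg (mul_nonneg (div_nonneg h.nonneg hTpos.le) (normSq_nonneg _))
  rw [conc_smul, normSq_smul, hval]
  ring

/-- The lower bound for a state filtered by invertible matrices: ensembles pull back. -/
theorem HasConcurrence.le_entanglementOfFormation (h : HasConcurrence K C m)
    {A B : Matrix (Fin 2) (Fin 2) ℂ} (hA : A.det ≠ 0) (hB : B.det ≠ 0) :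
    concEntropy (C * (‖A.det * B.det‖ / (filtered A B K).trace.re)) ≤
      entanglementOfFormation (localOp A B K) := by
  have hadm := h.admissible hA hB
  obtain ⟨x, t, hK, hx, ht⟩ := h.decomp
  have hTpos := h.trace_pos hadm
  have hTr := h.trace_eq A B
  set T := (filtered A B K).trace.re
  have e := localOp_sum A B x hTpos.le (by rw [← hK]; exact hTr)
  rw [← hK] at e
  have hD : 0 < ‖A.det * B.det‖ := norm_pos_iff.2 (mul_ne_zero hA hB)
  refine TwoQubit.le_entanglementOfFormation _ e (trace_localOp hadm)
    (mul_nonneg h.nonneg (div_nonneg hD.le hTpos.le)) fun n w hw => ?_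
  have hK' : K = ∑ i, ketbra (((√T : ℝ) : ℂ) • ((A⁻¹ ⊗ₖ B⁻¹) *ᵥ w i)) := by
    simp only [ketbra_real_smul, ← Finset.smul_sum, Real.sq_sqrt hTpos.le, ← filtered_ketbra]
    rw [← filtered_sum, ← hw, localOp, hTr, filtered_smul, filtered_filtered,
      Matrix.nonsing_inv_mul _ (isUnit_iff_ne_zero.2 hA),
      Matrix.nonsing_inv_mul _ (isUnit_iff_ne_zero.2 hB), filtered_one]
    ext i j
    simp only [Matrix.smul_apply, Complex.real_smul, smul_eq_mul]
    rw [mul_inv_cancel_left₀ (Complex.ofReal_ne_zero.2 hTpos.ne')]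
  have h1 := h.lower n _ hK'
  have e3 : ∀ i, conc (((√T : ℝ) : ℂ) • ((A⁻¹ ⊗ₖ B⁻¹) *ᵥ w i)) =
      T / ‖A.det * B.det‖ * conc (w i) := fun i => by
    rw [conc_smul, conc_kronecker_mulVec, Complex.norm_real, Real.norm_eq_abs, sq_abs,
      Real.sq_sqrt hTpos.le, Matrix.det_nonsing_inv, Matrix.det_nonsing_inv,
      Ring.inverse_eq_inv', ← mul_inv, norm_inv]
    ring
  simp only [e3, ← Finset.mul_sum] at h1
  rw [mul_div_assoc', div_le_iff₀ hTpos]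
  rw [div_mul_eq_mul_div, le_div_iff₀ hD] at h1
  linarith

theorem maxEF_bddAbove (ρ : Matrix Q Q ℂ) : BddAbove {x : ℝ | ∃ A B : Matrix (Fin 2) (Fin 2) ℂ,
    Admissible A B ρ ∧ x = entanglementOfFormation (localOp A B ρ)} := by
  refine ⟨1, ?_⟩
  rintro x ⟨A, B, -, rfl⟩
  rcases Set.eq_empty_or_nonempty {x : ℝ | ∃ (n : ℕ) (p : Fin n → ℝ) (ψ : Fin n → Q → ℂ),
    (∀ i, 0 ≤ p i) ∧ ∑ i, p i = 1 ∧ (∀ i, ∑ q, ‖ψ i q‖ ^ 2 = 1) ∧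
    localOp A B ρ = ∑ i, p i • ketbra (ψ i) ∧ x = ∑ i, p i * pureEntanglement (ψ i)} with h | h
  · rw [entanglementOfFormation, h, Real.sInf_empty]; exact zero_le_one
  · obtain ⟨x, hx⟩ := h
    refine (csInf_le (entanglementOfFormation_bddBelow _) hx).trans ?_
    obtain ⟨n, p, ψ, hp, hp1, hψ, -, rfl⟩ := hx
    rw [← hp1]
    refine Finset.sum_le_sum fun i _ => mul_le_of_le_one_right (hp i) ?_
    rw [pureEntanglement_eq _ (hψ i)]
    exact concEntropy_le_one _

theorem HasConcurrence.ratio_mem (h : HasConcurrence K C m) {A B : Matrix (Fin 2) (Fin 2) ℂ}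
    (hadm : Admissible A B K) :
    C * (‖A.det * B.det‖ / (filtered A B K).trace.re) ∈ Set.Icc (0 : ℝ) (C / m) := by
  have hT := h.trace_pos hadm
  refine ⟨mul_nonneg h.nonneg (by positivity), ?_⟩
  rw [div_eq_mul_one_div C]
  refine mul_le_mul_of_nonneg_left ?_ h.nonneg
  rw [div_le_div_iff₀ hT h.pos, one_mul]
  exact h.trace_le A B

theorem HasConcurrence.div_mem (h : HasConcurrence K C m) : C / m ∈ Set.Icc (0 : ℝ) 1 :=
  ⟨div_nonneg h.nonneg h.pos.le, (div_le_one h.pos).2 h.le⟩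

theorem HasConcurrence.maxEF_le (h : HasConcurrence K C m) : maxEF K ≤ concEntropy (C / m) := by
  refine csSup_le ⟨_, 1, 1, h.admissible (by simp) (by simp), rfl⟩ ?_
  rintro x ⟨A, B, hadm, rfl⟩
  have h1 := h.ratio_mem hadm
  exact (h.entanglementOfFormation_le hadm).trans
    (strictMonoOn_concEntropy.monotoneOn ⟨h1.1, h1.2.trans h.div_mem.2⟩ h.div_mem h1.2)

/-- If the trace approaches its lower bound, then the bound for `maxEF` is sharp. -/
theorem HasConcurrence.maxEF_eq (h : HasConcurrence K C m) (A B : ℕ → Matrix (Fin 2) (Fin 2) ℂ)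
    (hA : ∀ n, (A n).det ≠ 0) (hB : ∀ n, (B n).det ≠ 0)
    (hlim : Tendsto (fun n => ‖(A n).det * (B n).det‖ / (filtered (A n) (B n) K).trace.re) atTop
      (𝓝 m⁻¹)) : maxEF K = concEntropy (C / m) := by
  refine le_antisymm h.maxEF_le ?_
  have h1 := (continuous_concEntropy.tendsto _).comp (hlim.const_mul C)
  rw [← div_eq_mul_inv] at h1
  refine le_of_tendsto' h1 fun n => ?_
  exact (h.le_entanglementOfFormation (hA n) (hB n)).trans
    (le_csSup (maxEF_bddAbove K) ⟨A n, B n, h.admissible (hA n) (hB n), rfl⟩)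

/-- If the trace never attains its lower bound, then `maxEF` is not attained. -/
theorem HasConcurrence.not_attained (h : HasConcurrence K C m) (hC : 0 < C)
    (hlt : ∀ A B, Admissible A B K → ‖A.det * B.det‖ * m < (filtered A B K).trace.re) :
    ¬ ∃ A B, Admissible A B K ∧ entanglementOfFormation (localOp A B K) = concEntropy (C / m) := by
  rintro ⟨A, B, hadm, heq⟩
  have h1 := h.ratio_mem hadm
  have hT := h.trace_pos hadm
  refine (h.entanglementOfFormation_le hadm).not_gt ?_
  rw [heq]
  refine strictMonoOn_concEntropy ⟨h1.1, h1.2.trans h.div_mem.2⟩ h.div_mem ?_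
  rw [div_eq_mul_one_div C]
  refine mul_lt_mul_of_pos_left ?_ hC
  rw [div_lt_div_iff₀ hT h.pos, one_mul]
  exact hlt A B hadm

end FilteredStates

/-! ### Invariance under invertible filtering -/

section Invariance

variable {ρ : Matrix Q Q ℂ} {A₀ B₀ : Matrix (Fin 2) (Fin 2) ℂ}

theorem localOp_filtered (A B : Matrix (Fin 2) (Fin 2) ℂ) :
    localOp A B (filtered A₀ B₀ ρ) = localOp (A * A₀) (B * B₀) ρ := by
  rw [localOp, localOp, filtered_filtered]

theorem admissible_filtered (A B : Matrix (Fin 2) (Fin 2) ℂ) :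
    Admissible A B (filtered A₀ B₀ ρ) ↔ Admissible (A * A₀) (B * B₀) ρ := by
  rw [Admissible, Admissible, filtered_filtered]

theorem exists_filtered_iff (hA : A₀.det ≠ 0) (hB : B₀.det ≠ 0) (P : Matrix Q Q ℂ → Prop) :
    (∃ A B, Admissible A B (filtered A₀ B₀ ρ) ∧ P (localOp A B (filtered A₀ B₀ ρ))) ↔
      ∃ A B, Admissible A B ρ ∧ P (localOp A B ρ) := by
  constructor
  · rintro ⟨A, B, h1, h2⟩
    exact ⟨A * A₀, B * B₀, (admissible_filtered A B).1 h1, by rwa [localOp_filtered] at h2⟩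
  · rintro ⟨A, B, h1, h2⟩
    have eA : A * A₀⁻¹ * A₀ = A := Matrix.nonsing_inv_mul_cancel_right _ _ (isUnit_iff_ne_zero.2 hA)
    have eB : B * B₀⁻¹ * B₀ = B := Matrix.nonsing_inv_mul_cancel_right _ _ (isUnit_iff_ne_zero.2 hB)
    refine ⟨A * A₀⁻¹, B * B₀⁻¹, ?_, ?_⟩
    · rwa [admissible_filtered, eA, eB]
    · rwa [localOp_filtered, eA, eB]

theorem maxEF_filtered (hA : A₀.det ≠ 0) (hB : B₀.det ≠ 0) :
    maxEF (filtered A₀ B₀ ρ) = maxEF ρ := by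
  unfold maxEF
  congr 1
  ext x
  exact exists_filtered_iff hA hB fun σ => x = entanglementOfFormation σ

theorem incompletelyDistillable_of_filtered (hA : A₀.det ≠ 0) (hB : B₀.det ≠ 0)
    (h : IncompletelyDistillable (filtered A₀ B₀ ρ)) : IncompletelyDistillable ρ := by
  obtain ⟨h1, h2⟩ := h
  rw [maxEF_filtered hA hB] at h1 h2
  exact ⟨h1, (exists_filtered_iff hA hB fun σ =>
    entanglementOfFormation σ = maxEF ρ ∧ IsBellDiagonal σ).1 h2⟩

theorem distillable_of_filtered (hA : A₀.det ≠ 0) (hB : B₀.det ≠ 0)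
    (h : Distillable (filtered A₀ B₀ ρ)) : Distillable ρ := by
  obtain ⟨h1, h2⟩ := h
  rw [maxEF_filtered hA hB] at h1
  exact ⟨h1, (exists_filtered_iff hA hB IsBellState).1 h2⟩

theorem incompletelyQuasiDistillable_of_filtered (hA : A₀.det ≠ 0) (hB : B₀.det ≠ 0)
    (h : IncompletelyQuasiDistillable (filtered A₀ B₀ ρ)) : IncompletelyQuasiDistillable ρ := by
  obtain ⟨h1, h2, A, B, σ, h3, h4, h5⟩ := h
  rw [maxEF_filtered hA hB] at h1 h2 h5
  simp only [admissible_filtered, localOp_filtered] at h3 h4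
  refine ⟨h1, ?_, _, _, σ, h3, h4, h5⟩
  rwa [exists_filtered_iff hA hB fun σ => entanglementOfFormation σ = maxEF ρ] at h2

theorem quasiDistillable_of_filtered (hA : A₀.det ≠ 0) (hB : B₀.det ≠ 0)
    (h : QuasiDistillable (filtered A₀ B₀ ρ)) : QuasiDistillable ρ := by
  obtain ⟨h1, h2, A, B, σ, h3, h4, h5⟩ := h
  rw [maxEF_filtered hA hB] at h1
  simp only [admissible_filtered, localOp_filtered] at h3 h4
  refine ⟨h1, ?_, _, _, σ, h3, h4, h5⟩
  rwa [exists_filtered_iff hA hB fun σ => entanglementOfFormation σ = 1] at h2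

end Invariance

/-! ### The Bell basis -/

/-- The operator with weights `w` in the Bell basis. -/
noncomputable def bellDiag (w : Q → ℝ) : Matrix Q Q ℂ :=
  ∑ k, w k • ketbra (bellVector k.1 k.2)

/-- The value of the spin-flip form at the Bell vectors. -/
noncomputable def bellSign (k : Q) : ℂ := (-1) ^ (k.1.val + k.2.val)

theorem sqrt_two_inv_mul_self : ((√2 : ℝ) : ℂ)⁻¹ * ((√2 : ℝ) : ℂ)⁻¹ = 1 / 2 := by
  rw [← mul_inv, ← Complex.ofReal_mul, Real.mul_self_sqrt zero_le_two]; simp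

theorem star_bellVector (x z : Fin 2) (q : Q) : star (bellVector x z q) = bellVector x z q := by
  unfold bellVector
  split_ifs <;> simp

theorem tau_bellVector (k l : Q) :
    tau (bellVector k.1 k.2) (bellVector l.1 l.2) = if k = l then bellSign k else 0 := by
  obtain ⟨a, b⟩ := k
  obtain ⟨c, d⟩ := l
  have h := sqrt_two_inv_mul_self
  fin_cases a <;> fin_cases b <;> fin_cases c <;> fin_cases d <;>
    simp [tau, bellVector, bellSign, div_eq_mul_inv, h] <;> norm_num

/-- The Bell vectors are orthonormal. -/
theorem bellVector_dotProduct (k l : Q) :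
    ∑ q, bellVector k.1 k.2 q * bellVector l.1 l.2 q = if k = l then 1 else 0 := by
  obtain ⟨a, b⟩ := k
  obtain ⟨c, d⟩ := l
  have h := sqrt_two_inv_mul_self
  fin_cases a <;> fin_cases b <;> fin_cases c <;> fin_cases d <;>
    simp [sum_Q, bellVector, div_eq_mul_inv, h] <;> norm_num

/-- The spin-flip form is diagonal in Bell coordinates. -/
theorem tau_self_eq_sum_bell (v : Q → ℂ) :
    tau v v = ∑ k, bellSign k * (∑ q, bellVector k.1 k.2 q * v q) ^ 2 := by
  have h := sqrt_two_inv_mul_self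
  simp only [sum_Q]
  simp [tau, bellVector, bellSign, div_eq_mul_inv]
  linear_combination (-4 * (v (0, 0) * v (1, 1) - v (0, 1) * v (1, 0))) * h

theorem norm_bellSign (k : Q) : ‖bellSign k‖ = 1 := by simp [bellSign]

theorem bellSign_ne_zero (k : Q) : bellSign k ≠ 0 := by
  rw [← norm_ne_zero_iff, norm_bellSign]; exact one_ne_zero

/-- Every complex number is the value of the spin-flip form on a multiple of a given Bell vector. -/
theorem exists_smul_bellVector (t : Q → ℂ) : ∃ x : Q → Q → ℂ,
    (∀ k, ketbra (x k) = ‖t k‖ • ketbra (bellVector k.1 k.2)) ∧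
    (∀ k, ∃ c : ℂ, x k = c • bellVector k.1 k.2) ∧
    ∀ k l, tau (x k) (x l) = if k = l then t k else 0 := by
  have h : ∀ k, ∃ c : ℂ, c ^ 2 = t k * (bellSign k)⁻¹ := fun k =>
    IsAlgClosed.exists_pow_nat_eq _ two_pos
  choose c hc using h
  refine ⟨fun k => c k • bellVector k.1 k.2, fun k => ?_, fun k => ⟨c k, rfl⟩, fun k l => ?_⟩
  · rw [ketbra_smul, ← norm_pow, hc, norm_mul, norm_inv, norm_bellSign, inv_one, mul_one]
    ext i j; simp
  · rw [tau_smul_left, tau_smul_right, tau_bellVector]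
    split_ifs with hkl
    · subst hkl
      rw [← mul_assoc, ← sq, hc, inv_mul_cancel_right₀ (bellSign_ne_zero k)]
    · simp

/-- The expectation of an operator in a real vector is linear. -/
theorem expectation_sum {κ : Type*} [Fintype κ] (b : Q → ℂ) (hb : ∀ q, star (b q) = b q)
    (c : κ → ℝ) (u : κ → Q → ℂ) :
    ∑ p, ∑ q, b p * (∑ i, c i • ketbra (u i)) p q * b q =
      ((∑ i, c i * ‖∑ q, b q * u i q‖ ^ 2 : ℝ) : ℂ) := by
  have key : ∀ i, ((c i * ‖∑ q, b q * u i q‖ ^ 2 : ℝ) : ℂ) =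
      ∑ p, ∑ q, b p * (c i • ketbra (u i)) p q * b q := fun i => by
    push_cast
    rw [← Complex.mul_conj', ← Complex.star_def, star_sum, Finset.sum_mul_sum, Finset.mul_sum]
    refine Finset.sum_congr rfl fun p _ => ?_
    rw [Finset.mul_sum]
    refine Finset.sum_congr rfl fun q _ => ?_
    rw [star_mul', hb, ketbra, Matrix.smul_apply, Matrix.vecMulVec_apply, Pi.star_apply,
      Complex.real_smul]
    ring
  rw [Complex.ofReal_sum, Finset.sum_congr rfl fun i _ => key i]
  simp only [Matrix.sum_apply, Finset.mul_sum, Finset.sum_mul]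
  calc _ = ∑ p, ∑ i, ∑ q, b p * (c i • ketbra (u i)) p q * b q :=
        Finset.sum_congr rfl fun p _ => Finset.sum_comm
    _ = _ := Finset.sum_comm

/-- The weight of a decomposed Bell-diagonal operator at a Bell state. -/
theorem sum_norm_sq_bell {κ : Type*} [Fintype κ] {w : Q → ℝ} (v : κ → Q → ℂ)
    (h : bellDiag w = ∑ i, ketbra (v i)) (l : Q) :
    ∑ i, ‖∑ q, bellVector l.1 l.2 q * v i q‖ ^ 2 = w l := by
  have h1 := expectation_sum (bellVector l.1 l.2) (star_bellVector _ _) w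
    fun k => bellVector k.1 k.2
  have h2 := expectation_sum (bellVector l.1 l.2) (star_bellVector _ _) (fun _ => (1 : ℝ)) v
  simp only [one_smul, one_mul] at h2
  rw [← h, bellDiag] at h2
  rw [← Complex.ofReal_injective (h1.symm.trans h2), Finset.sum_eq_single l]
  · rw [bellVector_dotProduct, if_pos rfl]; simp
  · intro k _ hk
    rw [bellVector_dotProduct, if_neg hk.symm]; simp
  · simp

/-- The reverse triangle inequality for a sum with one distinguished term. -/
theorem two_mul_sub_sum_le_norm_sum (g : Q → ℂ) (k₀ : Q) :
    2 * ‖g k₀‖ - ∑ k, ‖g k‖ ≤ ‖∑ k, g k‖ := by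
  rw [← Finset.add_sum_erase _ _ (Finset.mem_univ k₀),
    ← Finset.add_sum_erase _ _ (Finset.mem_univ k₀)]
  have h3 := norm_sum_le (Finset.univ.erase k₀) g
  have h4 := norm_sub_le_norm_add (g k₀) (∑ k ∈ Finset.univ.erase k₀, g k)
  linarith

/-- An ensemble on which the spin-flip form is real diagonal bounds the trace under filtering, by
the inequality between the norm and the determinant of a `2 × 2` matrix. -/
theorem HasConcurrence.of_decomp {K : Matrix Q Q ℂ} {C m : ℝ} (x : Q → Q → ℂ) (t : Q → ℝ)
    (hK : K = ∑ k, ketbra (x k))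
    (hx : ∀ k l, tau (x k) (x l) = if k = l then (t k : ℂ) else 0) (hC : ∑ k, t k = C)
    (hm : ∑ k, |t k| = m) (hC0 : 0 ≤ C) (hm0 : 0 < m)
    (lower : ∀ (n : ℕ) (v : Fin n → Q → ℂ), K = ∑ i, ketbra (v i) → C ≤ ∑ i, conc (v i)) :
    HasConcurrence K C m where
  nonneg := hC0
  pos := hm0
  le := by rw [← hC, ← hm]; exact Finset.sum_le_sum fun k _ => le_abs_self _
  decomp := ⟨x, t, hK, hx, hC⟩
  lower := lower
  trace_le A B := by
    rw [hK, trace_filtered_sum, Complex.ofReal_re, ← hm, Finset.mul_sum]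
    refine Finset.sum_le_sum fun k _ => ?_
    refine le_trans (le_of_eq ?_) (conc_le_normSq _)
    rw [conc_kronecker_mulVec, conc, hx, if_pos rfl, Complex.norm_real, Real.norm_eq_abs]

/-- If one weight `w k₀` exceeds the sum of the others, then the concurrence is the excess. For the
lower bound, the spin-flip form of a vector is a signed sum of squares in Bell coordinates, and the
reverse triangle inequality singles out the coordinate `k₀`. -/
theorem hasConcurrence_bellDiag {w : Q → ℝ} (hw : ∀ k, 0 ≤ w k) {k₀ : Q}
    (h : ∑ k, w k < 2 * w k₀) :
    HasConcurrence (bellDiag w) (2 * w k₀ - ∑ k, w k) (∑ k, w k) := by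
  set t : Q → ℝ := fun k => if k = k₀ then w k else -w k with ht
  have habs : ∀ k, |t k| = w k := fun k => by
    rw [ht]; dsimp only; split_ifs <;> simp [abs_of_nonneg (hw k)]
  have hsum : ∑ k, t k = 2 * w k₀ - ∑ k, w k := by
    have : ∀ k, t k = (if k = k₀ then 2 * w k else 0) - w k := fun k => by
      rw [ht]; dsimp only; split_ifs <;> ring
    rw [Finset.sum_congr rfl fun k _ => this k, Finset.sum_sub_distrib]
    simp
  have hw0 : w k₀ ≤ ∑ k, w k := Finset.single_le_sum (fun k _ => hw k) (Finset.mem_univ _)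
  obtain ⟨x, hx1, -, hx2⟩ := exists_smul_bellVector fun k => (t k : ℂ)
  refine HasConcurrence.of_decomp x t ?_ hx2 hsum ?_ (by linarith) (by linarith) ?_
  · rw [bellDiag]
    refine Finset.sum_congr rfl fun k _ => ?_
    rw [hx1, Complex.norm_real, Real.norm_eq_abs, habs]
  · exact Finset.sum_congr rfl fun k _ => habs k
  · intro n v hv
    have h1 := sum_norm_sq_bell v hv
    simp only [← h1]
    rw [Finset.sum_comm, Finset.mul_sum, ← Finset.sum_sub_distrib]
    refine Finset.sum_le_sum fun i _ => ?_
    have h2 : ∀ k, ‖bellSign k * (∑ q, bellVector k.1 k.2 q * v i q) ^ 2‖ =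
        ‖∑ q, bellVector k.1 k.2 q * v i q‖ ^ 2 := fun k => by
      rw [norm_mul, norm_bellSign, one_mul, norm_pow]
    have h3 := two_mul_sub_sum_le_norm_sum
      (fun k => bellSign k * (∑ q, bellVector k.1 k.2 q * v i q) ^ 2) k₀
    simp only [h2] at h3
    rw [conc, tau_self_eq_sum_bell]
    exact h3

theorem trace_bellDiag (w : Q → ℝ) : (bellDiag w).trace = ((∑ k, w k : ℝ) : ℂ) := by
  rw [bellDiag, Matrix.trace_sum]
  push_cast
  refine Finset.sum_congr rfl fun k _ => ?_
  have : normSq (bellVector k.1 k.2) = 1 := by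
    have h := bellVector_dotProduct k k
    rw [if_pos rfl] at h
    have h1 : ((normSq (bellVector k.1 k.2) : ℝ) : ℂ) = 1 := by
      rw [← h, normSq]; push_cast
      refine Finset.sum_congr rfl fun q _ => ?_
      rw [← Complex.mul_conj', ← Complex.star_def, star_bellVector]
    exact_mod_cast h1
  rw [Matrix.trace_smul, trace_ketbra, this]; simp

theorem isBellDiagonal_smul_bellDiag (c : ℝ) (w : Q → ℝ) : IsBellDiagonal (c • bellDiag w) := by
  refine ⟨fun x z => c * w (x, z), ?_⟩
  rw [bellDiag, Fintype.sum_prod_type, Finset.smul_sum]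
  refine Finset.sum_congr rfl fun x _ => ?_
  rw [Finset.smul_sum]
  exact Finset.sum_congr rfl fun z _ => smul_smul _ _ _

theorem localOp_one_bellDiag (w : Q → ℝ) :
    localOp 1 1 (bellDiag w) = (∑ k, w k)⁻¹ • bellDiag w := by
  rw [localOp, filtered_one, trace_bellDiag]
  ext i j; simp

/-- The normalized Bell-diagonal state has the largest entanglement of formation in its orbit. -/
theorem maxEF_bellDiag {w : Q → ℝ} (hw : ∀ k, 0 ≤ w k) {k₀ : Q} (h : ∑ k, w k < 2 * w k₀) :
    maxEF (bellDiag w) = concEntropy ((2 * w k₀ - ∑ k, w k) / ∑ k, w k) ∧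
    entanglementOfFormation (localOp 1 1 (bellDiag w)) = maxEF (bellDiag w) := by
  have hc := hasConcurrence_bellDiag hw h
  have hT : (filtered 1 1 (bellDiag w)).trace.re = ∑ k, w k := by
    rw [filtered_one, trace_bellDiag, Complex.ofReal_re]
  have h1 := hc.maxEF_eq (fun _ => 1) (fun _ => 1) (by simp) (by simp) (by
    rw [hT]; simp)
  have h2 := hc.entanglementOfFormation_le (hc.admissible (A := 1) (B := 1) (by simp) (by simp))
  have h3 := hc.le_entanglementOfFormation (A := 1) (B := 1) (by simp) (by simp)
  rw [hT] at h2 h3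
  simp only [Matrix.det_one, mul_one, norm_one, mul_one_div] at h2 h3
  exact ⟨h1, by rw [h1]; exact le_antisymm h2 h3⟩

theorem incompletelyDistillable_bellDiag {w : Q → ℝ} (hw : ∀ k, 0 ≤ w k) {k₀ : Q}
    (h : ∑ k, w k < 2 * w k₀) (hlt : w k₀ < ∑ k, w k) : IncompletelyDistillable (bellDiag w) := by
  have hc := hasConcurrence_bellDiag hw h
  obtain ⟨h1, h2⟩ := maxEF_bellDiag hw h
  refine ⟨?_, 1, 1, hc.admissible (by simp) (by simp), h2, ?_⟩
  · rw [h1, ← concEntropy_one]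
    exact strictMonoOn_concEntropy hc.div_mem ⟨zero_le_one, le_rfl⟩
      ((div_lt_one hc.pos).2 (by linarith))
  · rw [localOp_one_bellDiag]
    exact isBellDiagonal_smul_bellDiag _ _

/-! ### Separable Bell-diagonal states -/

theorem exists_norm_add_mul_eq {a b s : ℝ} (h1 : |a - b| ≤ s) (h2 : s ≤ a + b) :
    ∃ u : ℂ, ‖u‖ = 1 ∧ ‖(a : ℂ) + b * u‖ = s := by
  have hcont : Continuous fun θ : ℝ => ‖(a : ℂ) + b * Complex.exp (θ * Complex.I)‖ := by fun_prop
  have h0 : (fun θ : ℝ => ‖(a : ℂ) + b * Complex.exp (θ * Complex.I)‖) Real.pi ≤ s := by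
    simp only [Complex.exp_pi_mul_I]
    rw [mul_neg_one, ← sub_eq_add_neg, ← Complex.ofReal_sub, Complex.norm_real]
    exact h1
  have h3 : s ≤ (fun θ : ℝ => ‖(a : ℂ) + b * Complex.exp (θ * Complex.I)‖) 0 := by
    simp only [Complex.ofReal_zero, zero_mul, Complex.exp_zero, mul_one]
    rw [← Complex.ofReal_add, Complex.norm_real]
    exact h2.trans (le_abs_self _)
  obtain ⟨θ, -, hθ⟩ := intermediate_value_Icc' Real.pi_pos.le hcont.continuousOn ⟨h0, h3⟩
  exact ⟨_, Complex.norm_exp_ofReal_mul_I θ, hθ⟩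

/-- Four lengths, none of which exceeds the sum of the others, are the side lengths of a closed
quadrilateral. -/
theorem exists_closed_quadrilateral (w : Q → ℝ) (hw : ∀ k, 0 ≤ w k)
    (h : ∀ k, 2 * w k ≤ ∑ l, w l) : ∃ t : Q → ℂ, (∀ k, ‖t k‖ = w k) ∧ ∑ k, t k = 0 := by
  set a := w (0, 0)
  set b := w (0, 1)
  set c := w (1, 0)
  set d := w (1, 1)
  have ha : 0 ≤ a := hw _
  have hb : 0 ≤ b := hw _
  have hc : 0 ≤ c := hw _
  have hd : 0 ≤ d := hw _
  have h00 : 2 * a ≤ a + b + (c + d) := by rw [← sum_Q w]; exact h _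
  have h01 : 2 * b ≤ a + b + (c + d) := by rw [← sum_Q w]; exact h _
  have h10 : 2 * c ≤ a + b + (c + d) := by rw [← sum_Q w]; exact h _
  have h11 : 2 * d ≤ a + b + (c + d) := by rw [← sum_Q w]; exact h _
  obtain ⟨u, hu, hu'⟩ := exists_norm_add_mul_eq (le_max_left |a - b| |c - d|)
    (max_le (abs_le.2 ⟨by linarith, by linarith⟩) (abs_le.2 ⟨by linarith, by linarith⟩))
  obtain ⟨v, hv, hv'⟩ := exists_norm_add_mul_eq (le_max_right |a - b| |c - d|)
    (max_le (abs_le.2 ⟨by linarith, by linarith⟩) (abs_le.2 ⟨by linarith, by linarith⟩))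
  obtain ⟨y, hy, hy'⟩ : ∃ y : ℂ, ‖y‖ = 1 ∧ (a + b * u) + y * (c + d * v) = 0 := by
    by_cases h0 : (c : ℂ) + d * v = 0
    · refine ⟨1, norm_one, ?_⟩
      rw [h0, norm_zero] at hv'
      rw [← hv', norm_eq_zero] at hu'
      rw [hu', h0]; simp
    · refine ⟨-(a + b * u) / (c + d * v), ?_, ?_⟩
      · rw [norm_div, norm_neg, hu', ← hv', div_self (norm_ne_zero_iff.2 h0)]
      · rw [div_mul_cancel₀ _ h0, add_neg_cancel]
  refine ⟨fun q => if q = (0, 0) then a else if q = (0, 1) then b * u else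
    if q = (1, 0) then y * c else y * (d * v), fun k => ?_, ?_⟩
  · obtain ⟨i, j⟩ := k
    fin_cases i <;> fin_cases j <;> simp [hu, hv, hy, abs_of_nonneg, ha, hb, hc, hd] <;> rfl
  · rw [sum_Q]
    simp
    linear_combination hy'

/-- A local image of a Bell-diagonal operator without dominating weight is separable. -/
theorem isSeparable_of_eq_filtered_bellDiag {w : Q → ℝ} (hw : ∀ k, 0 ≤ w k)
    (h : ∀ k, 2 * w k ≤ ∑ l, w l) {A B : Matrix (Fin 2) (Fin 2) ℂ} {ρ : Matrix Q Q ℂ}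
    (hρ : ρ = filtered A B (bellDiag w)) (htr : ρ.trace = 1) : IsSeparable ρ := by
  obtain ⟨t, ht, ht0⟩ := exists_closed_quadrilateral w hw h
  obtain ⟨x, hx1, -, hx2⟩ := exists_smul_bellVector t
  refine isSeparable_of_tau_diagonal (fun k => (A ⊗ₖ B) *ᵥ x k) (fun k => A.det * B.det * t k) ?_ htr
    (fun k l => ?_) ?_
  · simp only [← filtered_ketbra]
    rw [← filtered_sum, hρ, bellDiag]
    congr 1
    exact Finset.sum_congr rfl fun k _ => by rw [hx1, ht]
  · rw [tau_kronecker_mulVec, hx2]; split_ifs <;> simp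
  · rw [← Finset.mul_sum, ht0, mul_zero]

/-! ### Product vectors and ranks -/

theorem isProductVector_iff {v : Q → ℂ} : IsProductVector v ↔ v ≠ 0 ∧ tau v v = 0 := by
  refine and_congr_right fun _ => ⟨?_, fun h => exists_eq_mul_of_conc_eq_zero ?_⟩
  · rintro ⟨a, b, rfl⟩; exact tau_self_mul a b
  · rw [conc, h, norm_zero]

theorem tau_self_combination (s t : ℂ) (u v : Q → ℂ) :
    tau (s • u + t • v) (s • u + t • v) =
      s ^ 2 * tau u u + 2 * s * t * tau u v + t ^ 2 * tau v v := by
  simp only [tau, Pi.add_apply, Pi.smul_apply, smul_eq_mul]; ring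

/-- A tangent line of the quadric of product vectors. -/
theorem encard_productLines_eq_one {u v : Q → ℂ} (hu : u ≠ 0) (huu : tau u u = 0)
    (huv : tau u v = 0) (hvv : tau v v ≠ 0) :
    (productLines (Submodule.span ℂ {u, v})).encard = 1 := by
  rw [Set.encard_eq_one]
  refine ⟨Submodule.span ℂ {u}, Set.ext fun L => ⟨?_, ?_⟩⟩
  · rintro ⟨x, hx, hxp, rfl⟩
    obtain ⟨s, t, rfl⟩ := Submodule.mem_span_pair.1 hx
    obtain ⟨hx0, hxx⟩ := isProductVector_iff.1 hxp
    rw [tau_self_combination, huu, huv] at hxx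
    have ht : t = 0 := by simpa [hvv] using hxx
    subst ht
    rw [zero_smul, add_zero] at hx0 ⊢
    have hs : s ≠ 0 := fun h => hx0 (by rw [h, zero_smul])
    exact Submodule.span_singleton_smul_eq (isUnit_iff_ne_zero.2 hs) u
  · rintro rfl
    exact ⟨u, Submodule.subset_span (by simp), isProductVector_iff.2 ⟨hu, huu⟩, rfl⟩

/-- A secant line of the quadric of product vectors. -/
theorem encard_productLines_eq_two {u v : Q → ℂ} (huu : tau u u = 0)
    (huv : tau u v ≠ 0) (hvv : tau v v = 0) :
    (productLines (Submodule.span ℂ {u, v})).encard = 2 := by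
  have hu : u ≠ 0 := fun h => huv (by rw [h]; simp [tau])
  have hv : v ≠ 0 := fun h => huv (by rw [h]; simp [tau])
  rw [Set.encard_eq_two]
  refine ⟨Submodule.span ℂ {u}, Submodule.span ℂ {v}, ?_, Set.ext fun L => ⟨?_, ?_⟩⟩
  · intro h
    have h1 : v ∈ Submodule.span ℂ {u} := by rw [h]; exact Submodule.mem_span_singleton_self v
    obtain ⟨c, rfl⟩ := Submodule.mem_span_singleton.1 h1
    rw [tau_smul_right, huu, mul_zero] at huv
    exact huv rfl
  · rintro ⟨x, hx, hxp, rfl⟩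
    obtain ⟨s, t, rfl⟩ := Submodule.mem_span_pair.1 hx
    obtain ⟨hx0, hxx⟩ := isProductVector_iff.1 hxp
    rw [tau_self_combination, huu, hvv] at hxx
    have hst : s = 0 ∨ t = 0 := by simpa [huv] using hxx
    rcases hst with rfl | rfl
    · rw [zero_smul, zero_add] at hx0 ⊢
      have hs : t ≠ 0 := fun h => hx0 (by rw [h, zero_smul])
      exact Or.inr (Submodule.span_singleton_smul_eq (isUnit_iff_ne_zero.2 hs) v)
    · rw [zero_smul, add_zero] at hx0 ⊢
      have hs : s ≠ 0 := fun h => hx0 (by rw [h, zero_smul])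
      exact Or.inl (Submodule.span_singleton_smul_eq (isUnit_iff_ne_zero.2 hs) u)
  · rintro (rfl | rfl)
    · exact ⟨u, Submodule.subset_span (by simp), isProductVector_iff.2 ⟨hu, huu⟩, rfl⟩
    · exact ⟨v, Submodule.subset_span (by simp), isProductVector_iff.2 ⟨hv, hvv⟩, rfl⟩

/-- The support of a rank-two operator is spanned by two vectors spanning its ensemble. -/
theorem support_eq_span_pair {κ : Type*} [Fintype κ] {ρ : Matrix Q Q ℂ} (hr : ρ.rank = 2)
    (v : κ → Q → ℂ) (hρ : ρ = ∑ i, ketbra (v i)) {u₁ u₂ : Q → ℂ}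
    (hv : ∀ i, v i ∈ Submodule.span ℂ {u₁, u₂}) : support ρ = Submodule.span ℂ {u₁, u₂} := by
  refine Submodule.eq_of_le_of_finrank_le ?_ ?_
  · rintro _ ⟨x, rfl⟩
    rw [Matrix.mulVecLin_apply, hρ, Matrix.sum_mulVec]
    refine Submodule.sum_mem _ fun i _ => ?_
    rw [ketbra, Matrix.vecMulVec_mulVec]
    have : MulOpposite.op (star (v i) ⬝ᵥ x) • v i = (star (v i) ⬝ᵥ x) • v i := by
      ext; simp [mul_comm]
    rw [this]
    exact Submodule.smul_mem _ _ (hv i)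
  · have h1 : Module.finrank ℂ (support ρ) = 2 := hr
    rw [h1]
    classical
    have h2 := finrank_span_finset_le_card (R := ℂ) ({u₁, u₂} : Finset (Q → ℂ))
    have h3 : Module.finrank ℂ (Submodule.span ℂ {u₁, u₂}) ≤ ({u₁, u₂} : Finset (Q → ℂ)).card := by
      rwa [Finset.coe_pair] at h2
    exact h3.trans Finset.card_le_two

theorem kronecker_det_ne_zero {A B : Matrix (Fin 2) (Fin 2) ℂ} (hA : A.det ≠ 0) (hB : B.det ≠ 0) :
    IsUnit (A ⊗ₖ B).det := by
  rw [Matrix.det_kronecker, isUnit_iff_ne_zero]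
  exact mul_ne_zero (pow_ne_zero _ hA) (pow_ne_zero _ hB)

theorem rank_filtered {A B : Matrix (Fin 2) (Fin 2) ℂ} (hA : A.det ≠ 0) (hB : B.det ≠ 0)
    (ρ : Matrix Q Q ℂ) : (filtered A B ρ).rank = ρ.rank := by
  have h := kronecker_det_ne_zero hA hB
  rw [filtered, Matrix.rank_mul_eq_left_of_isUnit_det, Matrix.rank_mul_eq_right_of_isUnit_det _ _ h]
  rw [Matrix.det_conjTranspose]
  exact h.star

theorem eq_filtered_inv {A B : Matrix (Fin 2) (Fin 2) ℂ} (hA : A.det ≠ 0) (hB : B.det ≠ 0)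
    (ρ : Matrix Q Q ℂ) : ρ = filtered A⁻¹ B⁻¹ (filtered A B ρ) := by
  rw [filtered_filtered, Matrix.nonsing_inv_mul _ (isUnit_iff_ne_zero.2 hA),
    Matrix.nonsing_inv_mul _ (isUnit_iff_ne_zero.2 hB), filtered_one]

/-- An operator that is diagonal in an orthonormal basis of real vectors has as many non-zero
weights as its rank. -/
theorem rank_sum_smul_ketbra (e : Q → Q → ℂ) (he : ∀ k q, star (e k q) = e k q)
    (horth : ∀ k l, ∑ q, e k q * e l q = if k = l then 1 else 0) (w : Q → ℝ) :
    (∑ k, w k • ketbra (e k)).rank = ∑ k, if w k ≠ 0 then 1 else 0 := by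
  set M : Matrix Q Q ℂ := Matrix.of fun q k => e k q
  have hM : Mᴴ * M = 1 := by
    ext k l
    simp only [M, Matrix.mul_apply, Matrix.conjTranspose_apply, Matrix.of_apply, he, horth,
      Matrix.one_apply]
  have hdet : IsUnit M.det := by
    have := congrArg Matrix.det hM
    rw [Matrix.det_mul, Matrix.det_one] at this
    exact IsUnit.of_mul_eq_one_right _ this
  have hdet' : IsUnit Mᴴ.det := by rw [Matrix.det_conjTranspose]; exact hdet.star
  have heq : ∑ k, w k • ketbra (e k) = M * Matrix.diagonal (fun k => (w k : ℂ)) * Mᴴ := by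
    ext p q
    rw [Matrix.mul_apply, Matrix.sum_apply]
    refine Finset.sum_congr rfl fun k _ => ?_
    rw [Matrix.mul_diagonal, Matrix.smul_apply, ketbra, Matrix.vecMulVec_apply, Complex.real_smul]
    simp only [M, Matrix.conjTranspose_apply, Matrix.of_apply, Pi.star_apply]
    ring
  rw [heq, Matrix.rank_mul_eq_left_of_isUnit_det _ _ hdet',
    Matrix.rank_mul_eq_right_of_isUnit_det _ _ hdet, Matrix.rank_diagonal, Fintype.card_subtype,
    Finset.card_filter]
  simp

theorem rank_bellDiag (w : Q → ℝ) : (bellDiag w).rank = ∑ k, if w k ≠ 0 then 1 else 0 :=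
  rank_sum_smul_ketbra (fun k => bellVector k.1 k.2) (fun _ _ => star_bellVector _ _ _)
    bellVector_dotProduct w

/-! ### States whose kernel contains a product vector -/

/-- The normal form of the entangled operators with a product vector in the kernel. -/
noncomputable def asymState (r a b : ℝ) : Matrix Q Q ℂ :=
  r • ketbra (Pi.single (0, 0) 1) + a • ketbra (bellVector 1 0) + b • ketbra (bellVector 1 1)

/-- An orthonormal basis of eigenvectors of `asymState`. -/
noncomputable def asymBasis (k : Q) : Q → ℂ :=
  if k.1 = 0 then Pi.single (k.2, k.2) 1 else bellVector 1 k.2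

/-- The eigenvalues of `asymState`. -/
def asymWeight (r a b : ℝ) (k : Q) : ℝ :=
  if k.1 = 0 then (if k.2 = 0 then r else 0) else (if k.2 = 0 then a else b)

theorem asymState_eq_sum (r a b : ℝ) :
    asymState r a b = ∑ k, asymWeight r a b k • ketbra (asymBasis k) := by
  rw [sum_Q]
  simp [asymState, asymWeight, asymBasis, add_assoc]

theorem asymBasis_dotProduct (k l : Q) :
    ∑ q, asymBasis k q * asymBasis l q = if k = l then 1 else 0 := by
  obtain ⟨a, b⟩ := k
  obtain ⟨c, d⟩ := l
  have h := sqrt_two_inv_mul_self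
  fin_cases a <;> fin_cases b <;> fin_cases c <;> fin_cases d <;>
    simp [asymBasis, sum_Q, bellVector, div_eq_mul_inv, h] <;> norm_num

theorem rank_asymState (r a b : ℝ) : (asymState r a b).rank =
    (if r ≠ 0 then 1 else 0) + ((if a ≠ 0 then 1 else 0) + if b ≠ 0 then 1 else 0) := by
  rw [asymState_eq_sum, rank_sum_smul_ketbra _ (fun k q => ?_) asymBasis_dotProduct, sum_Q]
  · simp [asymWeight]
  · unfold asymBasis
    split_ifs
    · rw [Pi.single_apply]; split_ifs <;> simp
    · exact star_bellVector _ _ _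

theorem asymState_zero (a b : ℝ) : asymState 0 a b = bellDiag fun k =>
    if k.1 = 0 then 0 else if k.2 = 0 then a else b := by
  rw [bellDiag, sum_Q]
  simp [asymState]

/-- The ensemble of `asymState` certifying its concurrence. -/
theorem exists_asymState_decomp {r a b : ℝ} (hr : 0 ≤ r) (ha : 0 ≤ a) (hb : 0 ≤ b) :
    ∃ x : Q → Q → ℂ, asymState r a b = ∑ k, ketbra (x k) ∧
      x (0, 0) = ((√r : ℝ) : ℂ) • Pi.single (0, 0) 1 ∧
      ∀ k l, tau (x k) (x l) =
        if k = l then ((if k.1 = 0 then 0 else if k.2 = 0 then a else -b : ℝ) : ℂ) else 0 := by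
  obtain ⟨y, hy1, hy3, hy2⟩ := exists_smul_bellVector fun k => ((if k.2 = 0 then a else -b : ℝ) : ℂ)
  obtain ⟨c0, hc0⟩ := hy3 (1, 0)
  obtain ⟨c1, hc1⟩ := hy3 (1, 1)
  refine ⟨fun k => if k.1 = 0 then (if k.2 = 0 then ((√r : ℝ) : ℂ) • Pi.single (0, 0) 1 else 0)
    else y k, ?_, by simp, ?_⟩
  · rw [sum_Q]
    simp only [if_true, one_ne_zero, if_false, hy1]
    rw [ketbra_real_smul, Real.sq_sqrt hr]
    simp only [Complex.norm_real, Real.norm_eq_abs, abs_neg, abs_of_nonneg ha, abs_of_nonneg hb]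
    have : ketbra (0 : Q → ℂ) = 0 := by ext; simp [ketbra, Matrix.vecMulVec_apply]
    rw [this, add_zero, asymState, add_assoc]
  · have h10 := hy2 (1, 0) (1, 0)
    have h11 := hy2 (1, 1) (1, 1)
    have h01 := hy2 (1, 0) (1, 1)
    have h01' := hy2 (1, 1) (1, 0)
    rintro ⟨i, j⟩ ⟨k, l⟩
    fin_cases i <;> fin_cases j <;> fin_cases k <;> fin_cases l <;>
      first
      | simpa using h10
      | simpa using h11
      | simpa using h01
      | simpa using h01'
      | simp [tau, hc0, hc1, bellVector]

theorem asymState_apply (r a b : ℝ) :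
    asymState r a b (1, 1) (1, 1) = 0 ∧ asymState r a b (0, 1) (1, 0) = (((a - b) / 2 : ℝ) : ℂ) := by
  have h := sqrt_two_inv_mul_self
  constructor
  · simp [asymState, ketbra, Matrix.vecMulVec_apply, bellVector]
  · simp [asymState, ketbra, Matrix.vecMulVec_apply, bellVector, div_eq_mul_inv]
    linear_combination (a - b) * h

theorem hasConcurrence_asymState {r a b : ℝ} (hr : 0 ≤ r) (hb : 0 ≤ b) (hab : b < a) :
    HasConcurrence (asymState r a b) (a - b) (a + b) := by
  have ha : 0 ≤ a := hb.trans hab.le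
  obtain ⟨x, hx1, -, hx2⟩ := exists_asymState_decomp hr ha hb
  refine HasConcurrence.of_decomp x _ hx1 hx2 ?_ ?_ (by linarith) (by linarith) ?_
  · rw [sum_Q]; simp; ring
  · rw [sum_Q]; simp [abs_of_nonneg ha, abs_of_nonneg hb]
  · intro n v hv
    obtain ⟨h11, h01⟩ := asymState_apply r a b
    -- All members of an ensemble vanish at `(1, 1)`, where the diagonal entry is zero.
    have hz : ∀ i, v i (1, 1) = 0 := by
      have h1 : ∑ i, ‖v i (1, 1)‖ ^ 2 = 0 := by
        rw [hv, Matrix.sum_apply] at h11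
        have : ∀ i, ketbra (v i) (1, 1) (1, 1) = ((‖v i (1, 1)‖ ^ 2 : ℝ) : ℂ) := fun i => by
          rw [ketbra, Matrix.vecMulVec_apply]; push_cast; rw [← Complex.mul_conj']; rfl
        rw [Finset.sum_congr rfl fun i _ => this i] at h11
        exact_mod_cast h11
      intro i
      have := (Finset.sum_eq_zero_iff_of_nonneg fun i _ => sq_nonneg _).1 h1 i (Finset.mem_univ i)
      simpa using this
    have h2 : a - b = ∑ i, 2 * (v i (0, 1) * star (v i (1, 0))).re := by
      have h3 : a - b = 2 * (asymState r a b (0, 1) (1, 0)).re := by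
        rw [h01, Complex.ofReal_re]; ring
      rw [h3, hv, Matrix.sum_apply, Complex.re_sum, Finset.mul_sum]
      rfl
    rw [h2]
    refine Finset.sum_le_sum fun i _ => ?_
    have h4 : tau (v i) (v i) = -(2 * (v i (0, 1) * v i (1, 0))) := by
      unfold tau; rw [hz i]; ring
    rw [conc, h4, norm_neg, norm_mul, Complex.norm_ofNat, norm_mul]
    have h5 := Complex.re_le_norm (v i (0, 1) * star (v i (1, 0)))
    rw [norm_mul, norm_star] at h5
    linarith

/-- The component on the product vector makes every filtered trace larger than its bound. -/
theorem asymState_trace_lt {r a b : ℝ} (hr : 0 < r) (hb : 0 ≤ b) (hab : b < a)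
    (A B : Matrix (Fin 2) (Fin 2) ℂ) (hadm : Admissible A B (asymState r a b)) :
    ‖A.det * B.det‖ * (a + b) < (filtered A B (asymState r a b)).trace.re := by
  have ha : 0 ≤ a := hb.trans hab.le
  have hc := hasConcurrence_asymState hr.le hb hab
  by_cases hdet : A.det * B.det = 0
  · rw [hdet, norm_zero, zero_mul]; exact hc.trace_pos hadm
  have hA : A.det ≠ 0 := left_ne_zero_of_mul hdet
  have hB : B.det ≠ 0 := right_ne_zero_of_mul hdet
  obtain ⟨x, hx1, hx0, hx2⟩ := exists_asymState_decomp hr.le ha hb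
  have hm : a + b = ∑ k, conc (x k) := by
    simp only [conc, hx2, if_true]
    rw [sum_Q]
    simp [abs_of_nonneg ha, abs_of_nonneg hb]
  rw [hx1, trace_filtered_sum, Complex.ofReal_re, hm, Finset.mul_sum]
  refine Finset.sum_lt_sum (fun k _ => ?_) ⟨(0, 0), Finset.mem_univ _, ?_⟩
  · rw [← conc_kronecker_mulVec]; exact conc_le_normSq _
  · have : conc (x (0, 0)) = 0 := by simp [conc, hx2]
    rw [this, mul_zero]
    refine (normSq_nonneg _).lt_of_ne fun h => ?_
    have h1 := Matrix.eq_zero_of_mulVec_eq_zero (kronecker_det_ne_zero hA hB).ne_zero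
      (normSq_eq_zero.1 h.symm)
    have h2 := congrFun h1 (0, 0)
    rw [hx0] at h2
    simp [Real.sqrt_eq_zero', not_le.2 hr] at h2

/-- Filtering both qubits by `diag(ε, 1)` damps the product vector. -/
theorem filtered_diag_asymState (r a b : ℝ) (ε : ℝ) :
    filtered (Matrix.diagonal ![(ε : ℂ), 1]) (Matrix.diagonal ![(ε : ℂ), 1]) (asymState r a b) =
      (ε ^ 2) • asymState (ε ^ 2 * r) a b := by
  set D : Matrix (Fin 2) (Fin 2) ℂ := Matrix.diagonal ![(ε : ℂ), 1]
  have h0 : (D ⊗ₖ D) *ᵥ (Pi.single (0, 0) 1) = ((ε ^ 2 : ℝ) : ℂ) • Pi.single (0, 0) 1 := by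
    ext ⟨i, j⟩
    fin_cases i <;> fin_cases j <;> simp [D, Matrix.kroneckerMap_apply, sq]
  have h1 : ∀ z, (D ⊗ₖ D) *ᵥ (bellVector 1 z) = ((ε : ℝ) : ℂ) • bellVector 1 z := by
    intro z
    ext ⟨i, j⟩
    fin_cases i <;> fin_cases j <;> fin_cases z <;>
      simp [D, Matrix.kroneckerMap_apply, Matrix.mulVec, dotProduct, sum_Q, bellVector]
  have hs : ∀ (c : ℝ) (M : Matrix Q Q ℂ), filtered D D (c • M) = c • filtered D D M := fun c M => by
    simp [filtered]
  have hadd : ∀ M N : Matrix Q Q ℂ, filtered D D (M + N) = filtered D D M + filtered D D N :=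
    fun M N => by simp [filtered, Matrix.mul_add, Matrix.add_mul]
  rw [asymState, hadd, hadd, hs, hs, hs, filtered_ketbra, filtered_ketbra, filtered_ketbra, h0, h1,
    h1, ketbra_real_smul, ketbra_real_smul, ketbra_real_smul, asymState]
  module

theorem trace_asymState (r a b : ℝ) : (asymState r a b).trace = ((r + a + b : ℝ) : ℂ) := by
  have h := sqrt_two_inv_mul_self
  simp [asymState, Matrix.trace, sum_Q, ketbra, Matrix.vecMulVec_apply, bellVector, div_eq_mul_inv]
  linear_combination (2 * a + 2 * b : ℂ) * h

theorem localOp_diag_asymState {r a b ε : ℝ} (hε : ε ≠ 0) :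
    localOp (Matrix.diagonal ![(ε : ℂ), 1]) (Matrix.diagonal ![(ε : ℂ), 1]) (asymState r a b) =
      (ε ^ 2 * r + a + b)⁻¹ • asymState (ε ^ 2 * r) a b := by
  rw [localOp, filtered_diag_asymState, Matrix.trace_smul, trace_asymState]
  ext i j
  simp only [Matrix.smul_apply, Complex.real_smul, smul_eq_mul, mul_inv, ← Complex.ofReal_mul,
    ← Complex.ofReal_inv]
  rw [← mul_assoc, ← Complex.ofReal_mul]
  congr 2
  field_simp

theorem hasLimit_asymState {r a b : ℝ} (hab : a + b ≠ 0) :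
    Tendsto (fun n : ℕ => localOp (Matrix.diagonal ![(((1 / ((n : ℝ) + 1) : ℝ)) : ℂ), 1])
      (Matrix.diagonal ![(((1 / ((n : ℝ) + 1) : ℝ)) : ℂ), 1]) (asymState r a b)) atTop
      (𝓝 ((a + b)⁻¹ • asymState 0 a b)) := by
  have h1 : ∀ n : ℕ, localOp (Matrix.diagonal ![(((1 / ((n : ℝ) + 1) : ℝ)) : ℂ), 1])
      (Matrix.diagonal ![(((1 / ((n : ℝ) + 1) : ℝ)) : ℂ), 1]) (asymState r a b) =
      (fun s : ℝ => (s ^ 2 * r + a + b)⁻¹ • asymState (s ^ 2 * r) a b) (1 / ((n : ℝ) + 1)) :=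
    fun n => localOp_diag_asymState (by positivity)
  simp only [h1]
  have hcont : ContinuousAt (fun s : ℝ => (s ^ 2 * r + a + b)⁻¹ • asymState (s ^ 2 * r) a b) 0 := by
    have h3 : ContinuousAt (fun s : ℝ => s ^ 2 * r + a + b) 0 := by fun_prop
    refine (h3.inv₀ (by simpa using hab)).smul ?_
    unfold asymState; fun_prop
  have h2 := hcont.tendsto.comp tendsto_one_div_add_atTop_nhds_zero_nat
  simp only [ne_eq, OfNat.ofNat_ne_zero, not_false_eq_true, zero_pow, zero_mul, zero_add] at h2
  exact h2

theorem maxEF_asymState {r a b : ℝ} (hr : 0 ≤ r) (hb : 0 ≤ b) (hab : b < a) :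
    maxEF (asymState r a b) = concEntropy ((a - b) / (a + b)) := by
  have hc := hasConcurrence_asymState hr hb hab
  have hdet : ∀ n : ℕ, (Matrix.diagonal ![(((1 / ((n : ℝ) + 1) : ℝ)) : ℂ), 1]).det ≠ 0 := fun n => by
    rw [Matrix.det_diagonal, Fin.prod_univ_two]
    simp only [Matrix.cons_val_zero, Matrix.cons_val_one, mul_one]
    exact Complex.ofReal_ne_zero.2 (by positivity)
  refine hc.maxEF_eq _ _ hdet hdet ?_
  have h1 : ∀ n : ℕ, ‖(Matrix.diagonal ![(((1 / ((n : ℝ) + 1) : ℝ)) : ℂ), 1]).det *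
      (Matrix.diagonal ![(((1 / ((n : ℝ) + 1) : ℝ)) : ℂ), 1]).det‖ /
      (filtered (Matrix.diagonal ![(((1 / ((n : ℝ) + 1) : ℝ)) : ℂ), 1])
        (Matrix.diagonal ![(((1 / ((n : ℝ) + 1) : ℝ)) : ℂ), 1]) (asymState r a b)).trace.re =
      (fun s : ℝ => (s ^ 2 * r + a + b)⁻¹) (1 / ((n : ℝ) + 1)) := fun n => by
    set ε : ℝ := 1 / ((n : ℝ) + 1)
    have hε : 0 < ε := by positivity
    rw [filtered_diag_asymState, Matrix.trace_smul, trace_asymState, Matrix.det_diagonal,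
      Fin.prod_univ_two, Complex.real_smul, ← Complex.ofReal_mul, Complex.ofReal_re]
    simp only [Matrix.cons_val_zero, Matrix.cons_val_one, mul_one, ← Complex.ofReal_mul,
      Complex.norm_real]
    rw [Real.norm_of_nonneg (by positivity)]
    have : 0 < ε ^ 2 * r + a + b := by nlinarith [mul_nonneg (sq_nonneg ε) hr]
    field_simp
  simp only [h1]
  have hcont : ContinuousAt (fun s : ℝ => (s ^ 2 * r + a + b)⁻¹) 0 :=
    ContinuousAt.inv₀ (by fun_prop) (by simp; linarith)
  have h2 := hcont.tendsto.comp tendsto_one_div_add_atTop_nhds_zero_nat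
  simp only [ne_eq, OfNat.ofNat_ne_zero, not_false_eq_true, zero_pow, zero_mul, zero_add] at h2
  exact h2

theorem asymState_zero_facts {a b : ℝ} (hb : 0 ≤ b) (hab : b < a) :
    ∃ w : Q → ℝ, asymState 0 a b = bellDiag w ∧ (∀ k, 0 ≤ w k) ∧ w (1, 0) = a ∧
      ∑ k, w k = a + b := by
  refine ⟨_, asymState_zero a b, fun k => ?_, by simp, ?_⟩
  · split_ifs
    · exact le_rfl
    · exact hb.trans hab.le
    · exact hb
  · rw [sum_Q]; simp

theorem entanglementOfFormation_asymState_zero {a b : ℝ} (hb : 0 ≤ b) (hab : b < a) :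
    entanglementOfFormation ((a + b)⁻¹ • asymState 0 a b) =
      concEntropy ((a - b) / (a + b)) := by
  obtain ⟨w, h1, h2, h3, h4⟩ := asymState_zero_facts hb hab
  obtain ⟨h5, h6⟩ := maxEF_bellDiag h2 (k₀ := (1, 0)) (by rw [h3, h4]; linarith)
  rw [h1, ← h4, ← localOp_one_bellDiag, h6, h5, h3, h4]
  congr 2
  ring

theorem diag_admissible {r a b : ℝ} (hr : 0 ≤ r) (hb : 0 ≤ b) (hab : b < a) (n : ℕ) :
    Admissible (Matrix.diagonal ![(((1 / ((n : ℝ) + 1) : ℝ)) : ℂ), 1])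
      (Matrix.diagonal ![(((1 / ((n : ℝ) + 1) : ℝ)) : ℂ), 1]) (asymState r a b) := by
  have hdet : (Matrix.diagonal ![(((1 / ((n : ℝ) + 1) : ℝ)) : ℂ), 1]).det ≠ 0 := by
    rw [Matrix.det_diagonal, Fin.prod_univ_two]
    simp only [Matrix.cons_val_zero, Matrix.cons_val_one, mul_one]
    exact Complex.ofReal_ne_zero.2 (by positivity)
  exact (hasConcurrence_asymState hr hb hab).admissible hdet hdet

theorem incompletelyQuasiDistillable_asymState {r a b : ℝ} (hr : 0 < r) (hb : 0 < b)
    (hab : b < a) : IncompletelyQuasiDistillable (asymState r a b) := by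
  have hc := hasConcurrence_asymState hr.le hb.le hab
  have hM := maxEF_asymState hr.le hb.le hab
  refine ⟨?_, ?_, _, _, _, diag_admissible hr.le hb.le hab, hasLimit_asymState (by linarith), ?_, ?_⟩
  · rw [hM, ← concEntropy_one]
    exact strictMonoOn_concEntropy hc.div_mem ⟨zero_le_one, le_rfl⟩
      ((div_lt_one hc.pos).2 (by linarith))
  · rw [hM]
    exact hc.not_attained (by linarith) fun A B hadm => asymState_trace_lt hr hb.le hab A B hadm
  · rw [asymState_zero]; exact isBellDiagonal_smul_bellDiag _ _
  · rw [hM, entanglementOfFormation_asymState_zero hb.le hab]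

theorem quasiDistillable_asymState {r a : ℝ} (hr : 0 < r) (ha : 0 < a) :
    QuasiDistillable (asymState r a 0) := by
  have hc := hasConcurrence_asymState hr.le le_rfl ha
  have hM := maxEF_asymState hr.le le_rfl ha
  have h1 : (a - 0) / (a + 0) = 1 := by rw [sub_zero, add_zero, div_self ha.ne']
  have hnot := hc.not_attained (by linarith)
    fun A B hadm => asymState_trace_lt hr le_rfl ha A B hadm
  rw [h1, concEntropy_one] at hM hnot
  refine ⟨hM, hnot, _, _, _, diag_admissible hr.le le_rfl ha,
    hasLimit_asymState (by linarith), 1, 0, ?_⟩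
  rw [asymState, add_zero, zero_smul, zero_smul, add_zero, zero_add, smul_smul,
    inv_mul_cancel₀ ha.ne', one_smul]

theorem distillable_asymState {a : ℝ} (ha : 0 < a) : Distillable (asymState 0 a 0) := by
  have hc := hasConcurrence_asymState le_rfl le_rfl ha
  have hM := maxEF_asymState le_rfl le_rfl ha
  have h1 : (a - 0) / (a + 0) = 1 := by rw [sub_zero, add_zero, div_self ha.ne']
  rw [h1, concEntropy_one] at hM
  refine ⟨hM, 1, 1, hc.admissible (by simp) (by simp), 1, 0, ?_⟩
  obtain ⟨w, h1, h2, h3, h4⟩ := asymState_zero_facts le_rfl ha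
  rw [h1, localOp_one_bellDiag, ← h1, h4, asymState, add_zero, zero_smul, zero_smul, add_zero,
    zero_add, smul_smul, inv_mul_cancel₀ ha.ne', one_smul]

theorem incompletelyDistillable_asymState {a b : ℝ} (hb : 0 < b) (hab : b < a) :
    IncompletelyDistillable (asymState 0 a b) := by
  obtain ⟨w, h1, h2, h3, h4⟩ := asymState_zero_facts hb.le hab
  rw [h1]
  exact incompletelyDistillable_bellDiag h2 (k₀ := (1, 0)) (by rw [h3, h4]; linarith)
    (by rw [h3, h4]; linarith)

/-! ### Reduction to the normal form -/

theorem posSemidef_filtered {ρ : Matrix Q Q ℂ} (h : ρ.PosSemidef)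
    (A B : Matrix (Fin 2) (Fin 2) ℂ) : (filtered A B ρ).PosSemidef :=
  h.mul_mul_conjTranspose_same _

theorem exists_conjTranspose_mulVec_eq {a : Fin 2 → ℂ} (ha : a ≠ 0) :
    ∃ A : Matrix (Fin 2) (Fin 2) ℂ, A.det ≠ 0 ∧ ∀ i, star (A 1 i) = a i := by
  refine ⟨!![a 1, -a 0; star (a 0), star (a 1)], ?_, fun i => by fin_cases i <;> simp⟩
  rw [Matrix.det_fin_two_of, Complex.star_def, neg_mul, sub_neg_eq_add,
    Complex.mul_conj', Complex.mul_conj']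
  norm_cast
  intro h
  have h1 : ‖a 1‖ ^ 2 = 0 := by nlinarith [sq_nonneg ‖a 0‖, sq_nonneg ‖a 1‖]
  have h0 : ‖a 0‖ ^ 2 = 0 := by nlinarith [sq_nonneg ‖a 0‖, sq_nonneg ‖a 1‖]
  apply ha
  ext i
  fin_cases i
  · simpa using h0
  · simpa using h1

/-- A product vector in the kernel can be moved to `|11⟩`. -/
theorem exists_filtered_single_mem_kernel {ρ : Matrix Q Q ℂ} {v : Q → ℂ}
    (hv : IsProductVector v) (hker : v ∈ kernel ρ) : ∃ A B : Matrix (Fin 2) (Fin 2) ℂ,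
    A.det ≠ 0 ∧ B.det ≠ 0 ∧ ∀ q, filtered A B ρ q (1, 1) = 0 := by
  obtain ⟨hv0, a, b, rfl⟩ := hv
  have ha : a ≠ 0 := by rintro rfl; exact hv0 (by ext; simp)
  have hb : b ≠ 0 := by rintro rfl; exact hv0 (by ext; simp)
  obtain ⟨A, hA, hA'⟩ := exists_conjTranspose_mulVec_eq ha
  obtain ⟨B, hB, hB'⟩ := exists_conjTranspose_mulVec_eq hb
  refine ⟨A, B, hA, hB, fun q => ?_⟩
  have h1 : (A ⊗ₖ B)ᴴ *ᵥ Pi.single (1, 1) 1 = fun q => a q.1 * b q.2 := by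
    ext ⟨i, j⟩
    simp [Matrix.kroneckerMap_apply, ← hA', ← hB']
  have h2 : ρ *ᵥ (fun q => a q.1 * b q.2) = 0 := hker
  have h3 : filtered A B ρ *ᵥ Pi.single (1, 1) 1 = 0 := by
    rw [filtered, ← Matrix.mulVec_mulVec, h1, ← Matrix.mulVec_mulVec, h2, Matrix.mulVec_zero]
  simpa using congrFun h3 q

open scoped MatrixOrder in
theorem exists_eq_conjTranspose_mul_self {K : Matrix Q Q ℂ} (hK : K.PosSemidef) :
    ∃ L : Matrix Q Q ℂ, K = Lᴴ * L := by
  refine ⟨CFC.sqrt K, ?_⟩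
  rw [(CFC.sqrt_nonneg K).posSemidef.1.eq]
  exact (CFC.sqrt_mul_sqrt_self K hK.nonneg).symm

/-- A positive semidefinite matrix is a Gram matrix, so a vector can be made orthogonal to two
others by adding multiples of them. -/
theorem exists_orthogonalization {K : Matrix Q Q ℂ} (hK : K.PosSemidef) (i j k : Q) :
    ∃ α β : ℂ, K i j + β * K j j + α * K k j = 0 ∧ K i k + β * K j k + α * K k k = 0 := by
  obtain ⟨L, rfl⟩ := exists_eq_conjTranspose_mul_self hK
  set e : Q → EuclideanSpace ℂ Q := fun p => WithLp.toLp 2 fun s => L s p with he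
  have hin : ∀ p q, inner ℂ (e p) (e q) = (Lᴴ * L) p q := fun p q => by
    simp [he, PiLp.inner_apply, Matrix.mul_apply, mul_comm]
  set U := Submodule.span ℂ {e j, e k}
  obtain ⟨s, t, hst⟩ := Submodule.mem_span_pair.1 (U.starProjection_apply_mem (e i))
  have horth : ∀ q, e q ∈ U → inner ℂ (e i - (s • e j + t • e k)) (e q) = 0 := fun q hq => by
    rw [hst]
    exact U.starProjection_inner_eq_zero (e i) (e q) hq
  refine ⟨-star t, -star s, ?_, ?_⟩
  · have := horth j (Submodule.subset_span (by simp))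
    rw [inner_sub_left, inner_add_left, inner_smul_left, inner_smul_left, hin, hin, hin] at this
    simp only [Complex.star_def]
    linear_combination this
  · have := horth k (Submodule.subset_span (by simp))
    rw [inner_sub_left, inner_add_left, inner_smul_left, inner_smul_left, hin, hin, hin] at this
    simp only [Complex.star_def]
    linear_combination this

theorem filtered_apply (A B : Matrix (Fin 2) (Fin 2) ℂ) (ρ : Matrix Q Q ℂ) (p q : Q) :
    filtered A B ρ p q = ∑ s, ∑ r, A p.1 r.1 * B p.2 r.2 * ρ r s *
      (star (A q.1 s.1) * star (B q.2 s.2)) := by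
  rw [filtered, Matrix.mul_apply]
  refine Finset.sum_congr rfl fun s _ => ?_
  rw [Matrix.mul_apply, Finset.sum_mul]
  refine Finset.sum_congr rfl fun r _ => ?_
  rw [Matrix.conjTranspose_apply, Matrix.kroneckerMap_apply, Matrix.kroneckerMap_apply, star_mul']

/-- The operators with vanishing row and column at `|11⟩` whose `|00⟩` component is decoupled. -/
theorem ext_of_decoupled {M N : Matrix Q Q ℂ} (hM : M.IsHermitian) (hN : N.IsHermitian)
    (h11 : ∀ q, M q (1, 1) = N q (1, 1)) (h1 : M (0, 0) (0, 1) = N (0, 0) (0, 1))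
    (h2 : M (0, 0) (1, 0) = N (0, 0) (1, 0)) (h0 : M (0, 0) (0, 0) = N (0, 0) (0, 0))
    (hp : M (0, 1) (0, 1) = N (0, 1) (0, 1)) (hq : M (1, 0) (1, 0) = N (1, 0) (1, 0))
    (hz : M (0, 1) (1, 0) = N (0, 1) (1, 0)) : M = N := by
  have sym : ∀ p q, M p q = N p q → M q p = N q p := fun p q h => by
    rw [← hM.apply q p, ← hN.apply q p, h]
  ext ⟨i, j⟩ ⟨k, l⟩
  fin_cases i <;> fin_cases j <;> fin_cases k <;> fin_cases l <;>
    first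
    | assumption
    | exact h11 _
    | exact sym _ _ (h11 _)
    | exact sym _ _ h1
    | exact sym _ _ h2
    | exact sym _ _ hz

theorem isHermitian_real_smul {M : Matrix Q Q ℂ} (h : M.IsHermitian) (c : ℝ) :
    (c • M).IsHermitian := by
  rw [Matrix.IsHermitian, Matrix.conjTranspose_smul, h.eq, star_trivial]

theorem isHermitian_ketbra (v : Q → ℂ) : (ketbra v).IsHermitian := (posSemidef_ketbra v).1

theorem isHermitian_asymState (r a b : ℝ) : (asymState r a b).IsHermitian :=
  ((isHermitian_real_smul (isHermitian_ketbra _) _).add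
    (isHermitian_real_smul (isHermitian_ketbra _) _)).add
    (isHermitian_real_smul (isHermitian_ketbra _) _)

theorem norm_sq_apply_le {K : Matrix Q Q ℂ} (hK : K.PosSemidef) (j k : Q) :
    ‖K j k‖ ^ 2 ≤ (K j j).re * (K k k).re := by
  have h := (hK.submatrix ![j, k]).det_nonneg
  rw [Matrix.det_fin_two] at h
  simp only [Matrix.submatrix_apply, Matrix.cons_val_zero, Matrix.cons_val_one] at h
  have hre := (Complex.nonneg_iff.1 h).1
  have h1 : K j k * K k j = ((‖K j k‖ ^ 2 : ℝ) : ℂ) := by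
    rw [← hK.1.apply k j]; push_cast; exact Complex.mul_conj' _
  have hj := (Complex.nonneg_iff.1 (hK.diag_nonneg (i := j))).2
  rw [h1, Complex.sub_re, Complex.mul_re, ← hj, zero_mul, sub_zero, Complex.ofReal_re] at hre
  linarith

theorem filtered_triangular_apply {K : Matrix Q Q ℂ} (hK : K.IsHermitian)
    (h11 : ∀ q, K q (1, 1) = 0) (α β : ℂ) :
    (∀ q, filtered !![1, α; 0, 1] !![1, β; 0, 1] K q (1, 1) = 0) ∧
    filtered !![1, α; 0, 1] !![1, β; 0, 1] K (0, 0) (0, 1) =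
      K (0, 0) (0, 1) + β * K (0, 1) (0, 1) + α * K (1, 0) (0, 1) ∧
    filtered !![1, α; 0, 1] !![1, β; 0, 1] K (0, 0) (1, 0) =
      K (0, 0) (1, 0) + β * K (0, 1) (1, 0) + α * K (1, 0) (1, 0) := by
  have h11' : ∀ q, K (1, 1) q = 0 := fun q => by rw [← hK.apply (1, 1) q, h11, star_zero]
  refine ⟨?_, ?_, ?_⟩
  · rintro ⟨i, j⟩
    rw [filtered_apply, sum_Q]
    simp [h11]
  · rw [filtered_apply, sum_Q]
    simp [sum_Q, h11, h11']
  · rw [filtered_apply, sum_Q]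
    simp [sum_Q, h11, h11']

theorem filtered_diagonal_one_apply (K : Matrix Q Q ℂ) (c : ℂ) (p q : Q) :
    filtered (Matrix.diagonal ![c, 1]) 1 K p q =
      ![c, 1] p.1 * K p q * star (![c, 1] q.1) := by
  obtain ⟨i, j⟩ := p
  obtain ⟨k, l⟩ := q
  rw [filtered_apply, sum_Q]
  fin_cases i <;> fin_cases j <;> fin_cases k <;> fin_cases l <;>
    simp [sum_Q, Matrix.one_apply]

theorem conc_single (k : Q) : conc (Pi.single k 1) = 0 := by
  obtain ⟨i, j⟩ := k
  fin_cases i <;> fin_cases j <;> simp [conc, tau]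

/-- A local image of a diagonal operator is separable. -/
theorem isSeparable_of_eq_filtered_diagonal {w : Q → ℝ} (hw : ∀ k, 0 ≤ w k)
    {A B : Matrix (Fin 2) (Fin 2) ℂ} {ρ : Matrix Q Q ℂ}
    (hρ : ρ = filtered A B (Matrix.diagonal fun k => (w k : ℂ))) (htr : ρ.trace = 1) :
    IsSeparable ρ := by
  have h1 : (Matrix.diagonal fun k => (w k : ℂ)) =
      ∑ k, ketbra (((√(w k) : ℝ) : ℂ) • (Pi.single k 1 : Q → ℂ)) := by
    ext p q
    simp only [Matrix.sum_apply, ketbra, Matrix.vecMulVec_apply, Matrix.diagonal_apply,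
      Pi.star_apply]
    rw [Finset.sum_eq_single p]
    · by_cases h : p = q
      · subst h
        have h2 : ((√(w p) : ℝ) : ℂ) * ((√(w p) : ℝ) : ℂ) = (w p : ℂ) := by
          rw [← Complex.ofReal_mul, Real.mul_self_sqrt (hw p)]
        simp [h2]
      · simp [h, Ne.symm h]
    · intro b _ hb; simp [hb.symm]
    · simp
  rw [h1, filtered_sum] at hρ
  simp only [filtered_ketbra] at hρ
  refine isSeparable_of_conc_eq_zero _ hρ htr fun k => ?_
  rw [conc_kronecker_mulVec, conc_smul, conc_single, mul_zero, mul_zero]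

/-- An entangled state with a product vector in its kernel has the normal form `asymState`:
the product vector is moved to `|11⟩`, the `|00⟩` component is decoupled by triangular
matrices, and the remaining block on `|01⟩, |10⟩` is balanced by a diagonal matrix. -/
theorem exists_filtered_eq_asymState {ρ : Matrix Q Q ℂ} (hρ : ρ.PosSemidef) (htr : ρ.trace = 1)
    (hsep : ¬ IsSeparable ρ) {v : Q → ℂ} (hv : IsProductVector v) (hker : v ∈ kernel ρ) :
    ∃ (A B : Matrix (Fin 2) (Fin 2) ℂ) (r a b : ℝ), A.det ≠ 0 ∧ B.det ≠ 0 ∧ 0 ≤ r ∧ 0 ≤ b ∧ b < a ∧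
      filtered A B ρ = asymState r a b := by
  obtain ⟨A₁, B₁, hA₁, hB₁, h1⟩ := exists_filtered_single_mem_kernel hv hker
  have hK₁ := posSemidef_filtered hρ A₁ B₁
  obtain ⟨α, β, hα, hβ⟩ := exists_orthogonalization hK₁ (0, 0) (0, 1) (1, 0)
  obtain ⟨h2, h2a, h2b⟩ := filtered_triangular_apply hK₁.1 h1 α β
  rw [hα] at h2a
  rw [hβ] at h2b
  have hK₂ := posSemidef_filtered hK₁ !![1, α; 0, 1] !![1, β; 0, 1]
  have hdet : ∀ γ : ℂ, (!![1, γ; 0, 1] : Matrix (Fin 2) (Fin 2) ℂ).det ≠ 0 := fun γ => by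
    simp [Matrix.det_fin_two_of]
  obtain ⟨A₂, B₂, hA₂, hB₂, hK⟩ : ∃ A₂ B₂ : Matrix (Fin 2) (Fin 2) ℂ, A₂.det ≠ 0 ∧ B₂.det ≠ 0 ∧
      filtered A₂ B₂ ρ = filtered !![1, α; 0, 1] !![1, β; 0, 1] (filtered A₁ B₁ ρ) := by
    refine ⟨_, _, ?_, ?_, (filtered_filtered _ _ _ _ _).symm⟩
    · rw [Matrix.det_mul]; exact mul_ne_zero (hdet _) hA₁
    · rw [Matrix.det_mul]; exact mul_ne_zero (hdet _) hB₁
  rw [← hK] at h2 h2a h2b hK₂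
  set K := filtered A₂ B₂ ρ with hKdef
  have hdiag : ∀ k, K k k = ((K k k).re : ℂ) := fun k =>
    Complex.ext rfl (Complex.nonneg_iff.1 (hK₂.diag_nonneg (i := k))).2.symm
  have hdiag0 : ∀ k, 0 ≤ (K k k).re := fun k =>
    (Complex.nonneg_iff.1 (hK₂.diag_nonneg (i := k))).1
  set r := (K (0, 0) (0, 0)).re
  set p := (K (0, 1) (0, 1)).re
  set q := (K (1, 0) (1, 0)).re
  set z := K (0, 1) (1, 0)
  have hz : z ≠ 0 := by
    intro hz
    refine hsep (isSeparable_of_eq_filtered_diagonal (w := fun k => (K k k).re) hdiag0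
      (A := A₂⁻¹) (B := B₂⁻¹) ?_ htr)
    rw [eq_filtered_inv hA₂ hB₂ ρ, ← hKdef]
    congr 1
    refine ext_of_decoupled hK₂.1 ?_ (fun k => ?_) ?_ ?_ ?_ ?_ ?_ ?_
    · refine Matrix.isHermitian_diagonal_iff.2 fun k => ?_
      exact Complex.conj_ofReal _
    · rw [h2, Matrix.diagonal_apply]
      split_ifs with h
      · subst h; rw [h2]; simp
      · rfl
    · rw [h2a]; simp
    · rw [h2b]; simp
    · rw [Matrix.diagonal_apply_eq]; exact hdiag _
    · rw [Matrix.diagonal_apply_eq]; exact hdiag _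
    · rw [Matrix.diagonal_apply_eq]; exact hdiag _
    · change z = _; rw [hz]; simp
  have hpq : ‖z‖ ^ 2 ≤ p * q := norm_sq_apply_le hK₂ (0, 1) (1, 0)
  have hz0 : 0 < ‖z‖ := norm_pos_iff.2 hz
  have hp0 : 0 ≤ p := hdiag0 _
  have hq0 : 0 ≤ q := hdiag0 _
  have hp : 0 < p := hp0.lt_of_ne fun h => by rw [← h] at hpq; nlinarith
  have hq : 0 < q := hq0.lt_of_ne fun h => by rw [← h] at hpq; nlinarith
  -- The modulus of `c` balances the diagonal, its phase makes the off-diagonal entry positive.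
  set c : ℂ := ((√(q / p) : ℝ) : ℂ) * (star z / (‖z‖ : ℂ)) with hc
  have hs := Real.sq_sqrt (div_nonneg hq0 hp0)
  have hs0 : 0 < √(q / p) := Real.sqrt_pos.2 (div_pos hq hp)
  have hcn : ‖c‖ ^ 2 = q / p := by
    rw [hc, norm_mul, norm_div, norm_star, Complex.norm_real, Complex.norm_real, norm_norm,
      div_self hz0.ne', mul_one, Real.norm_eq_abs, sq_abs, hs]
  have hc0 : c ≠ 0 := fun h => by
    rw [h, norm_zero] at hcn
    exact (div_pos hq hp).ne (by simpa using hcn)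
  have hcz : c * z = ((√(q / p) * ‖z‖ : ℝ) : ℂ) := by
    have h3 : star z * z = ((‖z‖ : ℝ) : ℂ) ^ 2 := by rw [mul_comm]; exact Complex.mul_conj' z
    have h4 : ((‖z‖ : ℝ) : ℂ) ≠ 0 := Complex.ofReal_ne_zero.2 hz0.ne'
    calc c * z = ((√(q / p) : ℝ) : ℂ) * (star z * z / (‖z‖ : ℂ)) := by rw [hc]; ring
      _ = _ := by rw [h3, sq, mul_div_assoc, div_self h4]; push_cast; ring
  have hcc : ∀ x : ℝ, c * (x : ℂ) * star c = ((q / p * x : ℝ) : ℂ) := fun x => by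
    have : c * star c = ((q / p : ℝ) : ℂ) := by
      rw [← hcn]; push_cast; exact Complex.mul_conj' c
    calc c * (x : ℂ) * star c = c * star c * x := by ring
      _ = _ := by rw [this]; push_cast; ring
  set y := √(q / p) * ‖z‖ with hy
  have hy0 : 0 < y := mul_pos hs0 hz0
  have hyq : y ≤ q := by
    have h5 : y ^ 2 ≤ q ^ 2 := by
      rw [hy, mul_pow, hs]
      calc q / p * ‖z‖ ^ 2 ≤ q / p * (p * q) := by gcongr
        _ = q ^ 2 := by field_simp
    exact abs_le_of_sq_le_sq' h5 hq0 |>.2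
  refine ⟨Matrix.diagonal ![c, 1] * A₂, 1 * B₂, q / p * r, q + y, q - y, ?_, ?_,
    mul_nonneg (div_nonneg hq0 hp0) (hdiag0 _), by linarith, by linarith, ?_⟩
  · rw [Matrix.det_mul, Matrix.det_diagonal, Fin.prod_univ_two]
    simpa using ⟨hc0, hA₂⟩
  · rwa [one_mul]
  rw [← filtered_filtered, ← hKdef]
  have hsq := sqrt_two_inv_mul_self
  refine ext_of_decoupled (posSemidef_filtered hK₂ _ _).1 (isHermitian_asymState _ _ _)
    ?_ ?_ ?_ ?_ ?_ ?_ ?_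
  · rintro ⟨i, j⟩
    rw [filtered_diagonal_one_apply, h2]
    fin_cases i <;> fin_cases j <;>
      simp [asymState, ketbra, Matrix.vecMulVec_apply, bellVector]
  · rw [filtered_diagonal_one_apply, h2a]
    simp [asymState, ketbra, Matrix.vecMulVec_apply, bellVector]
  · rw [filtered_diagonal_one_apply, h2b]
    simp [asymState, ketbra, Matrix.vecMulVec_apply, bellVector]
  · rw [filtered_diagonal_one_apply, hdiag]
    refine (hcc _).trans ?_
    simp [asymState, ketbra, Matrix.vecMulVec_apply, bellVector]
    exact Or.inl rfl
  · rw [filtered_diagonal_one_apply, hdiag]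
    refine (hcc _).trans ?_
    rw [show (K (0, 1) (0, 1)).re = p from rfl, div_mul_cancel₀ _ hp.ne']
    simp [asymState, ketbra, Matrix.vecMulVec_apply, bellVector, div_eq_mul_inv]
    linear_combination (-2 * (q : ℂ)) * hsq
  · rw [filtered_diagonal_one_apply, hdiag]
    simp [asymState, ketbra, Matrix.vecMulVec_apply, bellVector, div_eq_mul_inv]
    change (q : ℂ) = _
    linear_combination (-2 * (q : ℂ)) * hsq
  · rw [filtered_diagonal_one_apply, (asymState_apply _ _ _).2]
    simp only [Matrix.cons_val_zero, Matrix.cons_val_one, star_one, mul_one]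
    refine hcz.trans ?_
    congr 1
    ring

/-- The classification when the kernel contains a product vector. -/
theorem classification_of_productVector_mem_kernel {ρ : Matrix Q Q ℂ} (hρ : ρ.PosSemidef)
    (htr : ρ.trace = 1) (hsep : ¬ IsSeparable ρ) {v : Q → ℂ} (hv : IsProductVector v)
    (hker : v ∈ kernel ρ) :
    (ρ.rank = 3 ∧ IncompletelyQuasiDistillable ρ) ∨
    (ρ.rank = 2 ∧ (productLines (support ρ)).encard = 1 ∧ QuasiDistillable ρ) ∨
    (ρ.rank = 2 ∧ (productLines (support ρ)).encard = 2 ∧ IncompletelyDistillable ρ) ∨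
    (ρ.rank = 1 ∧ Distillable ρ) := by
  obtain ⟨A, B, r, a, b, hA, hB, hr, hb, hab, hK⟩ :=
    exists_filtered_eq_asymState hρ htr hsep hv hker
  have ha : 0 < a := hb.trans_lt hab
  have hrank := rank_asymState r a b
  rw [← hK, rank_filtered hA hB, if_pos ha.ne'] at hrank
  have hinv := eq_filtered_inv hA hB ρ
  rw [hK] at hinv
  have hA' : A⁻¹.det ≠ 0 := by
    rw [Matrix.det_nonsing_inv, Ring.inverse_eq_inv']; exact inv_ne_zero hA
  have hB' : B⁻¹.det ≠ 0 := by
    rw [Matrix.det_nonsing_inv, Ring.inverse_eq_inv']; exact inv_ne_zero hB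
  have hdet := mul_ne_zero hA' hB'
  obtain ⟨x, hx1, -, -⟩ := exists_asymState_decomp hr ha.le hb
  set L := A⁻¹ ⊗ₖ B⁻¹ with hL
  have hLdet : L.det ≠ 0 := (kronecker_det_ne_zero hA' hB').ne_zero
  rcases hr.eq_or_lt with rfl | hr
  · rcases hb.eq_or_lt with rfl | hb
    · refine Or.inr (Or.inr (Or.inr ⟨by simpa using hrank, ?_⟩))
      exact distillable_of_filtered hA hB (hK ▸ distillable_asymState ha)
    · have hr2 : ρ.rank = 2 := by simpa [hb.ne'] using hrank
      refine Or.inr (Or.inr (Or.inl ⟨hr2, ?_, incompletelyDistillable_of_filtered hA hB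
        (hK ▸ incompletelyDistillable_asymState hb hab)⟩))
      have hdec : ρ = ∑ i : Fin 2, ketbra (L *ᵥ (((√(![a, b] i) : ℝ) : ℂ) • bellVector 1 i)) := by
        simp only [hL, ← filtered_ketbra]
        rw [← filtered_sum, Fin.sum_univ_two, ketbra_real_smul, ketbra_real_smul]
        simp only [Matrix.cons_val_zero, Matrix.cons_val_one]
        rw [Real.sq_sqrt ha.le, Real.sq_sqrt hb.le]
        conv_lhs => rw [hinv, asymState, zero_smul, zero_add]
      rw [support_eq_span_pair hr2 _ hdec (u₁ := L *ᵥ Pi.single (0, 1) 1)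
        (u₂ := L *ᵥ Pi.single (1, 0) 1)]
      · refine encard_productLines_eq_two ?_ ?_ ?_
        · rw [hL, tau_kronecker_mulVec]; simp [tau]
        · rw [hL, tau_kronecker_mulVec]; simpa [tau] using ⟨hA, hB⟩
        · rw [hL, tau_kronecker_mulVec]; simp [tau]
      · intro i
        rw [Matrix.mulVec_smul]
        refine Submodule.smul_mem _ _ (Submodule.mem_span_pair.2
          ⟨(√2 : ℂ)⁻¹, (-1) ^ i.val * (√2 : ℂ)⁻¹, ?_⟩)
        rw [← Matrix.mulVec_smul, ← Matrix.mulVec_smul, ← Matrix.mulVec_add]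
        congr 1
        ext ⟨j, k⟩
        fin_cases i <;> fin_cases j <;> fin_cases k <;> simp [bellVector] <;> ring
  · rcases hb.eq_or_lt with rfl | hb
    · have hr2 : ρ.rank = 2 := by simpa [hr.ne'] using hrank
      refine Or.inr (Or.inl ⟨hr2, ?_, quasiDistillable_of_filtered hA hB
        (hK ▸ quasiDistillable_asymState hr ha)⟩)
      have hdec : ρ = ∑ i : Fin 2, ketbra (L *ᵥ (![((√r : ℝ) : ℂ) • Pi.single (0, 0) 1,
          ((√a : ℝ) : ℂ) • bellVector 1 0] i)) := by
        simp only [hL, ← filtered_ketbra]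
        rw [← filtered_sum, Fin.sum_univ_two]
        simp only [Matrix.cons_val_zero, Matrix.cons_val_one]
        rw [ketbra_real_smul, ketbra_real_smul, Real.sq_sqrt ha.le, Real.sq_sqrt hr.le]
        conv_lhs => rw [hinv, asymState, zero_smul, add_zero]
      rw [support_eq_span_pair hr2 _ hdec (u₁ := L *ᵥ Pi.single (0, 0) 1)
        (u₂ := L *ᵥ bellVector 1 0)]
      · refine encard_productLines_eq_one ?_ ?_ ?_ ?_
        · intro h
          have := congrFun (Matrix.eq_zero_of_mulVec_eq_zero hLdet h) (0, 0)
          simp at this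
        · rw [hL, tau_kronecker_mulVec]; simp [tau]
        · rw [hL, tau_kronecker_mulVec]; simp [tau, bellVector]
        · have h1 := tau_bellVector (1, 0) (1, 0)
          rw [hL, tau_kronecker_mulVec, h1, if_pos rfl]
          exact mul_ne_zero hdet (bellSign_ne_zero _)
      · refine Fin.forall_fin_two.2 ⟨?_, ?_⟩
        · rw [Matrix.cons_val_zero, Matrix.mulVec_smul]
          exact Submodule.smul_mem _ _ (Submodule.subset_span (by simp))
        · rw [Matrix.cons_val_one, Matrix.cons_val_fin_one, Matrix.mulVec_smul]
          exact Submodule.smul_mem _ _ (Submodule.subset_span (by simp))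
    · refine Or.inl ⟨by simpa [hr.ne', hb.ne'] using hrank, ?_⟩
      exact incompletelyQuasiDistillable_of_filtered hA hB
        (hK ▸ incompletelyQuasiDistillable_asymState hr hb hab)

/-! ### Minimizing the filtered trace -/

theorem continuous_trace_filtered (ρ : Matrix Q Q ℂ) :
    Continuous fun P : Matrix (Fin 2) (Fin 2) ℂ × Matrix (Fin 2) (Fin 2) ℂ =>
      (filtered P.1 P.2 ρ).trace.re := by
  simp only [Matrix.trace, Matrix.diag_apply, filtered_apply]
  fun_prop

theorem trace_filtered_pos {ρ : Matrix Q Q ℂ} (hρ : ρ.PosSemidef)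
    (hker : ¬ ∃ v ∈ kernel ρ, IsProductVector v) {A B : Matrix (Fin 2) (Fin 2) ℂ} (hA : A ≠ 0)
    (hB : B ≠ 0) : 0 < (filtered A B ρ).trace.re := by
  have hP := posSemidef_filtered hρ A B
  refine (Complex.nonneg_iff.1 hP.trace_nonneg).1.lt_of_ne fun h0 => hker ?_
  have htr : (filtered A B ρ).trace = 0 :=
    Complex.ext h0.symm (Complex.nonneg_iff.1 hP.trace_nonneg).2.symm
  have hzero : filtered A B ρ = 0 := hP.trace_eq_zero_iff.1 htr
  obtain ⟨i, i', hi⟩ : ∃ i i', A i i' ≠ 0 := by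
    by_contra! h; exact hA (Matrix.ext h)
  obtain ⟨j, j', hj⟩ : ∃ j j', B j j' ≠ 0 := by
    by_contra! h; exact hB (Matrix.ext h)
  refine ⟨fun q => star (A i q.1) * star (B j q.2), ?_, ?_, fun k => star (A i k),
    fun k => star (B j k), rfl⟩
  · rw [kernel, LinearMap.mem_ker, Matrix.mulVecLin_apply]
    refine (hρ.dotProduct_mulVec_zero_iff _).1 ?_
    have h1 := congrFun (congrFun hzero (i, j)) (i, j)
    rw [filtered_apply, Finset.sum_comm] at h1
    refine Eq.trans ?_ h1
    rw [dotProduct]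
    refine Finset.sum_congr rfl fun r _ => ?_
    rw [Matrix.mulVec, dotProduct, Finset.mul_sum]
    refine Finset.sum_congr rfl fun s _ => ?_
    simp only [Pi.star_apply, star_mul', star_star]
    ring
  · intro h
    have := congrFun h (i', j')
    simp [hi, hj] at this

section Norm

attribute [local instance] Matrix.normedAddCommGroup Matrix.normedSpace

/-- If the kernel contains no product vector, the filtered trace is coercive. -/
theorem exists_le_trace_filtered {ρ : Matrix Q Q ℂ} (hρ : ρ.PosSemidef)
    (hker : ¬ ∃ v ∈ kernel ρ, IsProductVector v) : ∃ c : ℝ, 0 < c ∧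
      ∀ A B : Matrix (Fin 2) (Fin 2) ℂ, c * (‖A‖ ^ 2 * ‖B‖ ^ 2) ≤ (filtered A B ρ).trace.re := by
  have hproper : ProperSpace (Matrix (Fin 2) (Fin 2) ℂ) := FiniteDimensional.proper ℂ _
  have hcomp : IsCompact (Metric.sphere (0 : Matrix (Fin 2) (Fin 2) ℂ) 1 ×ˢ
      Metric.sphere (0 : Matrix (Fin 2) (Fin 2) ℂ) 1) :=
    (isCompact_sphere _ _).prod (isCompact_sphere _ _)
  have hne : (Metric.sphere (0 : Matrix (Fin 2) (Fin 2) ℂ) 1 ×ˢ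
      Metric.sphere (0 : Matrix (Fin 2) (Fin 2) ℂ) 1).Nonempty :=
    (NormedSpace.sphere_nonempty.2 zero_le_one).prod (NormedSpace.sphere_nonempty.2 zero_le_one)
  obtain ⟨P, hP, hmin⟩ := hcomp.exists_isMinOn hne (continuous_trace_filtered ρ).continuousOn
  have hP1 : ‖P.1‖ = 1 := by simpa using hP.1
  have hP2 : ‖P.2‖ = 1 := by simpa using hP.2
  refine ⟨_, trace_filtered_pos hρ hker (A := P.1) (B := P.2) (fun h => ?_) (fun h => ?_),
    fun A B => ?_⟩
  · rw [h, norm_zero] at hP1; exact zero_ne_one hP1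
  · rw [h, norm_zero] at hP2; exact zero_ne_one hP2
  by_cases hA : A = 0
  · subst hA; simp [filtered]
  by_cases hB : B = 0
  · subst hB; simp [filtered]
  have hnorm : ∀ M : Matrix (Fin 2) (Fin 2) ℂ, M ≠ 0 → ‖((‖M‖⁻¹ : ℝ) : ℂ) • M‖ = 1 := fun M hM => by
    rw [norm_smul, Complex.norm_real, norm_inv, norm_norm, inv_mul_cancel₀ (norm_ne_zero_iff.2 hM)]
  have h1 : (filtered P.1 P.2 ρ).trace.re ≤
      (filtered (((‖A‖⁻¹ : ℝ) : ℂ) • A) (((‖B‖⁻¹ : ℝ) : ℂ) • B) ρ).trace.re :=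
    hmin (a := (((‖A‖⁻¹ : ℝ) : ℂ) • A, ((‖B‖⁻¹ : ℝ) : ℂ) • B))
      ⟨by simpa using hnorm A hA, by simpa using hnorm B hB⟩
  have h2 : filtered (((‖A‖⁻¹ : ℝ) : ℂ) • A) (((‖B‖⁻¹ : ℝ) : ℂ) • B) ρ =
      (((‖A‖ ^ 2 * ‖B‖ ^ 2)⁻¹ : ℝ) : ℂ) • filtered A B ρ := by
    ext p q
    rw [Matrix.smul_apply, filtered_apply, filtered_apply]
    simp only [Finset.mul_sum, Matrix.smul_apply, smul_eq_mul, star_mul', Complex.star_def,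
      Complex.conj_ofReal]
    refine Finset.sum_congr rfl fun s _ => Finset.sum_congr rfl fun r _ => ?_
    push_cast
    ring
  have hpos : 0 < ‖A‖ ^ 2 * ‖B‖ ^ 2 :=
    mul_pos (pow_pos (norm_pos_iff.2 hA) 2) (pow_pos (norm_pos_iff.2 hB) 2)
  rw [h2, Matrix.trace_smul, smul_eq_mul, Complex.re_ofReal_mul, inv_mul_eq_div,
    le_div_iff₀ hpos] at h1
  exact h1

/-- If the kernel contains no product vector, the filtered trace attains its minimum over pairs
of matrices of determinant one. -/
theorem exists_minimizer {ρ : Matrix Q Q ℂ} (hρ : ρ.PosSemidef)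
    (hker : ¬ ∃ v ∈ kernel ρ, IsProductVector v) : ∃ A₀ B₀ : Matrix (Fin 2) (Fin 2) ℂ,
      A₀.det = 1 ∧ B₀.det = 1 ∧ ∀ A B : Matrix (Fin 2) (Fin 2) ℂ, A.det = 1 → B.det = 1 →
        (filtered A₀ B₀ ρ).trace.re ≤ (filtered A B ρ).trace.re := by
  have hproper : ProperSpace (Matrix (Fin 2) (Fin 2) ℂ) := FiniteDimensional.proper ℂ _
  obtain ⟨c, hc, hle⟩ := exists_le_trace_filtered hρ hker
  set F := (filtered 1 1 ρ).trace.re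
  have hone : ‖(1 : Matrix (Fin 2) (Fin 2) ℂ)‖ ≤ 1 := by
    refine (Matrix.norm_le_iff zero_le_one).2 fun i j => ?_
    rw [Matrix.one_apply]; split_ifs <;> simp
  have hF : 0 ≤ F := (by positivity : (0 : ℝ) ≤ c * (‖(1 : Matrix (Fin 2) (Fin 2) ℂ)‖ ^ 2 *
    ‖(1 : Matrix (Fin 2) (Fin 2) ℂ)‖ ^ 2)).trans (hle 1 1)
  set R : ℝ := 2 * F / c + 1
  have hR : 1 ≤ R := by
    have : 0 ≤ 2 * F / c := by positivity
    linarith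
  have hdet : ∀ A : Matrix (Fin 2) (Fin 2) ℂ, A.det = 1 → 1 ≤ 2 * ‖A‖ ^ 2 := fun A hA => by
    rw [Matrix.det_fin_two] at hA
    have h1 := norm_sub_le (A 0 0 * A 1 1) (A 0 1 * A 1 0)
    rw [hA, norm_one, norm_mul, norm_mul] at h1
    have h2 := fun i j => Matrix.norm_entry_le_entrywise_sup_norm A (i := i) (j := j)
    have h3 := mul_le_mul (h2 0 0) (h2 1 1) (norm_nonneg _) (norm_nonneg _)
    have h4 := mul_le_mul (h2 0 1) (h2 1 0) (norm_nonneg _) (norm_nonneg _)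
    nlinarith
  set T : Set (Matrix (Fin 2) (Fin 2) ℂ × Matrix (Fin 2) (Fin 2) ℂ) :=
    (Metric.closedBall 0 R ×ˢ Metric.closedBall 0 R) ∩ {P | P.1.det = 1 ∧ P.2.det = 1}
  have hT : IsCompact T := by
    refine ((isCompact_closedBall _ _).prod (isCompact_closedBall _ _)).inter_right ?_
    exact (isClosed_eq (continuous_fst.matrix_det) continuous_const).inter
      (isClosed_eq (continuous_snd.matrix_det) continuous_const)
  have hball : (1 : Matrix (Fin 2) (Fin 2) ℂ) ∈ Metric.closedBall 0 R :=
    mem_closedBall_zero_iff.2 (hone.trans hR)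
  have h11 : (1 : Matrix (Fin 2) (Fin 2) ℂ).det = 1 ∧ (1 : Matrix (Fin 2) (Fin 2) ℂ).det = 1 :=
    ⟨Matrix.det_one, Matrix.det_one⟩
  have h1T : ((1 : Matrix (Fin 2) (Fin 2) ℂ), (1 : Matrix (Fin 2) (Fin 2) ℂ)) ∈ T :=
    ⟨Set.mk_mem_prod hball hball, h11⟩
  obtain ⟨P, hP, hmin⟩ : ∃ P ∈ T, ∀ P' ∈ T, (filtered P.1 P.2 ρ).trace.re ≤
      (filtered P'.1 P'.2 ρ).trace.re :=
    hT.exists_isMinOn ⟨_, h1T⟩ (continuous_trace_filtered ρ).continuousOn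
  refine ⟨P.1, P.2, hP.2.1, hP.2.2, fun A B hA hB => ?_⟩
  by_cases hmem : (A, B) ∈ T
  · exact hmin (A, B) hmem
  · have hPF : (filtered P.1 P.2 ρ).trace.re ≤ F := hmin (1, 1) h1T
    refine hPF.trans ?_
    have hbig : R < ‖A‖ ∨ R < ‖B‖ := by
      by_contra! h
      exact hmem ⟨⟨mem_closedBall_zero_iff.2 h.1, mem_closedBall_zero_iff.2 h.2⟩, hA, hB⟩
    have hFR : F ≤ c * (R / 2) := by
      have : c * (2 * F / c) = 2 * F := by field_simp
      calc F = c * (2 * F / c) / 2 := by rw [this]; ring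
        _ ≤ c * (R / 2) := by
          have : 2 * F / c ≤ R := by simp only [R]; linarith
          nlinarith
    refine hFR.trans (le_trans ?_ (hle A B))
    refine mul_le_mul_of_nonneg_left ?_ hc.le
    have hA1 := hdet A hA
    have hB1 := hdet B hB
    rcases hbig with h | h
    · have : R ≤ ‖A‖ ^ 2 := by nlinarith
      nlinarith
    · have : R ≤ ‖B‖ ^ 2 := by nlinarith
      nlinarith

end Norm

/-! ### The marginals at a minimizer -/

/-- The partial trace over the first qubit. -/
def partialTrace₁ (ρ : Matrix Q Q ℂ) : Matrix (Fin 2) (Fin 2) ℂ :=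
  Matrix.of fun j l => ∑ i, ρ (i, j) (i, l)

theorem trace_filtered_one_right (A : Matrix (Fin 2) (Fin 2) ℂ) (K : Matrix Q Q ℂ) :
    (filtered A 1 K).trace = (A * partialTrace₂ K * Aᴴ).trace := by
  simp only [Matrix.trace, Matrix.diag_apply, filtered_apply, Matrix.mul_apply, partialTrace₂,
    Matrix.conjTranspose_apply, Matrix.of_apply, sum_Q, Fin.sum_univ_two, Matrix.one_apply]
  simp
  ring

theorem trace_filtered_one_left (B : Matrix (Fin 2) (Fin 2) ℂ) (K : Matrix Q Q ℂ) :
    (filtered 1 B K).trace = (B * partialTrace₁ K * Bᴴ).trace := by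
  simp only [Matrix.trace, Matrix.diag_apply, filtered_apply, Matrix.mul_apply, partialTrace₁,
    Matrix.conjTranspose_apply, Matrix.of_apply, sum_Q, Fin.sum_univ_two, Matrix.one_apply]
  simp
  ring

/-- If `Tr A R A†` is minimal at `A = 1` among matrices of determinant one, then `R` is a multiple
of the identity: for a suitable `A`, minimality says that the squared difference of the eigenvalues
of `R` is at most zero. -/
theorem eq_of_trace_minimal {R : Matrix (Fin 2) (Fin 2) ℂ} (hR : R.IsHermitian)
    (h00 : 0 ≤ (R 0 0).re) (h11 : 0 ≤ (R 1 1).re) (hpos : 0 < R.trace.re)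
    (hmin : ∀ A : Matrix (Fin 2) (Fin 2) ℂ, A.det = 1 → R.trace.re ≤ (A * R * Aᴴ).trace.re) :
    R 0 0 = R 1 1 ∧ R 0 1 = 0 := by
  set a := (R 0 0).re
  set d := (R 1 1).re
  have hself : ∀ i, R i i = ((R i i).re : ℂ) := fun i => (hR.coe_re_apply_self i).symm
  have h10 : R 1 0 = star (R 0 1) := (hR.apply 1 0).symm
  have htr : R.trace.re = a + d := by rw [Matrix.trace_fin_two, Complex.add_re]
  rw [htr] at hpos hmin
  -- The two-parameter family of lower triangular matrices suffices.
  have hfam : ∀ (s : ℝ) (γ : ℂ), s ≠ 0 → a + d ≤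
      s ^ 2 * a + (‖γ‖ ^ 2 * a + 2 * (γ * R 0 1).re + d) / s ^ 2 := fun s γ hs => by
    have hs' : (s : ℂ) ≠ 0 := Complex.ofReal_ne_zero.2 hs
    have h := hmin !![(s : ℂ), 0; γ / s, (s : ℂ)⁻¹] (by
      rw [Matrix.det_fin_two_of, mul_inv_cancel₀ hs', zero_mul, sub_zero])
    refine h.trans_eq ?_
    have e : (!![(s : ℂ), 0; γ / s, (s : ℂ)⁻¹] * R * !![(s : ℂ), 0; γ / s, (s : ℂ)⁻¹]ᴴ).trace =
        ((s ^ 2 * a + (‖γ‖ ^ 2 * a + 2 * (γ * R 0 1).re + d) / s ^ 2 : ℝ) : ℂ) := by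
      have e2 : ((2 * (γ * R 0 1).re : ℝ) : ℂ) = γ * R 0 1 + star (γ * R 0 1) := by
        rw [Complex.star_def, Complex.add_conj]
      have e3 : ((‖γ‖ ^ 2 : ℝ) : ℂ) = γ * star γ := by
        push_cast; exact (Complex.mul_conj' γ).symm
      rw [Complex.ofReal_add, Complex.ofReal_div, Complex.ofReal_add, Complex.ofReal_add, e2,
        Complex.ofReal_mul, Complex.ofReal_mul, e3, ← hself 0, ← hself 1]
      simp only [Matrix.trace_fin_two, Matrix.mul_apply, Fin.sum_univ_two,
        Matrix.conjTranspose_apply, h10, star_mul']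
      simp
      field_simp
      ring
    rw [e, Complex.ofReal_re]
  have ha : 0 < a := by
    refine h00.lt_of_ne fun h => ?_
    have h1 := hfam 2 0 two_ne_zero
    rw [← h] at h1 hpos
    simp at h1
    linarith
  set b := R 0 1
  have hcomplete : ‖-(star b / (a : ℂ))‖ ^ 2 * a + 2 * (-(star b / (a : ℂ)) * b).re + d =
      d - ‖b‖ ^ 2 / a := by
    have e1 : -(star b / (a : ℂ)) * b = ((-(‖b‖ ^ 2 / a) : ℝ) : ℂ) := by
      push_cast
      rw [← Complex.mul_conj', Complex.star_def]; ring
    rw [e1, Complex.ofReal_re, norm_neg, norm_div, norm_star, Complex.norm_real,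
      Real.norm_of_nonneg ha.le]
    field_simp
    ring
  -- The off-diagonal entry of `A` completes the square; its diagonal moves `R 0 0` to the mean.
  have h2 := hfam (√((a + d) / (2 * a))) (-(star b / (a : ℂ))) (Real.sqrt_pos.2 (by positivity)).ne'
  rw [hcomplete, Real.sq_sqrt (by positivity)] at h2
  have h3 : (a + d) / (2 * a) * a + (d - ‖b‖ ^ 2 / a) / ((a + d) / (2 * a)) =
      (a + d) / 2 + 2 * (a * d - ‖b‖ ^ 2) / (a + d) := by
    field_simp
  rw [h3] at h2
  have h4 : (a + d) / 2 ≤ 2 * (a * d - ‖b‖ ^ 2) / (a + d) := by linarith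
  rw [le_div_iff₀ hpos] at h4
  have hb : ‖b‖ ^ 2 = 0 := by nlinarith [sq_nonneg (a - d), sq_nonneg ‖b‖]
  have had : a = d := by nlinarith [sq_nonneg (a - d), sq_nonneg ‖b‖]
  exact ⟨by rw [hself 0, hself 1]; exact congrArg _ had, by simpa using hb⟩

/-! ### Orthonormal frames of quaternions -/

/-- The quaternion with given components. -/
def quat (a b c d : ℝ) : Quaternion ℝ := ⟨a, b, c, d⟩

@[simp] theorem quat_re (a b c d : ℝ) : (quat a b c d).re = a := rfl
@[simp] theorem quat_imI (a b c d : ℝ) : (quat a b c d).imI = b := rfl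
@[simp] theorem quat_imJ (a b c d : ℝ) : (quat a b c d).imJ = c := rfl
@[simp] theorem quat_imK (a b c d : ℝ) : (quat a b c d).imK = d := rfl
@[simp] theorem quat_one_re : (1 : Quaternion ℝ).re = 1 := rfl
@[simp] theorem quat_one_imI : (1 : Quaternion ℝ).imI = 0 := rfl
@[simp] theorem quat_one_imJ : (1 : Quaternion ℝ).imJ = 0 := rfl
@[simp] theorem quat_one_imK : (1 : Quaternion ℝ).imK = 0 := rfl
@[simp] theorem quat_zero_re : (0 : Quaternion ℝ).re = 0 := rfl
@[simp] theorem quat_zero_imI : (0 : Quaternion ℝ).imI = 0 := rfl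

theorem re_eq_of_eq {x y : Quaternion ℝ} (h : x = y) : x.re = y.re := by rw [h]

theorem imI_eq_of_eq {x y : Quaternion ℝ} (h : x = y) : x.imI = y.imI := by rw [h]

/-- The standard representation of the quaternions by complex `2 × 2` matrices. -/
noncomputable def quatMatrix (x : Quaternion ℝ) : Matrix (Fin 2) (Fin 2) ℂ :=
  !![⟨x.re, x.imI⟩, ⟨x.imJ, x.imK⟩; ⟨-x.imJ, x.imK⟩, ⟨x.re, -x.imI⟩]

theorem quatMatrix_mul (x y : Quaternion ℝ) :
    quatMatrix (x * y) = quatMatrix x * quatMatrix y := by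
  ext i j
  fin_cases i <;> fin_cases j <;> apply Complex.ext <;>
    simp [quatMatrix, Matrix.mul_apply, Fin.sum_univ_two] <;> ring

theorem det_quatMatrix (x : Quaternion ℝ) :
    (quatMatrix x).det = ((x.re ^ 2 + x.imI ^ 2 + x.imJ ^ 2 + x.imK ^ 2 : ℝ) : ℂ) := by
  rw [quatMatrix, Matrix.det_fin_two_of]
  apply Complex.ext <;> simp [sq] <;> ring

theorem det_quatMatrix_ne_zero {x : Quaternion ℝ} (hx : star x * x = 1) :
    (quatMatrix x).det ≠ 0 := by
  have h := re_eq_of_eq hx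
  simp at h
  rw [det_quatMatrix, Complex.ofReal_ne_zero]
  nlinarith

/-- The quaternion `x` as a vector of `ℂ² ⊗ ℂ²`: its normalized `2 × 2` matrix, read as a
coefficient matrix. Left and right multiplication by quaternions then act on the two qubits. -/
noncomputable def quatVector (x : Quaternion ℝ) : Q → ℂ := fun q =>
  quatMatrix x q.1 q.2 * ((√2 : ℝ) : ℂ)⁻¹

theorem kronecker_mulVec_quatVector (p r x : Quaternion ℝ) :
    (quatMatrix p ⊗ₖ (quatMatrix r)ᵀ) *ᵥ quatVector x = quatVector (p * x * r) := by
  ext ⟨i, j⟩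
  simp only [Matrix.mulVec, dotProduct, sum_Q, quatMatrix_mul, Matrix.mul_apply, Fin.sum_univ_two,
    Matrix.kroneckerMap_apply, Matrix.transpose_apply, quatVector]
  ring

theorem exists_unit_quaternion {x : Quaternion ℝ} (hx : x ≠ 0) :
    ∃ c : ℝ, star (c • x) * (c • x) = 1 := by
  have h0 : ‖x‖ ≠ 0 := norm_ne_zero_iff.2 hx
  refine ⟨‖x‖⁻¹, ?_⟩
  have h := Quaternion.star_mul_self (‖x‖⁻¹ • x)
  rw [h, Quaternion.normSq_eq_norm_mul_self, norm_smul, norm_inv, norm_norm, inv_mul_cancel₀ h0]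
  simp

theorem mul_star_re_comm (p x : Quaternion ℝ) (hp : star p * p = 1) :
    (p * x * star p).re = x.re := by
  have h := re_eq_of_eq hp
  simp at h
  simp
  linear_combination x.re * h

/-- Unit imaginary quaternions are conjugate to `i`. -/
theorem exists_conj_eq_I (u : Quaternion ℝ) (h0 : u.re = 0) (h1 : u * star u = 1) :
    ∃ p : Quaternion ℝ, star p * p = 1 ∧ p * u = quat 0 1 0 0 * p := by
  have hn := re_eq_of_eq h1
  simp [h0] at hn
  by_cases h : quat 0 1 0 0 + u = 0
  · have hu : u = -(quat 0 1 0 0) := by rw [eq_neg_iff_add_eq_zero, add_comm]; exact h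
    refine ⟨quat 0 0 1 0, ?_, ?_⟩
    · apply Quaternion.ext <;> simp
    · rw [hu]; apply Quaternion.ext <;> simp
  · obtain ⟨c, hc⟩ := exists_unit_quaternion h
    refine ⟨_, hc, ?_⟩
    rw [smul_mul_assoc, mul_smul_comm]
    congr 1
    apply Quaternion.ext <;> simp [h0] <;> linarith

/-- Unit quaternions orthogonal to `1` and `i` are conjugate to `j` by quaternions commuting
with `i`. -/
theorem exists_conj_eq_J (u : Quaternion ℝ) (h0 : u.re = 0) (hI : u.imI = 0)
    (h1 : u * star u = 1) : ∃ p : Quaternion ℝ, star p * p = 1 ∧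
      p * quat 0 1 0 0 = quat 0 1 0 0 * p ∧ p * u = quat 0 0 1 0 * p := by
  have hn := re_eq_of_eq h1
  simp [h0, hI] at hn
  by_cases h : (1 : Quaternion ℝ) - quat 0 0 1 0 * u = 0
  · have hJ := re_eq_of_eq h
    have hK := imI_eq_of_eq h
    simp at hJ hK
    have hu : u = quat 0 0 (-1) 0 := by
      apply Quaternion.ext
      · exact h0
      · exact hI
      · simp; linarith
      · simp; linarith
    refine ⟨quat 0 1 0 0, ?_, rfl, ?_⟩
    · apply Quaternion.ext <;> simp
    · rw [hu]; apply Quaternion.ext <;> simp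
  · obtain ⟨c, hc⟩ := exists_unit_quaternion h
    refine ⟨_, hc, ?_, ?_⟩
    · rw [smul_mul_assoc, mul_smul_comm]
      congr 1
      apply Quaternion.ext <;> simp [h0, hI]
    · rw [smul_mul_assoc, mul_smul_comm]
      congr 1
      apply Quaternion.ext <;> simp [h0, hI] <;> linarith

/-- `SU(2) × SU(2)` acts transitively on orthonormal frames of the quaternions, up to the
orientation, which is the sign of the last vector. -/
theorem exists_frame_eq (q : Fin 4 → Quaternion ℝ)
    (hq : ∀ m n, (q m * star (q n)).re = if m = n then 1 else 0) :
    ∃ p r : Quaternion ℝ, star p * p = 1 ∧ star r * r = 1 ∧ p * q 0 * r = 1 ∧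
      p * q 1 * r = quat 0 1 0 0 ∧ p * q 2 * r = quat 0 0 1 0 ∧
      (p * q 3 * r = quat 0 0 0 1 ∨ p * q 3 * r = quat 0 0 0 (-1)) := by
  have unit : ∀ x : Quaternion ℝ, (x * star x).re = 1 → x * star x = 1 := fun x hx => by
    rw [Quaternion.self_mul_star] at hx ⊢
    have : Quaternion.normSq x = 1 := hx
    rw [this]; simp
  have comm : ∀ x : Quaternion ℝ, x * star x = 1 → star x * x = 1 := fun x hx => by
    rw [Quaternion.star_mul_self, ← Quaternion.self_mul_star, hx]
  have comm' : ∀ x : Quaternion ℝ, star x * x = 1 → x * star x = 1 := fun x hx => by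
    rw [Quaternion.self_mul_star, ← Quaternion.star_mul_self, hx]
  have hu : ∀ m, q m * star (q m) = 1 := fun m => unit _ (by rw [hq, if_pos rfl])
  have h00 := comm _ (hu 0)
  -- All inner products are preserved by left and right multiplication by unit quaternions.
  have inner : ∀ (p : Quaternion ℝ), star p * p = 1 → ∀ m n,
      ((p * q m * (star (q 0) * star p)) * star (p * q n * (star (q 0) * star p))).re =
        if m = n then 1 else 0 := fun p hp m n => by
    rw [← hq m n, ← mul_star_re_comm p (q m * star (q n)) hp]
    congr 1
    simp only [star_mul, star_star]
    calc _ = p * q m * star (q 0) * (star p * p) * q 0 * star (q n) * star p := by noncomm_ring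
      _ = p * q m * (star (q 0) * q 0) * star (q n) * star p := by rw [hp]; noncomm_ring
      _ = _ := by rw [h00]; noncomm_ring
  have key : ∀ (p : Quaternion ℝ), star p * p = 1 → p * q 0 * (star (q 0) * star p) = 1 :=
    fun p hp => by
      calc _ = p * (q 0 * star (q 0)) * star p := by noncomm_ring
        _ = 1 := by rw [hu, mul_one, comm' p hp]
  obtain ⟨p₁, hp₁, hp₁'⟩ := exists_conj_eq_I (q 1 * star (q 0)) (by rw [hq]; rfl) (by
    rw [star_mul, star_star]
    calc _ = q 1 * (star (q 0) * q 0) * star (q 1) := by noncomm_ring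
      _ = 1 := by rw [h00, mul_one, hu])
  have e1 : p₁ * q 1 * (star (q 0) * star p₁) = quat 0 1 0 0 := by
    calc _ = p₁ * (q 1 * star (q 0)) * star p₁ := by noncomm_ring
      _ = _ := by rw [hp₁', mul_assoc, comm' p₁ hp₁, mul_one]
  obtain ⟨u, hudef⟩ : ∃ u, u = p₁ * q 2 * (star (q 0) * star p₁) := ⟨_, rfl⟩
  have hu0 : u.re = 0 := by
    have h := inner p₁ hp₁ 2 0
    rw [key p₁ hp₁, ← hudef] at h
    simpa using h
  have huI : u.imI = 0 := by
    have h := inner p₁ hp₁ 2 1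
    rw [e1, ← hudef] at h
    simpa [hu0] using h
  obtain ⟨p₂, hp₂, hpI, hpJ⟩ := exists_conj_eq_J u hu0 huI (unit _ (by
    rw [hudef, inner p₁ hp₁ 2 2, if_pos rfl]))
  have hp : star (p₂ * p₁) * (p₂ * p₁) = 1 := by
    rw [star_mul]
    calc _ = star p₁ * (star p₂ * p₂) * p₁ := by noncomm_ring
      _ = 1 := by rw [hp₂, mul_one, hp₁]
  have split : ∀ m, p₂ * p₁ * q m * (star (q 0) * star (p₂ * p₁)) =
      p₂ * (p₁ * q m * (star (q 0) * star p₁)) * star p₂ := fun m => by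
    rw [star_mul]; noncomm_ring
  have f1 : p₂ * p₁ * q 1 * (star (q 0) * star (p₂ * p₁)) = quat 0 1 0 0 := by
    rw [split, e1, hpI, mul_assoc, comm' p₂ hp₂, mul_one]
  have f2 : p₂ * p₁ * q 2 * (star (q 0) * star (p₂ * p₁)) = quat 0 0 1 0 := by
    rw [split, ← hudef, hpJ, mul_assoc, comm' p₂ hp₂, mul_one]
  refine ⟨p₂ * p₁, star (q 0) * star (p₂ * p₁), hp, ?_, key _ hp, f1, f2, ?_⟩
  · rw [star_mul, star_star, star_star]
    calc _ = p₂ * p₁ * (q 0 * star (q 0)) * star (p₂ * p₁) := by noncomm_ring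
      _ = 1 := by rw [hu, mul_one, comm' _ hp]
  · have g0 := inner _ hp 3 0
    have g1 := inner _ hp 3 1
    have g2 := inner _ hp 3 2
    have g3 := inner _ hp 3 3
    rw [key _ hp] at g0
    rw [f1] at g1
    rw [f2] at g2
    generalize p₂ * p₁ * q 3 * (star (q 0) * star (p₂ * p₁)) = w at *
    simp at g0 g1 g2 g3
    rw [g0, g1, g2] at g3
    have hK : (w.imK - 1) * (w.imK + 1) = 0 := by nlinarith
    rcases mul_eq_zero.1 hK with h | h
    · exact Or.inl (by apply Quaternion.ext <;> simp [g0, g1, g2]; linarith)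
    · exact Or.inr (by apply Quaternion.ext <;> simp [g0, g1, g2]; linarith)

/-! ### Operators with maximally mixed marginals -/

/-- The magic basis: the quaternion units as vectors of `ℂ² ⊗ ℂ²`. -/
noncomputable def magicFrame : Matrix Q (Fin 4) ℂ := Matrix.of fun q k =>
  quatVector (![quat 1 0 0 0, quat 0 1 0 0, quat 0 0 1 0, quat 0 0 0 1] k) q

theorem magicFrame_mulVec (c : Fin 4 → ℝ) :
    magicFrame *ᵥ (fun k => (c k : ℂ)) = quatVector (quat (c 0) (c 1) (c 2) (c 3)) := by
  ext ⟨i, j⟩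
  fin_cases i <;> fin_cases j <;> apply Complex.ext <;>
    simp [Matrix.mulVec, dotProduct, magicFrame, Fin.sum_univ_four, quatVector, quatMatrix] <;> ring

theorem magicFrame_conjTranspose_mul : magicFrameᴴ * magicFrame = 1 := by
  have h : √2 / 2 * (√2 / 2) = 1 / 2 := by
    rw [div_mul_div_comm, Real.mul_self_sqrt zero_le_two]; norm_num
  ext k l
  rw [Matrix.mul_apply, sum_Q]
  fin_cases k <;> fin_cases l <;> apply Complex.ext <;>
    simp [magicFrame, quatVector, quatMatrix] <;> linarith

theorem magicFrame_mul_conjTranspose : magicFrame * magicFrameᴴ = 1 :=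
  (Matrix.mul_eq_one_comm_of_card_eq _ _ _ (by simp)).1 magicFrame_conjTranspose_mul

/-- Having both marginals proportional to the identity makes the matrix in the magic basis
symmetric, hence real if it is Hermitian. -/
theorem magicFrame_symm {K : Matrix Q Q ℂ} (h1 : K (0, 0) (0, 0) = K (1, 1) (1, 1))
    (h2 : K (0, 1) (0, 1) = K (1, 0) (1, 0)) (h3 : K (0, 0) (1, 0) + K (0, 1) (1, 1) = 0)
    (h4 : K (0, 0) (0, 1) + K (1, 0) (1, 1) = 0) (h5 : K (1, 0) (0, 0) + K (1, 1) (0, 1) = 0)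
    (h6 : K (0, 1) (0, 0) + K (1, 1) (1, 0) = 0) :
    (magicFrameᴴ * K * magicFrame)ᵀ = magicFrameᴴ * K * magicFrame := by
  have e : ∀ a b : ℝ, (⟨a, b⟩ : ℂ) = a + b * Complex.I := fun a b => by
    apply Complex.ext <;> simp
  ext k l
  simp only [Matrix.transpose_apply, Matrix.mul_apply, sum_Q, magicFrame, quatVector, quatMatrix,
    Matrix.conjTranspose_apply, Matrix.of_apply, e, h1, h2, eq_neg_of_add_eq_zero_right h3,
    eq_neg_of_add_eq_zero_right h4, eq_neg_of_add_eq_zero_right h5, eq_neg_of_add_eq_zero_right h6]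
  fin_cases k <;> fin_cases l <;> simp <;> ring

theorem exists_real_spectral {n : Type*} [Fintype n] [DecidableEq n] {R : Matrix n n ℝ}
    (hR : R.IsHermitian) : ∃ (O : Matrix n n ℝ) (d : n → ℝ), Oᵀ * O = 1 ∧
      R = ∑ m, d m • Matrix.vecMulVec (fun i => O i m) (fun i => O i m) := by
  refine ⟨hR.eigenvectorUnitary, hR.eigenvalues, ?_, ?_⟩
  · have := (Matrix.mem_unitaryGroup_iff'.1 hR.eigenvectorUnitary.2)
    rwa [Matrix.star_eq_conjTranspose, Matrix.conjTranspose_eq_transpose_of_trivial] at this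
  · conv_lhs => rw [hR.spectral_theorem, Unitary.conjStarAlgAut_apply]
    ext i j
    rw [Matrix.mul_apply]
    simp only [Matrix.sum_apply, Matrix.smul_apply, Matrix.vecMulVec_apply,
      Matrix.mul_diagonal, Matrix.star_apply, star_trivial, smul_eq_mul]
    refine Finset.sum_congr rfl fun m _ => ?_
    simp
    ring

/-- The eigenvectors can be chosen real in the magic basis, that is, as an orthonormal frame of
quaternions. -/
theorem exists_sum_quatVector {K : Matrix Q Q ℂ} (hK : K.IsHermitian)
    (h : (magicFrameᴴ * K * magicFrame)ᵀ = magicFrameᴴ * K * magicFrame) :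
    ∃ (d : Fin 4 → ℝ) (q : Fin 4 → Quaternion ℝ),
      (∀ m n, (q m * star (q n)).re = if m = n then 1 else 0) ∧
      K = ∑ m, d m • ketbra (quatVector (q m)) := by
  obtain ⟨S, hS⟩ : ∃ S, S = magicFrameᴴ * K * magicFrame := ⟨_, rfl⟩
  rw [← hS] at h
  have hSH : Sᴴ = S := by
    rw [hS]; simp only [Matrix.conjTranspose_mul, Matrix.conjTranspose_conjTranspose, hK.eq,
      Matrix.mul_assoc]
  have hreal : ∀ i j, S i j = ((S i j).re : ℂ) := fun i j => by
    have h1 : star (S j i) = S i j := congrFun (congrFun hSH i) j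
    have h2 : S j i = S i j := congrFun (congrFun h i) j
    rw [h2] at h1
    exact (Complex.conj_eq_iff_re.1 h1).symm
  have hR : (Matrix.of fun i j => (S i j).re : Matrix (Fin 4) (Fin 4) ℝ).IsHermitian := by
    ext i j
    have h2 : S j i = S i j := congrFun (congrFun h i) j
    simp [h2]
  obtain ⟨O, d, hO, hd⟩ := exists_real_spectral hR
  refine ⟨d, fun m => quat (O 0 m) (O 1 m) (O 2 m) (O 3 m), fun m n => ?_, ?_⟩
  · have h1 : (Oᵀ * O) m n = (1 : Matrix (Fin 4) (Fin 4) ℝ) m n := by rw [hO]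
    rw [Matrix.mul_apply, Fin.sum_univ_four, Matrix.one_apply] at h1
    rw [← h1]
    simp
  · have hKS : K = magicFrame * S * magicFrameᴴ := by
      rw [hS]
      calc K = (magicFrame * magicFrameᴴ) * K * (magicFrame * magicFrameᴴ) := by
            rw [magicFrame_mul_conjTranspose, Matrix.one_mul, Matrix.mul_one]
        _ = _ := by simp only [Matrix.mul_assoc]
    have hSd : S = ∑ m, d m • ketbra (fun i => (O i m : ℂ)) := by
      ext i j
      have := congrFun (congrFun hd i) j
      rw [Matrix.of_apply] at this
      rw [hreal, this]
      simp [Matrix.sum_apply, ketbra, Matrix.vecMulVec_apply]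
    rw [hKS, hSd, Matrix.mul_sum, Matrix.sum_mul]
    refine Finset.sum_congr rfl fun m _ => ?_
    rw [Matrix.mul_smul, Matrix.smul_mul, ← magicFrame_mulVec fun i => O i m]
    congr 1
    rw [ketbra, ketbra, Matrix.mul_vecMulVec, Matrix.vecMulVec_mul, Matrix.star_mulVec]

theorem quatVector_one : quatVector 1 = bellVector 0 0 := by
  ext ⟨i, j⟩
  fin_cases i <;> fin_cases j <;> apply Complex.ext <;>
    simp [quatVector, quatMatrix, bellVector] 

theorem quatVector_I : quatVector (quat 0 1 0 0) = Complex.I • bellVector 0 1 := by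
  ext ⟨i, j⟩
  fin_cases i <;> fin_cases j <;> apply Complex.ext <;>
    simp [quatVector, quatMatrix, bellVector, neg_div] 

theorem quatVector_J : quatVector (quat 0 0 1 0) = bellVector 1 1 := by
  ext ⟨i, j⟩
  fin_cases i <;> fin_cases j <;> apply Complex.ext <;>
    simp [quatVector, quatMatrix, bellVector, neg_div] 

theorem quatVector_K (c : ℝ) :
    quatVector (quat 0 0 0 c) = (c * Complex.I) • bellVector 1 0 := by
  ext ⟨i, j⟩
  fin_cases i <;> fin_cases j <;> apply Complex.ext <;>
    simp [quatVector, quatMatrix, bellVector]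

/-- A positive operator with symmetric matrix in the magic basis is Bell-diagonal up to local
unitaries. -/
theorem exists_filtered_eq_bellDiag_of_symm {K : Matrix Q Q ℂ} (hK : K.PosSemidef)
    (h : (magicFrameᴴ * K * magicFrame)ᵀ = magicFrameᴴ * K * magicFrame) :
    ∃ (A B : Matrix (Fin 2) (Fin 2) ℂ) (w : Q → ℝ), A.det ≠ 0 ∧ B.det ≠ 0 ∧ (∀ k, 0 ≤ w k) ∧
      filtered A B K = bellDiag w := by
  obtain ⟨d, q, hq, hKq⟩ := exists_sum_quatVector hK.1 h
  obtain ⟨p, r, hp, hr, h0, h1, h2, h3⟩ := exists_frame_eq q hq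
  obtain ⟨c, hc, h3⟩ : ∃ c : ℝ, ‖c‖ = 1 ∧ p * q 3 * r = quat 0 0 0 c := by
    rcases h3 with h3 | h3
    · exact ⟨1, by simp, h3⟩
    · exact ⟨-1, by simp, h3⟩
  have hfilt : filtered (quatMatrix p) (quatMatrix r)ᵀ K =
      bellDiag (fun k => ![![d 0, d 1], ![d 3, d 2]] k.1 k.2) := by
    have hterm : ∀ m, filtered (quatMatrix p) (quatMatrix r)ᵀ (d m • ketbra (quatVector (q m))) =
        d m • ketbra (quatVector (p * q m * r)) := fun m => by
      rw [← kronecker_mulVec_quatVector, ← filtered_ketbra]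
      simp [filtered]
    rw [hKq, filtered_sum]
    simp only [hterm]
    rw [Fin.sum_univ_four, h0, h1, h2, h3, quatVector_one, quatVector_I, quatVector_J,
      quatVector_K, ketbra_smul, ketbra_smul, norm_mul, Complex.norm_I, Complex.norm_real, hc,
      bellDiag, sum_Q]
    simp
    abel
  refine ⟨_, _, _, det_quatMatrix_ne_zero hp, ?_, fun k => ?_, hfilt⟩
  · rw [Matrix.det_transpose]
    exact det_quatMatrix_ne_zero hr
  · have hpos := (posSemidef_filtered hK (quatMatrix p) (quatMatrix r)ᵀ).dotProduct_mulVec_nonneg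
      (bellVector k.1 k.2)
    rw [hfilt] at hpos
    obtain ⟨w, hw⟩ : ∃ w : Q → ℝ, w = fun k => ![![d 0, d 1], ![d 3, d 2]] k.1 k.2 := ⟨_, rfl⟩
    rw [← hw] at hpos
    rw [← show w k = ![![d 0, d 1], ![d 3, d 2]] k.1 k.2 by rw [hw]]
    have hexp := expectation_sum (bellVector k.1 k.2) (star_bellVector _ _) w
      (fun l => bellVector l.1 l.2)
    have heq : star (bellVector k.1 k.2) ⬝ᵥ (bellDiag w *ᵥ bellVector k.1 k.2) = (w k : ℂ) := by
      rw [show star (bellVector k.1 k.2) = bellVector k.1 k.2 from funext (star_bellVector _ _)]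
      simp only [dotProduct, Matrix.mulVec, Finset.mul_sum, ← mul_assoc]
      rw [bellDiag, hexp]
      simp only [bellVector_dotProduct]
      congr 1
      rw [Finset.sum_eq_single k]
      · simp
      · intro l _ hl; simp [Ne.symm hl]
      · simp
    rw [heq] at hpos
    exact_mod_cast hpos

/-- Bell-diagonal normal form: minimality of the trace makes both marginals multiples of the
identity. -/
theorem exists_filtered_eq_bellDiag {ρ : Matrix Q Q ℂ} (hρ : ρ.PosSemidef)
    (hker : ¬ ∃ v ∈ kernel ρ, IsProductVector v) :
    ∃ (A B : Matrix (Fin 2) (Fin 2) ℂ) (w : Q → ℝ), A.det ≠ 0 ∧ B.det ≠ 0 ∧ (∀ k, 0 ≤ w k) ∧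
      filtered A B ρ = bellDiag w := by
  obtain ⟨A₀, B₀, hA₀, hB₀, hmin⟩ := exists_minimizer hρ hker
  have hne : ∀ {A : Matrix (Fin 2) (Fin 2) ℂ}, A.det = 1 → A ≠ 0 := fun h h0 => by
    rw [h0, Matrix.det_zero] at h; exact zero_ne_one h
  obtain ⟨K, hKdef⟩ : ∃ K, K = filtered A₀ B₀ ρ := ⟨_, rfl⟩
  have hK : K.PosSemidef := hKdef ▸ posSemidef_filtered hρ A₀ B₀
  have hpos : 0 < K.trace.re := hKdef ▸ trace_filtered_pos hρ hker (hne hA₀) (hne hB₀)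
  have hminK : ∀ A B : Matrix (Fin 2) (Fin 2) ℂ, A.det = 1 → B.det = 1 →
      K.trace.re ≤ (filtered A B K).trace.re := fun A B hA hB => by
    rw [hKdef, filtered_filtered]
    exact hmin _ _ (by rw [Matrix.det_mul, hA, hA₀, one_mul])
      (by rw [Matrix.det_mul, hB, hB₀, one_mul])
  have hdiag : ∀ q, 0 ≤ (K q q).re := fun q => (Complex.nonneg_iff.1 (hK.diag_nonneg (i := q))).1
  have hstar : ∀ p q, star (K p q) = K q p := fun p q => hK.1.apply q p
  have htr2 : (partialTrace₂ K).trace = K.trace := by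
    simp [Matrix.trace, partialTrace₂, sum_Q, Fin.sum_univ_two]
  have htr1 : (partialTrace₁ K).trace = K.trace := by
    simp [Matrix.trace, partialTrace₁, sum_Q, Fin.sum_univ_two]; ring
  obtain ⟨a1, a2⟩ := eq_of_trace_minimal (R := partialTrace₂ K)
    (by ext i j; simp only [partialTrace₂, Matrix.conjTranspose_apply, Matrix.of_apply, star_sum, hstar])
    (by simp [partialTrace₂]; exact add_nonneg (hdiag _) (hdiag _))
    (by simp [partialTrace₂]; exact add_nonneg (hdiag _) (hdiag _))
    (by rwa [htr2]) (fun A hA => by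
      rw [htr2, ← trace_filtered_one_right]; exact hminK A 1 hA (by simp))
  obtain ⟨b1, b2⟩ := eq_of_trace_minimal (R := partialTrace₁ K)
    (by ext i j; simp only [partialTrace₁, Matrix.conjTranspose_apply, Matrix.of_apply, star_sum, hstar])
    (by simp [partialTrace₁]; exact add_nonneg (hdiag _) (hdiag _))
    (by simp [partialTrace₁]; exact add_nonneg (hdiag _) (hdiag _))
    (by rwa [htr1]) (fun B hB => by
      rw [htr1, ← trace_filtered_one_left]; exact hminK 1 B (by simp) hB)
  simp only [partialTrace₁, partialTrace₂, Matrix.of_apply, Fin.sum_univ_two] at a1 a2 b1 b2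
  have a3 := congrArg star a2
  have b3 := congrArg star b2
  simp only [star_add, star_zero, hstar] at a3 b3
  obtain ⟨A, B, w, hA, hB, hw, hfilt⟩ := exists_filtered_eq_bellDiag_of_symm hK
    (magicFrame_symm (by linear_combination (a1 + b1) / 2) (by linear_combination (a1 - b1) / 2)
      a2 b2 a3 b3)
  refine ⟨A * A₀, B * B₀, w, ?_, ?_, hw, ?_⟩
  · rwa [Matrix.det_mul, hA₀, mul_one]
  · rwa [Matrix.det_mul, hB₀, mul_one]
  · rw [← filtered_filtered, ← hKdef, hfilt]

/-! ### The classification -/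

/-- A plane meets the quadric of product vectors, because a binary quadratic form over `ℂ` has a
non-trivial zero. -/
theorem exists_productVector_mem {U : Submodule ℂ (Q → ℂ)} {u v : Q → ℂ} (hu : u ∈ U)
    (hv : v ∈ U) (h : LinearIndependent ℂ ![u, v]) : ∃ x ∈ U, IsProductVector x := by
  have hcomb : ∀ s t : ℂ, (s ≠ 0 ∨ t ≠ 0) →
      s ^ 2 * tau u u + 2 * s * t * tau u v + t ^ 2 * tau v v = 0 →
      ∃ x ∈ U, IsProductVector x := fun s t hst h0 => by
    refine ⟨s • u + t • v, U.add_mem (U.smul_mem s hu) (U.smul_mem t hv),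
      isProductVector_iff.2 ⟨fun hx => ?_, by rw [tau_self_combination, h0]⟩⟩
    have := LinearIndependent.pair_iff.1 h s t hx
    exact hst.elim (· this.1) (· this.2)
  by_cases h1 : tau u u = 0
  · exact hcomb 1 0 (Or.inl one_ne_zero) (by rw [h1]; ring)
  · obtain ⟨z, hz⟩ := IsAlgClosed.exists_pow_nat_eq (tau u v ^ 2 - tau u u * tau v v) two_pos
    exact hcomb (z - tau u v) (tau u u) (Or.inr h1) (by linear_combination tau u u * hz)

theorem rank_add_finrank_kernel (ρ : Matrix Q Q ℂ) :
    ρ.rank + Module.finrank ℂ (kernel ρ) = 4 := by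
  have h := LinearMap.finrank_range_add_finrank_ker ρ.mulVecLin
  rw [Module.finrank_fintype_fun_eq_card] at h
  exact h

/-- A kernel of dimension two or more would contain a product vector. -/
theorem three_le_rank {ρ : Matrix Q Q ℂ} (hker : ¬ ∃ v ∈ kernel ρ, IsProductVector v) :
    3 ≤ ρ.rank := by
  by_contra! hlt
  have h2 : 2 ≤ Module.finrank ℂ (kernel ρ) := by
    have := rank_add_finrank_kernel ρ
    omega
  obtain ⟨f, hf⟩ := exists_linearIndependent_of_le_finrank h2
  refine hker (exists_productVector_mem (f 0).2 (f 1).2 ?_)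
  have := hf.map' (kernel ρ).subtype (Submodule.ker_subtype _)
  rwa [show ![((f 0 : kernel ρ) : Q → ℂ), f 1] = (kernel ρ).subtype ∘ f by
    ext i : 1; fin_cases i <;> rfl]

/-- In the Bell-diagonal normal form one weight dominates, because the state is entangled, and it is
not the only one, because of the rank. -/
theorem incompletelyDistillable_of_kernel {ρ : Matrix Q Q ℂ} (hρ : IsEntangled ρ)
    (hker : ¬ ∃ v ∈ kernel ρ, IsProductVector v) : IncompletelyDistillable ρ := by
  obtain ⟨⟨hpos, htr⟩, hsep⟩ := hρ
  obtain ⟨A, B, w, hA, hB, hw, hfilt⟩ := exists_filtered_eq_bellDiag hpos hker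
  have hrank := three_le_rank hker
  refine incompletelyDistillable_of_filtered hA hB ?_
  rw [hfilt]
  obtain ⟨k₀, hk₀⟩ : ∃ k₀, ∑ k, w k < 2 * w k₀ := by
    by_contra! hle
    exact hsep (isSeparable_of_eq_filtered_bellDiag hw hle
      (by rw [← hfilt]; exact eq_filtered_inv hA hB ρ) htr)
  refine incompletelyDistillable_bellDiag hw hk₀ (lt_of_not_ge fun hge => ?_)
  -- A single non-zero weight would make the rank at most one.
  have hzero : ∀ k, k ≠ k₀ → w k = 0 := fun k hk => by
    have h1 := Finset.sum_le_sum_of_subset_of_nonneg (Finset.subset_univ {k₀, k})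
      (fun i _ _ => hw i)
    rw [Finset.sum_pair hk.symm] at h1
    linarith [hw k]
  have h1 := rank_bellDiag w
  rw [← hfilt, rank_filtered hA hB, Finset.sum_eq_single k₀ (fun k _ hk => by simp [hzero k hk])
    (by simp)] at h1
  split_ifs at h1 <;> omega

theorem kernel_eq_span {ρ : Matrix Q Q ℂ} (hrank : ρ.rank = 3) {v : Q → ℂ} (hv : v ≠ 0)
    (hker : v ∈ kernel ρ) : kernel ρ = Submodule.span ℂ {v} := by
  refine (Submodule.eq_of_le_of_finrank_eq
    ((Submodule.span_singleton_le_iff_mem v _).2 hker) ?_).symm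
  rw [finrank_span_singleton hv]
  have := rank_add_finrank_kernel ρ
  omega

/-- The classification of the entangled states of two qubits. -/
theorem classification {ρ : Matrix Q Q ℂ} (hent : IsEntangled ρ) :
    (ρ.rank = 4 ∧ IncompletelyDistillable ρ) ∨
    (ρ.rank = 3 ∧
      (((¬ ∃ v ∈ kernel ρ, IsProductVector v) ∧ IncompletelyDistillable ρ) ∨
        ((∃ v, IsProductVector v ∧ kernel ρ = Submodule.span ℂ {v}) ∧
          IncompletelyQuasiDistillable ρ))) ∨
    (ρ.rank = 2 ∧
      (((productLines (support ρ)).encard = 1 ∧ QuasiDistillable ρ) ∨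
        ((productLines (support ρ)).encard = 2 ∧ IncompletelyDistillable ρ))) ∨
    (ρ.rank = 1 ∧ Distillable ρ) := by
  by_cases hker : ∃ v ∈ kernel ρ, IsProductVector v
  · obtain ⟨v, hv, hprod⟩ := hker
    rcases classification_of_productVector_mem_kernel hent.1.1 hent.1.2 hent.2 hprod hv with
      ⟨hr, h⟩ | ⟨hr, h⟩ | ⟨hr, h⟩ | h
    · exact Or.inr (Or.inl ⟨hr, Or.inr ⟨⟨v, hprod, kernel_eq_span hr hprod.1 hv⟩, h⟩⟩)
    · exact Or.inr (Or.inr (Or.inl ⟨hr, Or.inl h⟩))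
    · exact Or.inr (Or.inr (Or.inl ⟨hr, Or.inr h⟩))
    · exact Or.inr (Or.inr (Or.inr h))
  · have h := incompletelyDistillable_of_kernel hent hker
    have h3 := three_le_rank hker
    have h4 := rank_add_finrank_kernel ρ
    rcases (by omega : ρ.rank = 4 ∨ ρ.rank = 3) with hr | hr
    · exact Or.inl ⟨hr, h⟩
    · exact Or.inr (Or.inl ⟨hr, Or.inl ⟨hker, h⟩⟩)

end TwoQubit

theorem mainTheorem1 (ρ : Matrix (Fin 2 × Fin 2) (Fin 2 × Fin 2) ℂ)
    (hent : TwoQubit.IsEntangled ρ) (hbell : ¬ TwoQubit.IsBellDiagonal ρ) :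
    (ρ.rank = 4 ∧ TwoQubit.IncompletelyDistillable ρ) ∨
    (ρ.rank = 3 ∧
      (((¬ ∃ v ∈ TwoQubit.kernel ρ, TwoQubit.IsProductVector v) ∧
          TwoQubit.IncompletelyDistillable ρ) ∨
        ((∃ v, TwoQubit.IsProductVector v ∧ TwoQubit.kernel ρ = Submodule.span ℂ {v}) ∧
          TwoQubit.IncompletelyQuasiDistillable ρ))) ∨
    (ρ.rank = 2 ∧
      (((TwoQubit.productLines (TwoQubit.support ρ)).encard = 1 ∧
          TwoQubit.QuasiDistillable ρ) ∨
        ((TwoQubit.productLines (TwoQubit.support ρ)).encard = 2 ∧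
          TwoQubit.IncompletelyDistillable ρ))) ∨
    (ρ.rank = 1 ∧ TwoQubit.Distillable ρ) :=
  TwoQubit.classification hent
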